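/- **Setting.** Let $(M,g)$ be a smooth Lorentzian manifold of dimension $1+n$, $n\ge 2$, with signature $(-,+,\dots,+)$. Let $(t,z)\in(-T,T)\times Z$, $Z\subset\mathbb R^n$ open, be semigeodesic coordinates on an open subset of $M$, so that $g=-dt^2+g'(t,z)$ with $g'(t,\cdot)$ a Riemannian metric on $Z$, and put $h=g'(0,\cdot)$. Let $A\subset\mathbb R^{n-1}$ be open and let $(z,a)\mapsto(z,\theta(z,a))$, $(z,a)\in Z\times A$, be (the inverse of) smooth local coordinates on the unit sphere bundle $SZ$ of $h$; in particular $(\theta,\theta)_h=1$. Let $\ell>0$, and suppose that for all $(z,a)\in\mathcal M:=Z\times A$ the geodesic $\gamma_{z,a}$ with $\gamma_{z,a}(0)=(0,z)$ and $\dot\gamma_{z,a}(0)=(1,\theta(z,a))$ is defined on $[0,\ell]$, depending smoothly on $(z,a,s)$ up to the end points $s=0,\ell$. Each $\gamma_{z,a}$ is lightlike. Write $M_j(s)=\partial_{z^j}\gamma_{z,a}(s)$, $J_k(s)=\partial_{a^k}\gamma_{z,a}(s)$, $\Gamma(s)=s\dot\gamma_{z,a}(s)$, let $'$ denote the covariant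 derivative along $\gamma_{z,a}$, and set $$\mathcal J=\operatorname{span}\{M_1,\dots,M_n,J_1,\dots,J_{n-1},\dot\gamma_{z,a},\Gamma\},\qquad \mathcal J'_{s_1,s_2}=\{J'\mid J\in\mathcal J,\ J(s_1)=J(s_2)=0\},$$ the elements of $\mathcal J'_{s_1,s_2}$ being regarded as vector fields along $\gamma_{z,a}:[0,\ell]\to M$. For a covector $\xi$ let $\xi_*$ be the vector with $(\xi_*,\cdot)_g=\langle\xi,\cdot\rangle$; $\xi$ is called spacelike if $(\xi_*,\xi_*)_g>0$ and lightlike if $(\xi_*,\xi_*)_g=0$ (so $\xi=0$ counts as lightlike). For $\zeta\in\mathbb R^n$, $\alpha\in\mathbb R^{n-1}$, a pair $(s,\xi)$ with $s\in[0,\ell]$, $\xi\in T^*_{\gamma_{z,a}(s)}M$ *solves* $(\ast)$ if $$\zeta_j=\langle\xi,M_j(s)\rangle\ (1\le j\le n),\qquad \alpha_k=\langle\xi,J_k(s)\rangle\ (1\le k\le n-1),\qquad \langle\xi,\dot\gamma_{z,a}(s)\rangle=0.\tag{$\ast$}$$ **Lemma.** Let $(z,a,\zeta,\alpha)\in T^*\mathcal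 M$ and let $(s_1,\xi^1)$, $(s_2,\xi^2)$ solve $(\ast)$. Then: (i) Either $\xi^1$ and $\xi^2$ are both spacelike or they are both lightlike. (ii) If $s_1=s_2$ then $\xi^1=\xi^2$. (iii) If $s_1\ne s_2$ then there are unique $J'\in\mathcal J'_{s_1,s_2}$ and $\lambda\in\mathbb R$ such that $$\xi^j_*=J'(s_j)+\lambda\dot\gamma_{z,a}(s_j),\qquad j=1,2,$$ and $\xi^1$ and $\xi^2$ are spacelike if and only if $J'\ne0$. Moreover, for all $(z,a)\in\mathcal M$ and all $s_1\ne s_2$ in $[0,\ell]$: the set $\mathcal J'_{s_1,s_2}$ consists of the covariant derivatives of all Jacobi fields (solutions of $J''+R(J,\dot\gamma_{z,a})\dot\gamma_{z,a}=0$) along $\gamma_{z,a}:[0,\ell]\to M$ that vanish at $s_1$ and $s_2$; and there are $(\zeta,\alpha)$ and spacelike $\xi^1,\xi^2$ such that $(s_1,\xi^1)$ and $(s_2,\xi^2)$ both solve $(\ast)$ if and only if $\gamma_{z,a}(s_1)$ and $\gamma_{z,a}(s_2)$ are conjugate along $\gamma_{z,a}$, that is, some Jacobi field along $\gamma_{z,a}:[0,\ell]\to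 M$ that does not vanish identically vanishes at $s_1$ and $s_2$. -/

import Mathlib

open Set
open scoped Manifold ContDiff

noncomputable section

/-- A smooth Lorentzian metric of signature `(-,+,…,+)` on a smooth manifold of dimension `1 + n`. -/
structure LorentzianMetric (n : ℕ) (M : Type*) [TopologicalSpace M]
    [ChartedSpace (EuclideanSpace ℝ (Fin (n + 1))) M] [IsManifold (𝓡 (n + 1)) ∞ M] where
  /-- The scalar product `(v, w)_g` on each tangent space. -/
  inner (x : M) : TangentSpace (𝓡 (n + 1)) x →L[ℝ] TangentSpace (𝓡 (n + 1)) x →L[ℝ] ℝ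
  symm (x : M) (v w : TangentSpace (𝓡 (n + 1)) x) : inner x v w = inner x w v
  /-- Every tangent space has a basis in which the scalar product is `diag (-1, 1, …, 1)`. -/
  signature (x : M) : ∃ b : Module.Basis (Fin (n + 1)) ℝ (TangentSpace (𝓡 (n + 1)) x),
    ∀ i j, inner x (b i) (b j) = if i = j then (if i = 0 then -1 else 1) else 0
  contMDiff : ContMDiff (𝓡 (n + 1))
    ((𝓡 (n + 1)).prod 𝓘(ℝ, EuclideanSpace ℝ (Fin (n + 1)) →L[ℝ]
      EuclideanSpace ℝ (Fin (n + 1)) →L[ℝ] ℝ)) ∞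
    (fun x ↦ Bundle.TotalSpace.mk' (EuclideanSpace ℝ (Fin (n + 1)) →L[ℝ]
      EuclideanSpace ℝ (Fin (n + 1)) →L[ℝ] ℝ)
      (E := fun x : M ↦ TangentSpace (𝓡 (n + 1)) x →L[ℝ] TangentSpace (𝓡 (n + 1)) x →L[ℝ] ℝ)
      x (inner x))

/-- The velocity `γ̇(s)` of a curve in `M`. -/
def velocity {n : ℕ} {M : Type*} [TopologicalSpace M]
    [ChartedSpace (EuclideanSpace ℝ (Fin (n + 1))) M] (γ : ℝ → M) (s : ℝ) :
    TangentSpace (𝓡 (n + 1)) (γ s) :=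
  mfderiv 𝓘(ℝ, ℝ) (𝓡 (n + 1)) γ s (1 : ℝ)

namespace LorentzianMetric

variable {n : ℕ} {M : Type*} [TopologicalSpace M]
  [ChartedSpace (EuclideanSpace ℝ (Fin (n + 1))) M] [IsManifold (𝓡 (n + 1)) ∞ M]
  (g : LorentzianMetric n M)

/-- The vector `ξ_*` obtained from a covector `ξ` by raising its index: `(ξ_*, v)_g = ⟨ξ, v⟩`. -/
def sharp (x : M) (ξ : TangentSpace (𝓡 (n + 1)) x →L[ℝ] ℝ) : TangentSpace (𝓡 (n + 1)) x :=
  ContinuousLinearMap.inverse (g.inner x) ξ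

/-- `ξ` is spacelike if `g⁻¹(ξ, ξ) = ⟨ξ, ξ_*⟩` is positive. -/
def IsSpacelike (x : M) (ξ : TangentSpace (𝓡 (n + 1)) x →L[ℝ] ℝ) : Prop :=
  0 < ξ (g.sharp x ξ)

/-- `ξ` is lightlike if `g⁻¹(ξ, ξ) = ⟨ξ, ξ_*⟩` vanishes. -/
def IsLightlike (x : M) (ξ : TangentSpace (𝓡 (n + 1)) x →L[ℝ] ℝ) : Prop :=
  ξ (g.sharp x ξ) = 0

/-- The metric in the coordinates `φ` given by the preferred chart at `x₀`: the bilinear form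
`(u, v) ↦ g (dφ⁻¹ u, dφ⁻¹ v)` at the coordinate point `y`, that is, the matrix `g_{ij}(y)`. -/
def inChart (x₀ : M) (y : EuclideanSpace ℝ (Fin (n + 1))) :
    EuclideanSpace ℝ (Fin (n + 1)) →L[ℝ] EuclideanSpace ℝ (Fin (n + 1)) →L[ℝ] ℝ :=
  letI A : EuclideanSpace ℝ (Fin (n + 1)) →L[ℝ] EuclideanSpace ℝ (Fin (n + 1)) :=
    mfderiv 𝓘(ℝ, EuclideanSpace ℝ (Fin (n + 1))) (𝓡 (n + 1)) (extChartAt (𝓡 (n + 1)) x₀).symm y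
  letI B : EuclideanSpace ℝ (Fin (n + 1)) →L[ℝ] EuclideanSpace ℝ (Fin (n + 1)) →L[ℝ] ℝ :=
    g.inner ((extChartAt (𝓡 (n + 1)) x₀).symm y)
  B.bilinearComp A A

/-- The Christoffel symbols of the Levi-Civita connection in the preferred chart at `x₀`,
`Γ(u, v)^k = ½ g^{kl} (∂_i g_{jl} + ∂_j g_{il} - ∂_l g_{ij}) u^i v^j` at the coordinate point `y`. -/
def christoffel (x₀ : M) (y u v : EuclideanSpace ℝ (Fin (n + 1))) :
    EuclideanSpace ℝ (Fin (n + 1)) :=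
  letI D := fderiv ℝ (g.inChart x₀) y
  ContinuousLinearMap.inverse (g.inChart x₀ y)
    ((1 / 2 : ℝ) • (D u v + D v u - (D.flip u).flip v))

/-- The covariant derivative `V'(s) = ∇_s V(s)` of a vector field `V` along a curve `γ`, computed in
the preferred chart `φ` at `γ s`: the derivative of the coordinate vector `dφ(V)` plus the
Christoffel term. The differential at `x` of the preferred chart at `x` is the identification of
`TangentSpace _ x` with the model space, so that the coordinate result at the centre of the chart
is the tangent vector itself. -/
def covDeriv (γ : ℝ → M) (V : ∀ s : ℝ, TangentSpace (𝓡 (n + 1)) (γ s)) (s : ℝ) :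
    TangentSpace (𝓡 (n + 1)) (γ s) :=
  letI coord : ℝ → EuclideanSpace ℝ (Fin (n + 1)) := fun τ ↦
    mfderiv (𝓡 (n + 1)) 𝓘(ℝ, EuclideanSpace ℝ (Fin (n + 1)))
      (extChartAt (𝓡 (n + 1)) (γ s)) (γ τ) (V τ)
  deriv coord s +
    g.christoffel (γ s) (extChartAt (𝓡 (n + 1)) (γ s) (γ s)) (velocity γ s) (V s)

/-- The Riemann curvature tensor `R(u, v) w`, with the sign convention
`R(X, Y) W = ∇_X ∇_Y W - ∇_Y ∇_X W - ∇_{[X, Y]} W`, computed in the preferred chart at `x`. -/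
def curvature (x : M) (u v w : TangentSpace (𝓡 (n + 1)) x) : TangentSpace (𝓡 (n + 1)) x :=
  letI y : EuclideanSpace ℝ (Fin (n + 1)) := extChartAt (𝓡 (n + 1)) x x
  letI Γ := g.christoffel x
  fderiv ℝ (fun y' ↦ Γ y' v w) y u - fderiv ℝ (fun y' ↦ Γ y' u w) y v
    + Γ y u (Γ y v w) - Γ y v (Γ y u w)

/-- `J` is a Jacobi field along `γ` over the set `S` of parameters: a smooth vector field along `γ`
with `J'' + R(J, γ̇) γ̇ = 0` on `S`. -/
def IsJacobiField (γ : ℝ → M) (S : Set ℝ) (J : ∀ s : ℝ, TangentSpace (𝓡 (n + 1)) (γ s)) : Prop :=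
  (∀ s ∈ S, ContMDiffAt 𝓘(ℝ, ℝ) (𝓡 (n + 1)).tangent ∞
    (fun τ ↦ (⟨γ τ, J τ⟩ : TangentBundle (𝓡 (n + 1)) M)) s) ∧
  ∀ s ∈ S, g.covDeriv γ (g.covDeriv γ J) s
    + g.curvature (γ s) (J s) (velocity γ s) (velocity γ s) = 0

/-- `γ s₁` and `γ s₂` are conjugate along `γ : [0, ℓ] → M`: some Jacobi field along `γ` that is not
identically zero vanishes at the two distinct parameters `s₁` and `s₂`. -/
def AreConjugate (γ : ℝ → M) (ℓ s₁ s₂ : ℝ) : Prop :=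
  s₁ ≠ s₂ ∧ ∃ J : ∀ s : ℝ, TangentSpace (𝓡 (n + 1)) (γ s),
    g.IsJacobiField γ (Icc 0 ℓ) J ∧ J s₁ = 0 ∧ J s₂ = 0 ∧ ∃ s ∈ Icc 0 ℓ, J s ≠ 0

end LorentzianMetric

/-- The local parametrization of the lightlike geodesics of `(M, g)`: semigeodesic coordinates
`Φ : (-T, T) × Z → M` associated to the spacelike hypersurface `H = Φ {t = 0}`; coordinates
`(z, a) ∈ Z × A` on the unit sphere bundle `SZ` with respect to the metric `h` induced on `{t = 0}`,
with coordinate map `(z, a) ↦ (z, θ(z, a))`; and the smooth family of the geodesics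
`γ_{z,a} : [0, ℓ] → M` with `γ_{z,a}(0) = (0, z)` and `γ̇_{z,a}(0) = (1, θ(z, a))` in the
coordinates `(t, z)`. -/
structure NullGeodesicFamily {n : ℕ} {M : Type*} [TopologicalSpace M]
    [ChartedSpace (EuclideanSpace ℝ (Fin (n + 1))) M] [IsManifold (𝓡 (n + 1)) ∞ M]
    (g : LorentzianMetric n M) where
  T : ℝ
  T_pos : 0 < T
  Z : Set (EuclideanSpace ℝ (Fin n))
  isOpen_Z : IsOpen Z
  A : Set (EuclideanSpace ℝ (Fin (n - 1)))
  isOpen_A : IsOpen A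
  /-- The point with coordinates `(t, z)`. -/
  Φ : ℝ × EuclideanSpace ℝ (Fin n) → M
  smooth_Φ : ContMDiffOn 𝓘(ℝ, ℝ × EuclideanSpace ℝ (Fin n)) (𝓡 (n + 1)) ∞ Φ (Ioo (-T) T ×ˢ Z)
  injOn_Φ : InjOn Φ (Ioo (-T) T ×ˢ Z)
  /-- In the coordinates `g = -dt² + g'`, with `g'` a Riemannian metric on `Z` depending on `t`.
  In particular the differential of `Φ` is invertible. -/
  semigeodesic : ∀ p ∈ Ioo (-T) T ×ˢ Z,
    letI dΦ := mfderiv 𝓘(ℝ, ℝ × EuclideanSpace ℝ (Fin n)) (𝓡 (n + 1)) Φ p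
    g.inner (Φ p) (dΦ (1, 0)) (dΦ (1, 0)) = -1 ∧
    (∀ v, g.inner (Φ p) (dΦ (1, 0)) (dΦ (0, v)) = 0) ∧
    ∀ v, v ≠ 0 → 0 < g.inner (Φ p) (dΦ (0, v)) (dΦ (0, v))
  θ : EuclideanSpace ℝ (Fin n) × EuclideanSpace ℝ (Fin (n - 1)) → EuclideanSpace ℝ (Fin n)
  smooth_θ : ContDiffOn ℝ ∞ θ (Z ×ˢ A)
  /-- `(θ(z, a), θ(z, a))_h = 1`, where `h = g'(0, ·)`. -/
  unit_θ : ∀ z ∈ Z, ∀ a ∈ A,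
    letI dΦ := mfderiv 𝓘(ℝ, ℝ × EuclideanSpace ℝ (Fin n)) (𝓡 (n + 1)) Φ ((0 : ℝ), z)
    g.inner (Φ (0, z)) (dΦ (0, θ (z, a))) (dΦ (0, θ (z, a))) = 1
  /-- `(z, a) ↦ (z, θ(z, a))` is a diffeomorphism onto its image in `SZ`: it is injective and its
  differential is injective. -/
  injOn_θ : ∀ z ∈ Z, InjOn (fun a ↦ θ (z, a)) A
  immersion_θ : ∀ z ∈ Z, ∀ a ∈ A, Function.Injective (fderiv ℝ (fun a' ↦ θ (z, a')) a)
  ℓ : ℝ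
  ℓ_pos : 0 < ℓ
  /-- The point `γ_{z,a}(s)`; the values with `s` outside `[0, ℓ]` matter only through the
  smoothness of the family up to the end points. -/
  γ : EuclideanSpace ℝ (Fin n) → EuclideanSpace ℝ (Fin (n - 1)) → ℝ → M
  smooth_γ : ∀ z ∈ Z, ∀ a ∈ A, ∀ s ∈ Icc 0 ℓ,
    ContMDiffAt 𝓘(ℝ, EuclideanSpace ℝ (Fin n) × EuclideanSpace ℝ (Fin (n - 1)) × ℝ)
      (𝓡 (n + 1)) ∞ (fun p ↦ γ p.1 p.2.1 p.2.2) (z, a, s)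
  geodesic_γ : ∀ z ∈ Z, ∀ a ∈ A, ∀ s ∈ Icc 0 ℓ, g.covDeriv (γ z a) (velocity (γ z a)) s = 0
  /-- `γ_{z,a}(0) = (0, z)` and `γ̇_{z,a}(0) = (1, θ(z, a))` in the coordinates `(t, z)`. -/
  initial_γ : ∀ z ∈ Z, ∀ a ∈ A,
    (⟨γ z a 0, velocity (γ z a) 0⟩ : TangentBundle (𝓡 (n + 1)) M) =
      ⟨Φ (0, z), mfderiv 𝓘(ℝ, ℝ × EuclideanSpace ℝ (Fin n)) (𝓡 (n + 1)) Φ ((0 : ℝ), z)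
        ((1 : ℝ), θ (z, a))⟩

namespace NullGeodesicFamily

variable {n : ℕ} {M : Type*} [TopologicalSpace M]
  [ChartedSpace (EuclideanSpace ℝ (Fin (n + 1))) M] [IsManifold (𝓡 (n + 1)) ∞ M]
  {g : LorentzianMetric n M} (F : NullGeodesicFamily g)
  (z : EuclideanSpace ℝ (Fin n)) (a : EuclideanSpace ℝ (Fin (n - 1)))

/-- The variation field `M_j(s; z, a) = ∂_{z^j} γ_{z,a}(s)`. -/
def fieldM (j : Fin n) (s : ℝ) : TangentSpace (𝓡 (n + 1)) (F.γ z a s) :=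
  mfderiv 𝓘(ℝ, EuclideanSpace ℝ (Fin n)) (𝓡 (n + 1)) (fun z' ↦ F.γ z' a s) z
    (EuclideanSpace.single j (1 : ℝ))

/-- The variation field `J_k(s; z, a) = ∂_{a^k} γ_{z,a}(s)`. -/
def fieldJ (k : Fin (n - 1)) (s : ℝ) : TangentSpace (𝓡 (n + 1)) (F.γ z a s) :=
  mfderiv 𝓘(ℝ, EuclideanSpace ℝ (Fin (n - 1))) (𝓡 (n + 1)) (fun a' ↦ F.γ z a' s) a
    (EuclideanSpace.single k (1 : ℝ))

/-- The space `𝒥 = span {M_1, …, M_n, J_1, …, J_{n-1}, γ̇, Γ}` of vector fields along `γ_{z,a}`,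
where `Γ(s) = s γ̇(s)`. -/
def spaceJ : Submodule ℝ (∀ s : ℝ, TangentSpace (𝓡 (n + 1)) (F.γ z a s)) :=
  Submodule.span ℝ (range (F.fieldM z a) ∪ range (F.fieldJ z a) ∪
    {velocity (F.γ z a), fun s ↦ s • velocity (F.γ z a) s})

/-- The set `𝒥'_{s₁,s₂} = {J' | J ∈ 𝒥, J(s₁) = 0, J(s₂) = 0}` of vector fields along
`γ_{z,a} : [0, ℓ] → M`. -/
def spaceJ' (s₁ s₂ : Icc 0 F.ℓ) : Set (∀ s : Icc 0 F.ℓ, TangentSpace (𝓡 (n + 1)) (F.γ z a s)) :=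
  {W | ∃ J ∈ F.spaceJ z a, J s₁ = 0 ∧ J s₂ = 0 ∧ ∀ s : Icc 0 F.ℓ, W s = g.covDeriv (F.γ z a) J s}

/-- The pair `(s, ξ)` solves `ζ_j = ⟨ξ, M_j(s; z, a)⟩`, `α_k = ⟨ξ, J_k(s; z, a)⟩`,
`⟨ξ, γ̇_{z,a}(s)⟩ = 0`. -/
def Solves (ζ : Fin n → ℝ) (α : Fin (n - 1) → ℝ) (s : Icc 0 F.ℓ)
    (ξ : TangentSpace (𝓡 (n + 1)) (F.γ z a s) →L[ℝ] ℝ) : Prop :=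
  (∀ j, ζ j = ξ (F.fieldM z a j s)) ∧ (∀ k, α k = ξ (F.fieldJ z a k s)) ∧
    ξ (velocity (F.γ z a) s) = 0

end NullGeodesicFamily

end

/-! The argument rests on the Wronskian `(J', K) - (J, K')` of two Jacobi fields. It is constant
along the geodesic because `R(·, γ̇) γ̇` is symmetric for the metric (`IsJacobi.wronskian`).

The generators `M_j`, `J_k`, `γ̇`, `Γ` of `𝒥` are `2n + 1` Jacobi fields, and all varied geodesics
are lightlike, so `(J', γ̇) = 0` for every `J` in `𝒥`. At `s = 0` the Cauchy data `(J, J')` of `𝒥`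
fill the space of pairs `(u, w)` with `w ⊥ γ̇` (`initial_frameField`). This space has dimension `2(n
+ 1) - 1`, which equals the number of generators, so the generators are independent. The Wronskian
transports both facts to every `s` (`injective_data`, `exists_of_data`). It also gives uniqueness
for arbitrary Jacobi fields (`eq_zero_of_data`), so no theorem on differential equations enters.

Two solutions of the system with the same `(ζ, α)` give vectors `v_j = ξ^j_*` in `γ̇^⊥` with `(v₁,
L(s₁)) = (v₂, L(s₂))` for all `L` in `𝒥`. If `s₁ = s₂`, the values `L(s₁)` fill the tangent space,
which is (ii). If `s₁ ≠ s₂`, choose `J` in `𝒥` with `J(s₁) = 0` and `J'(s₁) = v₁`. Comparing the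
pairing with the Wronskian at `s₂` gives `J'(s₂) = v₂`, and `J(s₂)` is orthogonal to `γ̇^⊥`, hence a
multiple of `γ̇(s₂)`. Subtracting a multiple of `(s - s₁) γ̇` makes `J` vanish at `s₂` too, and the
derivative of the subtracted field is the term `λ γ̇` (`exists_decomposition`).

If `J` vanishes at both parameters and `J'(s₁) = c γ̇(s₁)`, then `J = c (s - s₁) γ̇`, so `c = 0` and
`J = 0` (`eq_zero_of_cov_tangent`). This gives uniqueness. The metric is semidefinite on `γ̇^⊥` with
null vectors only along `γ̇`, so it also gives the criterion for spacelike covectors, and with it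
(i). Finally, if a Jacobi field vanishes twice, then `(J, γ̇)` is affine in `s` with two zeros; thus
`J' ⊥ γ̇`, and `J` agrees on `[0, ℓ]` with a member of `𝒥`.

The structure `NullGeodesicCalculus` isolates what this argument uses. The rest verifies its axioms
in charts and computes the initial data of the generators. -/

noncomputable section

/-! ### Christoffel symbols, curvature and covariant derivative in one chart. -/

section ChartLevel

open Filter Topology

set_option maxSynthPendingDepth 3

variable {E : Type*} [NormedAddCommGroup E] [NormedSpace ℝ E]

/-- The Christoffel symbols of the first kind of a field `G` of bilinear forms on `E`. -/
def christoffelLower (G : E → E →L[ℝ] E →L[ℝ] ℝ) (y : E) : E →L[ℝ] E →L[ℝ] E →L[ℝ] ℝ :=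
  (1 / 2 : ℝ) • (fderiv ℝ G y + (fderiv ℝ G y).flip
    - (ContinuousLinearMap.flipₗᵢ ℝ E E ℝ : (E →L[ℝ] E →L[ℝ] ℝ) →L[ℝ] (E →L[ℝ] E →L[ℝ] ℝ)) ∘L
      (fderiv ℝ G y).flip)

/-- The Christoffel symbols (of the second kind) of a field `G` of bilinear forms on `E`, as a
bounded bilinear map. -/
def christoffelMap (G : E → E →L[ℝ] E →L[ℝ] ℝ) (y : E) : E →L[ℝ] E →L[ℝ] E :=
  (ContinuousLinearMap.compL ℝ E (E →L[ℝ] ℝ) E (ContinuousLinearMap.inverse (G y))) ∘L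
    christoffelLower G y

/-- `G` is a smooth pseudo-Riemannian metric near `y`. -/
structure IsMetricNear (G : E → E →L[ℝ] E →L[ℝ] ℝ) (y : E) : Prop where
  eventually_contDiffAt : ∀ᶠ x in 𝓝 y, ContDiffAt ℝ ∞ G x
  symm : ∀ᶠ x in 𝓝 y, ∀ u v, G x u v = G x v u
  invertible : (G y).IsInvertible

theorem christoffelLower_apply (G : E → E →L[ℝ] E →L[ℝ] ℝ) (y u v w : E) :
    christoffelLower G y u v w =
      (1 / 2) * (fderiv ℝ G y u v w + fderiv ℝ G y v u w - fderiv ℝ G y w u v) := by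
  simp [christoffelLower]

theorem christoffelMap_apply (G : E → E →L[ℝ] E →L[ℝ] ℝ) (y u v : E) :
    christoffelMap G y u v = ContinuousLinearMap.inverse (G y)
      ((1 / 2 : ℝ) • (fderiv ℝ G y u v + fderiv ℝ G y v u - ((fderiv ℝ G y).flip u).flip v)) := by
  simp only [christoffelMap, ContinuousLinearMap.comp_apply, ContinuousLinearMap.compL_apply]
  congr 1

theorem ContinuousLinearMap.IsInvertible.apply_inverse_apply {F : Type*} [NormedAddCommGroup F]
    [NormedSpace ℝ F] {f : E →L[ℝ] F} (hf : f.IsInvertible) (x : F) :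
    f (ContinuousLinearMap.inverse f x) = x := by
  obtain ⟨e, rfl⟩ := hf
  simp

namespace IsMetricNear

variable {G : E → E →L[ℝ] E →L[ℝ] ℝ} {y : E}

theorem contDiffAt (h : IsMetricNear G y) : ContDiffAt ℝ ∞ G y :=
  h.eventually_contDiffAt.self_of_nhds

/-- Lowering the index cancels the inverse of `G`. Together with `eq_of_forall`, this lets
identities for the Christoffel symbols be checked after pairing with `w`, without differentiating an
inverse. -/
theorem metric_christoffel (h : (G y).IsInvertible) (u v w : E) :
    G y (christoffelMap G y u v) w =
      (1 / 2) * (fderiv ℝ G y u v w + fderiv ℝ G y v u w - fderiv ℝ G y w u v) := by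
  rw [← christoffelLower_apply]
  simp only [christoffelMap, ContinuousLinearMap.comp_apply, ContinuousLinearMap.compL_apply]
  rw [h.apply_inverse_apply]

theorem eq_of_forall (h : (G y).IsInvertible) {u v : E} (huv : ∀ w, G y u w = G y v w) :
    u = v := by
  obtain ⟨e, he⟩ := h
  apply e.injective
  ext w
  simpa [← he] using huv w

theorem hasFDerivAt (h : IsMetricNear G y) : HasFDerivAt G (fderiv ℝ G y) y :=
  (h.contDiffAt.differentiableAt (by simp)).hasFDerivAt

theorem fderiv_symm (h : IsMetricNear G y) (x u v : E) :
    fderiv ℝ G y x u v = fderiv ℝ G y x v u := by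
  have h1 := (h.hasFDerivAt.clm_apply (hasFDerivAt_const u y)).clm_apply (hasFDerivAt_const v y)
  have h2 := (h.hasFDerivAt.clm_apply (hasFDerivAt_const v y)).clm_apply (hasFDerivAt_const u y)
  have h3 : (fun x ↦ G x u v) =ᶠ[𝓝 y] fun x ↦ G x v u := h.symm.mono fun x hx ↦ hx u v
  have := (h2.congr_of_eventuallyEq h3).unique h1
  simpa using (DFunLike.congr_fun this x).symm

theorem christoffel_symm (h : IsMetricNear G y) (u v : E) :
    christoffelMap G y u v = christoffelMap G y v u := by
  refine eq_of_forall h.invertible fun w ↦ ?_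
  rw [metric_christoffel h.invertible, metric_christoffel h.invertible, h.fderiv_symm w u v]
  ring

/-- The metric is parallel. -/
theorem fderiv_eq (h : IsMetricNear G y) (x u v : E) :
    fderiv ℝ G y x u v =
      G y (christoffelMap G y x u) v + G y u (christoffelMap G y x v) := by
  rw [h.symm.self_of_nhds u, metric_christoffel h.invertible, metric_christoffel h.invertible,
    h.fderiv_symm u x v, h.fderiv_symm v x u, h.fderiv_symm x v u]
  ring

variable [CompleteSpace E]

theorem eventually_invertible (h : IsMetricNear G y) : ∀ᶠ x in 𝓝 y, (G x).IsInvertible := by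
  obtain ⟨e, he⟩ := h.invertible
  have : Set.range ((↑) : (E ≃L[ℝ] (E →L[ℝ] ℝ)) → E →L[ℝ] E →L[ℝ] ℝ) ∈ 𝓝 (G y) := by
    rw [← he]; exact ContinuousLinearEquiv.nhds e
  exact h.contDiffAt.continuousAt this

theorem eventually_isMetricNear (h : IsMetricNear G y) : ∀ᶠ x in 𝓝 y, IsMetricNear G x := by
  filter_upwards [h.eventually_invertible, h.eventually_contDiffAt.eventually_nhds, h.symm.eventually_nhds]
    with x h1 h2 h3 using ⟨h2, h3, h1⟩

theorem contDiffAt_christoffel (h : IsMetricNear G y) :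
    ContDiffAt ℝ ∞ (christoffelMap G) y := by
  have hD : ContDiffAt ℝ ∞ (fderiv ℝ G) y := h.contDiffAt.fderiv_right (by simp)
  have hI : ContDiffAt ℝ ∞ (fun y ↦ ContinuousLinearMap.inverse (G y)) y :=
    ContDiffAt.comp y (h.invertible.contDiffAt_map_inverse) h.contDiffAt
  have hF : ContDiffAt ℝ ∞ (fun y ↦ (fderiv ℝ G y).flip) y :=
    ContDiffAt.comp y (ContinuousLinearMap.flipₗᵢ ℝ E E (E →L[ℝ] ℝ)).contDiff.contDiffAt hD
  have hL : ContDiffAt ℝ ∞ (christoffelLower G) y := by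
    unfold christoffelLower
    exact ((hD.add hF).sub (contDiffAt_const.clm_comp hF)).const_smul (1 / 2 : ℝ)
  unfold christoffelMap
  exact (ContDiffAt.comp y (ContinuousLinearMap.compL ℝ E (E →L[ℝ] ℝ) E).contDiff.contDiffAt
    hI).clm_comp hL

theorem hasFDerivAt_christoffel (h : IsMetricNear G y) :
    HasFDerivAt (christoffelMap G) (fderiv ℝ (christoffelMap G) y) y :=
  (h.contDiffAt_christoffel.differentiableAt (by simp)).hasFDerivAt

theorem fderiv_christoffel_symm (h : IsMetricNear G y) (x u v : E) :
    fderiv ℝ (christoffelMap G) y x u v = fderiv ℝ (christoffelMap G) y x v u := by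
  have h1 := (h.hasFDerivAt_christoffel.clm_apply (hasFDerivAt_const u y)).clm_apply
    (hasFDerivAt_const v y)
  have h2 := (h.hasFDerivAt_christoffel.clm_apply (hasFDerivAt_const v y)).clm_apply
    (hasFDerivAt_const u y)
  have h3 : (fun x ↦ christoffelMap G x u v) =ᶠ[𝓝 y] fun x ↦ christoffelMap G x v u :=
    h.eventually_isMetricNear.mono fun x hx ↦ hx.christoffel_symm u v
  simpa using (DFunLike.congr_fun ((h2.congr_of_eventuallyEq h3).unique h1) x).symm

end IsMetricNear

/-- The curvature of `G` in coordinates. -/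
def chartCurvature (G : E → E →L[ℝ] E →L[ℝ] ℝ) (y u v w : E) : E :=
  fderiv ℝ (christoffelMap G) y u v w - fderiv ℝ (christoffelMap G) y v u w
    + christoffelMap G y u (christoffelMap G y v w) - christoffelMap G y v (christoffelMap G y u w)

namespace IsMetricNear

variable {G : E → E →L[ℝ] E →L[ℝ] ℝ} {y : E} [CompleteSpace E]

/-- Differentiate `metric_christoffel`, which holds at all points near `y`. The last term comes from
the derivative of `G` itself on the left. -/
theorem metric_fderiv_christoffel (h : IsMetricNear G y) (x u v w : E) :
    G y (fderiv ℝ (christoffelMap G) y x u v) w =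
      (1 / 2) * (fderiv ℝ (fderiv ℝ G) y x u v w + fderiv ℝ (fderiv ℝ G) y x v u w
        - fderiv ℝ (fderiv ℝ G) y x w u v) - fderiv ℝ G y x (christoffelMap G y u v) w := by
  have h1 : HasFDerivAt (fun z ↦ G z (christoffelMap G z u v) w) _ y :=
    (h.hasFDerivAt.clm_apply ((h.hasFDerivAt_christoffel.clm_apply
      (hasFDerivAt_const u y)).clm_apply (hasFDerivAt_const v y))).clm_apply (hasFDerivAt_const w y)
  have hD : HasFDerivAt (fderiv ℝ G) (fderiv ℝ (fderiv ℝ G) y) y :=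
    ((h.contDiffAt.fderiv_right (m := ∞) (by simp)).differentiableAt (by simp)).hasFDerivAt
  have hD3 (a b c : E) := ((hD.clm_apply (hasFDerivAt_const a y)).clm_apply
    (hasFDerivAt_const b y)).clm_apply (hasFDerivAt_const c y)
  have h2 := (((hD3 u v w).add (hD3 v u w)).sub (hD3 w u v)).const_mul (1 / 2 : ℝ)
  have h3 : (fun z ↦ G z (christoffelMap G z u v) w) =ᶠ[𝓝 y] fun z ↦
      (1 / 2) * (fderiv ℝ G z u v w + fderiv ℝ G z v u w - fderiv ℝ G z w u v) :=
    h.eventually_invertible.mono fun z hz ↦ metric_christoffel hz u v w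
  have h4 := DFunLike.congr_fun ((h2.congr_of_eventuallyEq h3).unique h1) x
  simp at h4
  linarith

/-- After lowering the index both sides are second derivatives of `G` plus products of Christoffel
symbols. They match because `D²G` is symmetric in its two directions and in its two arguments. This
is the only symmetry of the curvature that the Wronskian needs. -/
theorem curvature_symm (h : IsMetricNear G y) (u v w : E) :
    G y (chartCurvature G y u w w) v = G y (chartCurvature G y v w w) u := by
  have hs : ∀ a b, fderiv ℝ (fderiv ℝ G) y a b = fderiv ℝ (fderiv ℝ G) y b a :=
    h.contDiffAt.isSymmSndFDerivAt (by
      simpa using WithTop.coe_le_coe.2 (le_top : (2 : ℕ∞) ≤ ⊤))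
  have hD : HasFDerivAt (fderiv ℝ G) (fderiv ℝ (fderiv ℝ G) y) y :=
    ((h.contDiffAt.fderiv_right (m := ∞) (by simp)).differentiableAt (by simp)).hasFDerivAt
  have hs' : ∀ a b c d, fderiv ℝ (fderiv ℝ G) y a b c d = fderiv ℝ (fderiv ℝ G) y a b d c := by
    intro a b c d
    have hD3 (c d : E) := ((hD.clm_apply (hasFDerivAt_const b y)).clm_apply
      (hasFDerivAt_const c y)).clm_apply (hasFDerivAt_const d y)
    have h3 : (fun x ↦ fderiv ℝ G x b c d) =ᶠ[𝓝 y] fun x ↦ fderiv ℝ G x b d c := by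
      filter_upwards [h.eventually_isMetricNear] with x hx using hx.fderiv_symm b c d
    simpa using (DFunLike.congr_fun (((hD3 d c).congr_of_eventuallyEq h3).unique (hD3 c d)) a).symm
  simp only [chartCurvature, map_add, map_sub, _root_.add_apply,
    _root_.sub_apply, h.metric_fderiv_christoffel, h.fderiv_eq]
  have e := h.symm.self_of_nhds
  have e1 : fderiv ℝ (fderiv ℝ G) y w u w v = fderiv ℝ (fderiv ℝ G) y u w w v := by rw [hs w u]
  have e2 : fderiv ℝ (fderiv ℝ G) y w v w u = fderiv ℝ (fderiv ℝ G) y v w w u := by rw [hs w v]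
  have e3 : fderiv ℝ (fderiv ℝ G) y v u w w = fderiv ℝ (fderiv ℝ G) y u v w w := by rw [hs v u]
  rw [hs' w w u v, hs' w v u w, hs' w u v w, e1, e2, e3, h.christoffel_symm w u,
    h.christoffel_symm w v, h.christoffel_symm v u,
    e (christoffelMap G y u w) (christoffelMap G y v w)]
  ring

end IsMetricNear

/-- The covariant derivative in coordinates of the vector field `v` along the curve `c`. -/
def chartCov (G : E → E →L[ℝ] E →L[ℝ] ℝ) (c v : ℝ → E) (s : ℝ) : E :=
  deriv v s + christoffelMap G (c s) (deriv c s) (v s)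

theorem IsMetricNear.hasDerivAt_apply {G : E → E →L[ℝ] E →L[ℝ] ℝ} {c v w : ℝ → E} {s : ℝ}
    (h : IsMetricNear G (c s)) (hc : DifferentiableAt ℝ c s) (hv : DifferentiableAt ℝ v s)
    (hw : DifferentiableAt ℝ w s) :
    HasDerivAt (fun τ ↦ G (c τ) (v τ) (w τ))
      (G (c s) (chartCov G c v s) (w s) + G (c s) (v s) (chartCov G c w s)) s := by
  have h1 : HasDerivAt (fun τ ↦ G (c τ)) (fderiv ℝ G (c s) (deriv c s)) s :=
    h.hasFDerivAt.comp_hasDerivAt s hc.hasDerivAt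
  refine ((h1.clm_apply hv.hasDerivAt).clm_apply hw.hasDerivAt).congr_deriv ?_
  simp only [chartCov, map_add, _root_.add_apply, h.fderiv_eq]
  ring

/-- The transformation law of the Christoffel symbols. -/
theorem christoffelMap_transform {G₀ G₁ : E → E →L[ℝ] E →L[ℝ] ℝ} {ψ : E → E} {y : E}
    (h₀ : IsMetricNear G₀ y) (h₁ : IsMetricNear G₁ (ψ y)) (hψ : ContDiffAt ℝ 2 ψ y)
    (hinv : Function.Surjective (fderiv ℝ ψ y))
    (hG : ∀ᶠ x in 𝓝 y, ∀ u v, G₀ x u v = G₁ (ψ x) (fderiv ℝ ψ x u) (fderiv ℝ ψ x v)) (u v : E) :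
    christoffelMap G₁ (ψ y) (fderiv ℝ ψ y u) (fderiv ℝ ψ y v) + fderiv ℝ (fderiv ℝ ψ) y u v =
      fderiv ℝ ψ y (christoffelMap G₀ y u v) := by
  have hs : ∀ a b, fderiv ℝ (fderiv ℝ ψ) y a b = fderiv ℝ (fderiv ℝ ψ) y b a :=
    hψ.isSymmSndFDerivAt (by simp)
  have hψ1 : HasFDerivAt ψ (fderiv ℝ ψ y) y := (hψ.differentiableAt (by simp)).hasFDerivAt
  have hψ2 : HasFDerivAt (fderiv ℝ ψ) (fderiv ℝ (fderiv ℝ ψ) y) y :=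
    ((hψ.fderiv_right (m := 1) (by norm_num)).differentiableAt (by simp)).hasFDerivAt
  -- The derivative of the pullback identity. In the Christoffel combination of three such terms the
  -- second derivatives of `ψ` cancel by symmetry, except for the one paired with `w`.
  have key (x u v : E) : fderiv ℝ G₀ y x u v =
      fderiv ℝ G₁ (ψ y) (fderiv ℝ ψ y x) (fderiv ℝ ψ y u) (fderiv ℝ ψ y v)
      + G₁ (ψ y) (fderiv ℝ (fderiv ℝ ψ) y x u) (fderiv ℝ ψ y v)
      + G₁ (ψ y) (fderiv ℝ ψ y u) (fderiv ℝ (fderiv ℝ ψ) y x v) := by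
    have hl := (h₀.hasFDerivAt.clm_apply (hasFDerivAt_const u y)).clm_apply (hasFDerivAt_const v y)
    have hr : HasFDerivAt (fun x ↦ G₁ (ψ x) (fderiv ℝ ψ x u) (fderiv ℝ ψ x v)) _ y :=
      (((h₁.hasFDerivAt.comp y hψ1).clm_apply (hψ2.clm_apply (hasFDerivAt_const u y)))).clm_apply
        (hψ2.clm_apply (hasFDerivAt_const v y))
    have hE : (fun x ↦ G₀ x u v) =ᶠ[𝓝 y] fun x ↦ G₁ (ψ x) (fderiv ℝ ψ x u) (fderiv ℝ ψ x v) :=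
      hG.mono fun x hx ↦ hx u v
    have := DFunLike.congr_fun (hl.unique (hr.congr_of_eventuallyEq hE)) x
    simp at this
    linarith
  -- Since `dψ` is onto, it suffices to pair with vectors `dψ w`.
  refine IsMetricNear.eq_of_forall h₁.invertible fun w ↦ ?_
  obtain ⟨w, rfl⟩ := hinv w
  rw [map_add, _root_.add_apply, IsMetricNear.metric_christoffel h₁.invertible,
    ← hG.self_of_nhds, IsMetricNear.metric_christoffel h₀.invertible, key, key, key, hs w u, hs w v,
    hs v u]
  have e := h₁.symm.self_of_nhds
  rw [e (fderiv ℝ ψ y v), e (fderiv ℝ ψ y u) (fderiv ℝ (fderiv ℝ ψ) y v w)]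
  ring

/-- The covariant derivative does not depend on the coordinates. -/
theorem chartCov_transform {G₀ G₁ : E → E →L[ℝ] E →L[ℝ] ℝ} {ψ : E → E} {c v c₁ v₁ : ℝ → E} {s : ℝ}
    (h₀ : IsMetricNear G₀ (c s)) (h₁ : IsMetricNear G₁ (ψ (c s))) (hψ : ContDiffAt ℝ 2 ψ (c s))
    (hinv : Function.Surjective (fderiv ℝ ψ (c s)))
    (hG : ∀ᶠ x in 𝓝 (c s), ∀ u v, G₀ x u v = G₁ (ψ x) (fderiv ℝ ψ x u) (fderiv ℝ ψ x v))
    (hc : DifferentiableAt ℝ c s) (hv : DifferentiableAt ℝ v s)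
    (hc₁ : ∀ᶠ τ in 𝓝 s, c₁ τ = ψ (c τ)) (hv₁ : ∀ᶠ τ in 𝓝 s, v₁ τ = fderiv ℝ ψ (c τ) (v τ)) :
    chartCov G₁ c₁ v₁ s = fderiv ℝ ψ (c s) (chartCov G₀ c v s) := by
  have hψ1 : HasFDerivAt ψ (fderiv ℝ ψ (c s)) (c s) := (hψ.differentiableAt (by simp)).hasFDerivAt
  have hψ2 : HasFDerivAt (fderiv ℝ ψ) (fderiv ℝ (fderiv ℝ ψ) (c s)) (c s) :=
    ((hψ.fderiv_right (m := 1) (by norm_num)).differentiableAt (by simp)).hasFDerivAt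
  have d1 : deriv c₁ s = fderiv ℝ ψ (c s) (deriv c s) :=
    ((hψ1.comp_hasDerivAt s hc.hasDerivAt).congr_of_eventuallyEq hc₁).deriv
  have d2 : deriv v₁ s = fderiv ℝ (fderiv ℝ ψ) (c s) (deriv c s) (v s)
      + fderiv ℝ ψ (c s) (deriv v s) :=
    (((hψ2.comp_hasDerivAt s hc.hasDerivAt).clm_apply hv.hasDerivAt).congr_of_eventuallyEq
      hv₁).deriv
  simp only [chartCov, d1, d2, hc₁.self_of_nhds, hv₁.self_of_nhds, map_add,
    ← christoffelMap_transform h₀ h₁ hψ hinv hG]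
  abel

end ChartLevel

/-! ### Variations of geodesics in one chart. -/

section Variation

open Filter Topology

set_option maxSynthPendingDepth 3

variable {E : Type*} [NormedAddCommGroup E] [NormedSpace ℝ E]

theorem DifferentiableAt.hasDerivAt_snd {C : ℝ × ℝ → E} {ε s : ℝ}
    (h : DifferentiableAt ℝ C (ε, s)) :
    HasDerivAt (fun τ ↦ C (ε, τ)) (fderiv ℝ C (ε, s) (0, 1)) s :=
  h.hasFDerivAt.comp_hasDerivAt_of_eq s ((hasDerivAt_const s ε).prodMk (hasDerivAt_id s)) rfl

theorem DifferentiableAt.hasDerivAt_fst {C : ℝ × ℝ → E} {ε s : ℝ}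
    (h : DifferentiableAt ℝ C (ε, s)) :
    HasDerivAt (fun ε ↦ C (ε, s)) (fderiv ℝ C (ε, s) (1, 0)) ε :=
  h.hasFDerivAt.comp_hasDerivAt_of_eq ε ((hasDerivAt_id ε).prodMk (hasDerivAt_const ε s)) rfl

theorem Filter.Eventually.snd_slice {p : ℝ × ℝ → Prop} {ε s : ℝ} (h : ∀ᶠ x in 𝓝 (ε, s), p x) :
    ∀ᶠ τ in 𝓝 s, p (ε, τ) :=
  (Continuous.prodMk_right (Y := ℝ) ε).continuousAt.eventually h

theorem Filter.Eventually.fst_slice {p : ℝ × ℝ → Prop} {ε s : ℝ} (h : ∀ᶠ x in 𝓝 (ε, s), p x) :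
    ∀ᶠ δ in 𝓝 ε, p (δ, s) :=
  (Continuous.prodMk_left (Y := ℝ) s).continuousAt.eventually h

theorem ContDiffAt.fderiv_apply_const {F : Type*} [NormedAddCommGroup F] [NormedSpace ℝ F]
    {C : F → E} {p : F} (h : ContDiffAt ℝ ∞ C p)
    (w : F) : ContDiffAt ℝ ∞ (fun p ↦ fderiv ℝ C p w) p :=
  (h.fderiv_right (m := ∞) (by simp)).clm_apply contDiffAt_const

theorem ContDiffAt.eventually_differentiableAt {F : Type*} [NormedAddCommGroup F] [NormedSpace ℝ F]
    {C : F → E} {p : F} (h : ContDiffAt ℝ ∞ C p) : ∀ᶠ x in 𝓝 p, DifferentiableAt ℝ C x :=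
  ((h.of_le (m := 1) (by simp)).eventually (by simp)).mono fun _ hx ↦
    hx.differentiableAt (by simp)

theorem ContDiffAt.fderiv_fderiv_comm {C : ℝ × ℝ → E} {p : ℝ × ℝ} (h : ContDiffAt ℝ ∞ C p)
    (u v : ℝ × ℝ) :
    fderiv ℝ (fun p ↦ fderiv ℝ C p u) p v = fderiv ℝ (fun p ↦ fderiv ℝ C p v) p u := by
  have h1 : DifferentiableAt ℝ (fderiv ℝ C) p :=
    (h.fderiv_right (m := ∞) (by simp)).differentiableAt (by simp)
  have h2 := h.isSymmSndFDerivAt (by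
    simpa using WithTop.coe_le_coe.2 (le_top : (2 : ℕ∞) ≤ ⊤)) u v
  rw [(h1.hasFDerivAt.clm_apply (hasFDerivAt_const u p)).fderiv,
    (h1.hasFDerivAt.clm_apply (hasFDerivAt_const v p)).fderiv]
  simpa using h2.symm

theorem ContDiffAt.eventually_fderiv_fderiv_comm {C : ℝ × ℝ → E} {p : ℝ × ℝ}
    (h : ContDiffAt ℝ ∞ C p) (u v : ℝ × ℝ) :
    ∀ᶠ q in 𝓝 p, fderiv ℝ (fun p ↦ fderiv ℝ C p u) q v =
      fderiv ℝ (fun p ↦ fderiv ℝ C p v) q u := by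
  filter_upwards [(h.of_le (m := 2) (WithTop.coe_le_coe.2 (le_top : (2 : ℕ∞) ≤ ⊤))).eventually
    (by simp)] with q hq
  have h1 : DifferentiableAt ℝ (fderiv ℝ C) q :=
    (hq.fderiv_right (m := 1) (by norm_num)).differentiableAt (by simp)
  have h2 := hq.isSymmSndFDerivAt (by simp) u v
  rw [(h1.hasFDerivAt.clm_apply (hasFDerivAt_const u q)).fderiv,
    (h1.hasFDerivAt.clm_apply (hasFDerivAt_const v q)).fderiv]
  simpa using h2.symm

section

variable {G : E → E →L[ℝ] E →L[ℝ] ℝ} {C : ℝ × ℝ → E} {s : ℝ}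

theorem eventually_deriv_snd (hC : ContDiffAt ℝ ∞ C (0, s)) :
    ∀ᶠ p in 𝓝 ((0 : ℝ), s), deriv (fun τ ↦ C (p.1, τ)) p.2 = fderiv ℝ C p (0, 1) :=
  hC.eventually_differentiableAt.mono fun _ hp ↦ hp.hasDerivAt_snd.deriv

theorem eventually_deriv_fst (hC : ContDiffAt ℝ ∞ C (0, s)) :
    ∀ᶠ p in 𝓝 ((0 : ℝ), s), deriv (fun ε ↦ C (ε, p.2)) p.1 = fderiv ℝ C p (1, 0) :=
  hC.eventually_differentiableAt.mono fun _ hp ↦ hp.hasDerivAt_fst.deriv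

/-- The derivative of the variation field in terms of mixed derivatives of the variation. -/
theorem eventually_chartCov_variation (hC : ContDiffAt ℝ ∞ C (0, s)) :
    ∀ᶠ τ in 𝓝 s, chartCov G (fun τ ↦ C (0, τ)) (fun τ ↦ deriv (fun ε ↦ C (ε, τ)) 0) τ =
      fderiv ℝ (fun p ↦ fderiv ℝ C p (0, 1)) (0, τ) (1, 0) +
        christoffelMap G (C (0, τ)) (fderiv ℝ C (0, τ) (0, 1)) (fderiv ℝ C (0, τ) (1, 0)) := by
  have h1 := (hC.fderiv_apply_const (1, 0)).eventually_differentiableAt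
  filter_upwards [(eventually_deriv_fst hC).snd_slice.eventually_nhds,
    (eventually_deriv_snd hC).snd_slice, h1.snd_slice,
    (hC.eventually_fderiv_fderiv_comm (0, 1) (1, 0)).snd_slice] with τ e1 e2 d1 e3
  have : deriv (fun τ ↦ deriv (fun ε ↦ C (ε, τ)) 0) τ =
      fderiv ℝ (fun p ↦ fderiv ℝ C p (1, 0)) (0, τ) (0, 1) :=
    (d1.hasDerivAt_snd.congr_of_eventuallyEq e1).deriv
  rw [chartCov, this, e3]
  rw [e2, e1.self_of_nhds]

/-- The variation field of a smooth family of geodesics is a Jacobi field. -/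
theorem chartCov_chartCov_variation [CompleteSpace E] (h : IsMetricNear G (C (0, s)))
    (hC : ContDiffAt ℝ ∞ C (0, s))
    (hgeo : ∀ᶠ ε in 𝓝 (0 : ℝ), chartCov G (fun τ ↦ C (ε, τ)) (deriv fun τ ↦ C (ε, τ)) s = 0) :
    chartCov G (fun τ ↦ C (0, τ))
        (chartCov G (fun τ ↦ C (0, τ)) (fun τ ↦ deriv (fun ε ↦ C (ε, τ)) 0)) s
      + chartCurvature G (C (0, s)) (deriv (fun ε ↦ C (ε, s)) 0)
        (deriv (fun τ ↦ C (0, τ)) s) (deriv (fun τ ↦ C (0, τ)) s) = 0 := by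
  have s1 := hC.fderiv_apply_const (1, 0)
  have s2 := hC.fderiv_apply_const (0, 1)
  have s21 := s2.fderiv_apply_const (1, 0)
  have s22 := s2.fderiv_apply_const (0, 1)
  have d0 := hC.differentiableAt (by simp)
  have d1 := s1.differentiableAt (by simp)
  have d2 := s2.differentiableAt (by simp)
  have d21 := s21.differentiableAt (by simp)
  have d22 := s22.differentiableAt (by simp)
  have hG := h.hasFDerivAt_christoffel
  -- The geodesic equation at fixed `s`, written as a function of `ε` so that it can be
  -- differentiated in `ε`.
  have hgeo' : ∀ᶠ ε in 𝓝 (0 : ℝ), fderiv ℝ (fun p ↦ fderiv ℝ C p (0, 1)) (ε, s) (0, 1) +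
      christoffelMap G (C (ε, s)) (fderiv ℝ C (ε, s) (0, 1)) (fderiv ℝ C (ε, s) (0, 1)) = 0 := by
    filter_upwards [hgeo, (eventually_deriv_snd hC).eventually_nhds.fst_slice,
      s2.eventually_differentiableAt.fst_slice] with ε h1 h2 h3
    rw [← h1, chartCov, h2.self_of_nhds.symm]
    congr 1
    exact (h3.hasDerivAt_snd.congr_of_eventuallyEq h2.snd_slice).deriv.symm
  -- `hJ` is the `s`-derivative of `D_s ∂_ε C`, and `hE` is the `ε`-derivative of the geodesic
  -- expression. Both contain the third derivative `∂_ε ∂_s ∂_s C`. Eliminating it leaves the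
  -- curvature term.
  have hJ := ((d21.hasDerivAt_snd).add (((hG.comp_hasDerivAt_of_eq s d0.hasDerivAt_snd rfl).clm_apply
    d2.hasDerivAt_snd).clm_apply d1.hasDerivAt_snd)).congr_of_eventuallyEq
      (eventually_chartCov_variation (G := G) hC)
  have hE := (d22.hasDerivAt_fst).add (((hG.comp_hasDerivAt_of_eq (0 : ℝ) d0.hasDerivAt_fst
    rfl).clm_apply d2.hasDerivAt_fst).clm_apply d2.hasDerivAt_fst)
  have hE0 := hE.unique ((hasDerivAt_const (0 : ℝ) (0 : E)).congr_of_eventuallyEq hgeo')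
  rw [chartCov, hJ.deriv, (eventually_chartCov_variation (G := G) hC).self_of_nhds,
    d0.hasDerivAt_snd.deriv, d0.hasDerivAt_fst.deriv, hC.fderiv_fderiv_comm (1, 0) (0, 1),
    s2.fderiv_fderiv_comm (1, 0) (0, 1), eq_neg_of_add_eq_zero_left hE0,
    eq_neg_of_add_eq_zero_left hgeo'.self_of_nhds]
  simp only [chartCurvature, Function.comp_def, map_add, map_neg, _root_.add_apply,
    _root_.neg_apply]
  rw [h.christoffel_symm (fderiv ℝ C (0, s) (1, 0)),
    h.christoffel_symm (fderiv ℝ C (0, s) (1, 0)),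
    h.christoffel_symm (fderiv ℝ (fun p ↦ fderiv ℝ C p (0, 1)) (0, s) (1, 0)),
    h.fderiv_christoffel_symm (fderiv ℝ C (0, s) (0, 1)) (fderiv ℝ C (0, s) (0, 1))]
  abel

/-- The derivative of the square norm of the velocities in a variation. -/
theorem deriv_normSq_variation (h : IsMetricNear G (C (0, s))) (hC : ContDiffAt ℝ ∞ C (0, s)) :
    HasDerivAt (fun ε ↦ G (C (ε, s)) (deriv (fun τ ↦ C (ε, τ)) s) (deriv (fun τ ↦ C (ε, τ)) s))
      (2 * G (C (0, s)) (chartCov G (fun τ ↦ C (0, τ)) (fun τ ↦ deriv (fun ε ↦ C (ε, τ)) 0) s)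
        (deriv (fun τ ↦ C (0, τ)) s)) 0 := by
  have d0 := hC.differentiableAt (by simp)
  have d2 := (hC.fderiv_apply_const (0, 1)).differentiableAt (by simp)
  have hE := ((h.hasFDerivAt.comp_hasDerivAt_of_eq (0 : ℝ) d0.hasDerivAt_fst rfl).clm_apply
    d2.hasDerivAt_fst).clm_apply d2.hasDerivAt_fst
  refine (hE.congr_of_eventuallyEq ?_).congr_deriv ?_
  · filter_upwards [(eventually_deriv_snd hC).fst_slice] with ε hε
    simp [hε]
  · rw [(eventually_chartCov_variation (G := G) hC).self_of_nhds, d0.hasDerivAt_snd.deriv]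
    have e := h.symm.self_of_nhds
    simp only [Function.comp_def, h.fderiv_eq, map_add, _root_.add_apply,
      h.christoffel_symm (fderiv ℝ C (0, s) (1, 0))]
    rw [e (fderiv ℝ C (0, s) (0, 1)), e (fderiv ℝ C (0, s) (0, 1))]
    ring

end

end Variation

/-! ### Axioms for vector fields along a lightlike geodesic. -/

/-- The calculus of vector fields along a lightlike geodesic defined on `[0, ℓ]`, all tangent spaces
being identified with a model space `E`: the metric, the smooth fields, the covariant derivative,
and the curvature operator `R(·, γ̇) γ̇`. -/
structure NullGeodesicCalculus (E : Type*) [NormedAddCommGroup E] [NormedSpace ℝ E] where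
  ℓ : ℝ
  ℓ_pos : 0 < ℓ
  metric : ℝ → E →L[ℝ] E →L[ℝ] ℝ
  fields : Submodule ℝ (ℝ → E)
  cov : (ℝ → E) → ℝ → E
  curv : ℝ → E → E
  vel : ℝ → E
  metric_symm : ∀ s u v, metric s u v = metric s v u
  nondeg : ∀ s ∈ Icc 0 ℓ, ∀ u, (∀ v, metric s u v = 0) → u = 0
  nonneg : ∀ s ∈ Icc 0 ℓ, ∀ u, metric s u (vel s) = 0 → 0 ≤ metric s u u
  eq_smul_vel : ∀ s ∈ Icc 0 ℓ, ∀ u, metric s u (vel s) = 0 → metric s u u = 0 →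
    ∃ c : ℝ, u = c • vel s
  cov_mem : ∀ V ∈ fields, cov V ∈ fields
  cov_add : ∀ V ∈ fields, ∀ W ∈ fields, ∀ s ∈ Icc 0 ℓ, cov (V + W) s = cov V s + cov W s
  cov_smul : ∀ (c : ℝ), ∀ V ∈ fields, ∀ s ∈ Icc 0 ℓ, cov (c • V) s = c • cov V s
  cov_zero : ∀ V ∈ fields, (∀ s ∈ Icc 0 ℓ, V s = 0) → ∀ s ∈ Icc 0 ℓ, cov V s = 0
  hasDerivAt_metric : ∀ V ∈ fields, ∀ W ∈ fields, ∀ s ∈ Icc 0 ℓ,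
    HasDerivAt (fun τ ↦ metric τ (V τ) (W τ)) (metric s (cov V s) (W s) + metric s (V s) (cov W s)) s
  curv_add : ∀ s ∈ Icc 0 ℓ, ∀ u v, curv s (u + v) = curv s u + curv s v
  curv_smul : ∀ s ∈ Icc 0 ℓ, ∀ (c : ℝ) u, curv s (c • u) = c • curv s u
  curv_symm : ∀ s ∈ Icc 0 ℓ, ∀ u v, metric s (curv s u) v = metric s (curv s v) u
  vel_mem : vel ∈ fields
  cov_vel : ∀ s ∈ Icc 0 ℓ, cov vel s = 0
  vel_ne : ∀ s ∈ Icc 0 ℓ, vel s ≠ 0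
  vel_null : ∀ s ∈ Icc 0 ℓ, metric s (vel s) (vel s) = 0
  smul_vel_mem : (fun s ↦ s • vel s) ∈ fields
  cov_smul_vel : ∀ s ∈ Icc 0 ℓ, cov (fun s ↦ s • vel s) s = vel s

theorem eq_of_hasDerivAt_zero {ℓ : ℝ} {f : ℝ → ℝ} (h : ∀ s ∈ Icc 0 ℓ, HasDerivAt f 0 s) {s t : ℝ}
    (hs : s ∈ Icc 0 ℓ) (ht : t ∈ Icc 0 ℓ) : f s = f t := by
  have := constant_of_has_deriv_right_zero (f := f) (a := 0) (b := ℓ)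
    (fun x hx ↦ (h x hx).continuousAt.continuousWithinAt)
    fun x hx ↦ (h x (Ico_subset_Icc_self hx)).hasDerivWithinAt
  rw [this s hs, this t ht]

/-! ### Jacobi fields and the Wronskian. -/

namespace NullGeodesicCalculus

variable {E : Type*} [NormedAddCommGroup E] [NormedSpace ℝ E] (N : NullGeodesicCalculus E)

/-- Jacobi fields along the geodesic. -/
def IsJacobi (J : ℝ → E) : Prop :=
  J ∈ N.fields ∧ ∀ s ∈ Icc 0 N.ℓ, N.cov (N.cov J) s + N.curv s (J s) = 0

variable {N}

theorem IsJacobi.add {J K : ℝ → E} (hJ : N.IsJacobi J) (hK : N.IsJacobi K) :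
    N.IsJacobi (J + K) := by
  refine ⟨N.fields.add_mem hJ.1 hK.1, fun s hs ↦ ?_⟩
  -- The axioms give `(J + K)' = J' + K'` only on `[0, ℓ]`, so a second derivative cannot be taken
  -- by rewriting. The difference is a field vanishing there, and `cov_zero` disposes of its
  -- derivative.
  have hd : N.cov (J + K) - (N.cov J + N.cov K) ∈ N.fields :=
    N.fields.sub_mem (N.cov_mem _ (N.fields.add_mem hJ.1 hK.1))
      (N.fields.add_mem (N.cov_mem _ hJ.1) (N.cov_mem _ hK.1))
  have h0 := N.cov_zero _ hd (fun t ht ↦ by simp [N.cov_add J hJ.1 K hK.1 t ht]) s hs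
  have h1 := N.cov_add _ hd _ (N.fields.add_mem (N.cov_mem _ hJ.1) (N.cov_mem _ hK.1)) s hs
  rw [sub_add_cancel, h0, zero_add, N.cov_add _ (N.cov_mem _ hJ.1) _ (N.cov_mem _ hK.1) s hs] at h1
  rw [h1, Pi.add_apply, N.curv_add s hs, add_add_add_comm, hJ.2 s hs, hK.2 s hs, add_zero]

theorem IsJacobi.smul {J : ℝ → E} (c : ℝ) (hJ : N.IsJacobi J) : N.IsJacobi (c • J) := by
  refine ⟨N.fields.smul_mem c hJ.1, fun s hs ↦ ?_⟩
  have hd : N.cov (c • J) - c • N.cov J ∈ N.fields :=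
    N.fields.sub_mem (N.cov_mem _ (N.fields.smul_mem c hJ.1))
      (N.fields.smul_mem c (N.cov_mem _ hJ.1))
  have h0 := N.cov_zero _ hd (fun t ht ↦ by simp [N.cov_smul c J hJ.1 t ht]) s hs
  have h1 := N.cov_add _ hd _ (N.fields.smul_mem c (N.cov_mem _ hJ.1)) s hs
  rw [sub_add_cancel, h0, zero_add, N.cov_smul _ _ (N.cov_mem _ hJ.1) s hs] at h1
  rw [h1, Pi.smul_apply, N.curv_smul s hs, ← smul_add, hJ.2 s hs, smul_zero]

theorem cov_sub {V W : ℝ → E} (hV : V ∈ N.fields) (hW : W ∈ N.fields) {s : ℝ}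
    (hs : s ∈ Icc 0 N.ℓ) : N.cov (V - W) s = N.cov V s - N.cov W s := by
  have h1 := N.cov_add _ (N.fields.sub_mem hV hW) W hW s hs
  rw [sub_add_cancel] at h1
  rw [h1, add_sub_cancel_right]

theorem cov_congr {V W : ℝ → E} (hV : V ∈ N.fields) (hW : W ∈ N.fields)
    (h : ∀ s ∈ Icc 0 N.ℓ, V s = W s) {s : ℝ} (hs : s ∈ Icc 0 N.ℓ) : N.cov V s = N.cov W s := by
  rw [← sub_eq_zero, ← cov_sub hV hW hs]
  exact N.cov_zero _ (N.fields.sub_mem hV hW) (fun t ht ↦ by simp [h t ht]) s hs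

theorem IsJacobi.sub {J K : ℝ → E} (hJ : N.IsJacobi J) (hK : N.IsJacobi K) :
    N.IsJacobi (J - K) := by
  simpa [sub_eq_add_neg] using hJ.add (hK.smul (-1))

theorem isJacobi_zero : N.IsJacobi 0 := by
  have : N.curv 0 0 = 0 := by
    simpa using N.curv_smul 0 ⟨le_rfl, N.ℓ_pos.le⟩ 0 0
  refine ⟨N.fields.zero_mem, fun s hs ↦ ?_⟩
  have h1 : N.curv s 0 = 0 := by simpa using N.curv_smul s hs 0 0
  have h2 := N.cov_zero _ (N.cov_mem _ N.fields.zero_mem)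
    (N.cov_zero 0 N.fields.zero_mem fun _ _ ↦ rfl) s hs
  simp [h1, h2]

/-- The Wronskian of two Jacobi fields is constant. -/
theorem IsJacobi.wronskian {J K : ℝ → E} (hJ : N.IsJacobi J) (hK : N.IsJacobi K) {s t : ℝ}
    (hs : s ∈ Icc 0 N.ℓ) (ht : t ∈ Icc 0 N.ℓ) :
    N.metric s (N.cov J s) (K s) - N.metric s (J s) (N.cov K s) =
      N.metric t (N.cov J t) (K t) - N.metric t (J t) (N.cov K t) := by
  refine eq_of_hasDerivAt_zero
    (f := fun s ↦ N.metric s (N.cov J s) (K s) - N.metric s (J s) (N.cov K s)) (fun r hr ↦ ?_) hs ht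
  refine ((N.hasDerivAt_metric _ (N.cov_mem _ hJ.1) _ hK.1 r hr).sub
    (N.hasDerivAt_metric _ hJ.1 _ (N.cov_mem _ hK.1) r hr)).congr_deriv ?_
  rw [eq_neg_of_add_eq_zero_left (hJ.2 r hr), eq_neg_of_add_eq_zero_left (hK.2 r hr)]
  simp only [map_neg, _root_.neg_apply]
  rw [N.metric_symm r (J r), N.curv_symm r hr (K r)]
  ring

/-- A Jacobi field that vanishes twice has derivative orthogonal to the geodesic. -/
theorem IsJacobi.metric_cov_vel {J : ℝ → E} (hJ : N.IsJacobi J) (hvel : N.IsJacobi N.vel)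
    {s₁ s₂ : ℝ} (h₁ : s₁ ∈ Icc 0 N.ℓ) (h₂ : s₂ ∈ Icc 0 N.ℓ) (hne : s₁ ≠ s₂) (hJ₁ : J s₁ = 0)
    (hJ₂ : J s₂ = 0) {s : ℝ} (hs : s ∈ Icc 0 N.ℓ) : N.metric s (N.cov J s) (N.vel s) = 0 := by
  -- The Wronskian with the parallel field `γ̇` is `(J', γ̇)`, so `(J, γ̇)` has constant slope. Its
  -- two zeros then force the slope to be zero.
  have hc : ∀ t ∈ Icc 0 N.ℓ,
      N.metric t (N.cov J t) (N.vel t) = N.metric s (N.cov J s) (N.vel s) := by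
    intro t ht
    simpa [N.cov_vel t ht, N.cov_vel s hs] using hJ.wronskian hvel ht hs
  have := eq_of_hasDerivAt_zero
    (f := fun t ↦ N.metric t (J t) (N.vel t) - t * N.metric s (N.cov J s) (N.vel s)) (fun r hr ↦
      ((N.hasDerivAt_metric _ hJ.1 _ N.vel_mem r hr).sub
        ((hasDerivAt_id r).mul_const _)).congr_deriv (by simp [N.cov_vel r hr, hc r hr])) h₁ h₂
  simp only [hJ₁, hJ₂, map_zero, _root_.zero_apply, zero_sub, neg_inj] at this
  by_contra h
  exact hne (mul_right_cancel₀ h this)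

theorem isJacobi_of_mem_span {ι : Type*} {K : ι → ℝ → E} (hK : ∀ i, N.IsJacobi (K i)) {J : ℝ → E}
    (hJ : J ∈ Submodule.span ℝ (range K)) : N.IsJacobi J := by
  induction hJ using Submodule.span_induction with
  | mem x h => obtain ⟨i, rfl⟩ := h; exact hK i
  | zero => exact isJacobi_zero
  | add x y _ _ h1 h2 => exact h1.add h2
  | smul c x _ h => exact h.smul c

theorem ortho_of_mem_span {ι : Type*} {K : ι → ℝ → E} (hK : ∀ i, N.IsJacobi (K i)) {s : ℝ}
    (ho : ∀ i, N.metric s (N.cov (K i) s) (N.vel s) = 0) (hs : s ∈ Icc 0 N.ℓ) {J : ℝ → E}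
    (hJ : J ∈ Submodule.span ℝ (range K)) : N.metric s (N.cov J s) (N.vel s) = 0 := by
  induction hJ using Submodule.span_induction with
  | mem x h => obtain ⟨i, rfl⟩ := h; exact ho i
  | zero => simp [N.cov_zero 0 N.fields.zero_mem (fun _ _ ↦ rfl) s hs]
  | add x y hx hy h1 h2 =>
    simp [N.cov_add x (isJacobi_of_mem_span hK hx).1 y (isJacobi_of_mem_span hK hy).1 s hs, h1, h2]
  | smul c x hx h => simp [N.cov_smul c x (isJacobi_of_mem_span hK hx).1 s hs, h]

/-- The Cauchy data at `s` of the linear combinations of a family of Jacobi fields. -/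
def spanData {ι : Type*} {K : ι → ℝ → E} (hK : ∀ i, N.IsJacobi (K i)) {s : ℝ}
    (hs : s ∈ Icc 0 N.ℓ) : Submodule ℝ (E × E) where
  carrier := {x | ∃ J ∈ Submodule.span ℝ (range K), J s = x.1 ∧ N.cov J s = x.2}
  add_mem' := by
    rintro x y ⟨J, hJ, h1, h2⟩ ⟨L, hL, h3, h4⟩
    refine ⟨J + L, Submodule.add_mem _ hJ hL, by simp [h1, h3], ?_⟩
    rw [N.cov_add J (isJacobi_of_mem_span hK hJ).1 L (isJacobi_of_mem_span hK hL).1 s hs, h2, h4]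
    rfl
  zero_mem' := ⟨0, Submodule.zero_mem _, rfl,
    N.cov_zero 0 N.fields.zero_mem (fun _ _ ↦ rfl) s hs⟩
  smul_mem' := by
    rintro c x ⟨J, hJ, h1, h2⟩
    refine ⟨c • J, Submodule.smul_mem _ c hJ, by simp [h1], ?_⟩
    rw [N.cov_smul c J (isJacobi_of_mem_span hK hJ).1 s hs, h2]
    rfl

theorem mk_mem_spanData {ι : Type*} {K : ι → ℝ → E} (hK : ∀ i, N.IsJacobi (K i)) {s : ℝ}
    (hs : s ∈ Icc 0 N.ℓ) (i : ι) : (K i s, N.cov (K i) s) ∈ spanData hK hs :=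
  ⟨K i, Submodule.subset_span ⟨i, rfl⟩, rfl, rfl⟩

variable (N) in
/-- A finite family of Jacobi fields `K` with derivatives orthogonal to the geodesic, whose initial
data are all those compatible with orthogonality. -/
structure JacobiFrame (ι : Type*) [Fintype ι] where
  K : ι → ℝ → E
  isJacobi : ∀ i, N.IsJacobi (K i)
  ortho : ∀ i, ∀ s ∈ Icc 0 N.ℓ, N.metric s (N.cov (K i) s) (N.vel s) = 0
  vel_mem : N.vel ∈ Submodule.span ℝ (range K)
  smul_vel_mem : (fun s ↦ s • N.vel s) ∈ Submodule.span ℝ (range K)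
  card : Fintype.card ι + 1 = 2 * Module.finrank ℝ E
  initial : ∀ u w, N.metric 0 w (N.vel 0) = 0 →
    ∃ J ∈ Submodule.span ℝ (range K), J 0 = u ∧ N.cov J 0 = w

/-! ### Cauchy data of the span and the linear algebra of the lemma. -/

namespace JacobiFrame

variable {ι : Type*} [Fintype ι] (𝒦 : N.JacobiFrame ι)

theorem isJacobi_of_mem {J : ℝ → E} (hJ : J ∈ Submodule.span ℝ (range 𝒦.K)) : N.IsJacobi J :=
  isJacobi_of_mem_span 𝒦.isJacobi hJ

theorem ortho_of_mem {J : ℝ → E} (hJ : J ∈ Submodule.span ℝ (range 𝒦.K)) {s : ℝ}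
    (hs : s ∈ Icc 0 N.ℓ) : N.metric s (N.cov J s) (N.vel s) = 0 :=
  ortho_of_mem_span 𝒦.isJacobi (fun i ↦ 𝒦.ortho i s hs) hs hJ

/-- The Cauchy data at `s` of the field with given coefficients. -/
def data (s : Icc 0 N.ℓ) : (ι → ℝ) →ₗ[ℝ] E × E where
  toFun p := (Fintype.linearCombination ℝ 𝒦.K p s,
    N.cov (Fintype.linearCombination ℝ 𝒦.K p) s)
  map_add' p q := by
    have h (p) : Fintype.linearCombination ℝ 𝒦.K p ∈ N.fields :=
      (𝒦.isJacobi_of_mem (by rw [← Fintype.range_linearCombination]; exact ⟨p, rfl⟩)).1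
    rw [map_add, N.cov_add _ (h p) _ (h q) s s.2]
    rfl
  map_smul' c p := by
    have h (p) : Fintype.linearCombination ℝ 𝒦.K p ∈ N.fields :=
      (𝒦.isJacobi_of_mem (by rw [← Fintype.range_linearCombination]; exact ⟨p, rfl⟩)).1
    rw [map_smul, N.cov_smul c _ (h p) s s.2]
    rfl

theorem linearCombination_mem (p : ι → ℝ) :
    Fintype.linearCombination ℝ 𝒦.K p ∈ Submodule.span ℝ (range 𝒦.K) := by
  rw [← Fintype.range_linearCombination]
  exact ⟨p, rfl⟩

theorem exists_linearCombination {J : ℝ → E} (hJ : J ∈ Submodule.span ℝ (range 𝒦.K)) :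
    ∃ p : ι → ℝ, Fintype.linearCombination ℝ 𝒦.K p = J := by
  rw [← Fintype.range_linearCombination] at hJ
  exact hJ

/-- The possible Cauchy data at `s`. -/
def target (N : NullGeodesicCalculus E) (s : ℝ) : Submodule ℝ (E × E) :=
  LinearMap.ker (((N.metric s).flip (N.vel s) : E →ₗ[ℝ] ℝ) ∘ₗ LinearMap.snd ℝ E E)

theorem mem_target {s : ℝ} {x : E × E} : x ∈ target N s ↔ N.metric s x.2 (N.vel s) = 0 := by
  simp [target]

theorem range_data_le (s : Icc 0 N.ℓ) : LinearMap.range (𝒦.data s) ≤ target N s := by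
  rintro _ ⟨p, rfl⟩
  exact mem_target.2 (𝒦.ortho_of_mem (𝒦.linearCombination_mem p) s.2)

theorem zero_mem_Icc : (0 : ℝ) ∈ Icc 0 N.ℓ := ⟨le_rfl, N.ℓ_pos.le⟩

include 𝒦 in
theorem isJacobi_vel : N.IsJacobi N.vel := 𝒦.isJacobi_of_mem 𝒦.vel_mem

/-- As `γ̇` is null it lies in `γ̇^⊥`. Hence `u ⊥ γ̇`, so `u` itself is an admissible test vector
and is null, and null vectors of `γ̇^⊥` are multiples of `γ̇`. -/
theorem eq_smul_vel_of_forall {s : ℝ} (hs : s ∈ Icc 0 N.ℓ) {u : E}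
    (h : ∀ w, N.metric s w (N.vel s) = 0 → N.metric s u w = 0) : ∃ c : ℝ, u = c • N.vel s := by
  have h1 := h _ (N.vel_null s hs)
  exact N.eq_smul_vel s hs u h1 (h u h1)

/-- The tangential Jacobi field `(s - s₁) γ̇(s)` of the span. -/
theorem sub_smul_vel_mem (s₁ : ℝ) :
    (fun s ↦ (s - s₁) • N.vel s) ∈ Submodule.span ℝ (range 𝒦.K) := by
  have : (fun s ↦ (s - s₁) • N.vel s) = (fun s ↦ s • N.vel s) - s₁ • N.vel := by
    ext s
    simp [sub_smul]
  rw [this]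
  exact Submodule.sub_mem _ 𝒦.smul_vel_mem (Submodule.smul_mem _ _ 𝒦.vel_mem)

theorem cov_sub_smul_vel (s₁ : ℝ) {s : ℝ} (hs : s ∈ Icc 0 N.ℓ) :
    N.cov (fun s ↦ (s - s₁) • N.vel s) s = N.vel s := by
  have : (fun s ↦ (s - s₁) • N.vel s) = (fun s ↦ s • N.vel s) - s₁ • N.vel := by
    ext s
    simp [sub_smul]
  rw [this, cov_sub N.smul_vel_mem (N.fields.smul_mem _ N.vel_mem) hs, N.cov_smul_vel s hs,
    N.cov_smul _ _ N.vel_mem s hs, N.cov_vel s hs, smul_zero, sub_zero]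

theorem ortho_decomposition {J : ℝ → E} (hJ : J ∈ Submodule.span ℝ (range 𝒦.K)) {s : ℝ}
    (hs : s ∈ Icc 0 N.ℓ) (a : ℝ) : N.metric s (N.cov J s + a • N.vel s) (N.vel s) = 0 := by
  simp [𝒦.ortho_of_mem hJ hs, N.vel_null s hs]

/-- The derivatives at two zeros of a Jacobi field pair in the same way with the span. -/
theorem pairing_of_vanish {J : ℝ → E} (hJ : N.IsJacobi J) {s₁ s₂ : ℝ} (h₁ : s₁ ∈ Icc 0 N.ℓ)
    (h₂ : s₂ ∈ Icc 0 N.ℓ) (hJ₁ : J s₁ = 0) (hJ₂ : J s₂ = 0) {L : ℝ → E}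
    (hL : L ∈ Submodule.span ℝ (range 𝒦.K)) :
    N.metric s₁ (N.cov J s₁) (L s₁) = N.metric s₂ (N.cov J s₂) (L s₂) := by
  simpa [hJ₁, hJ₂] using hJ.wronskian (𝒦.isJacobi_of_mem hL) h₁ h₂

variable [FiniteDimensional ℝ E]

/-- Orthogonality to `γ̇` is one nontrivial linear condition, since `γ̇ ≠ 0` and the metric is
nondegenerate. The field `card` of `JacobiFrame` is this same count. -/
theorem finrank_target {s : ℝ} (hs : s ∈ Icc 0 N.ℓ) :
    Module.finrank ℝ (target N s) + 1 = 2 * Module.finrank ℝ E := by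
  have hne : ((N.metric s).flip (N.vel s) : E →ₗ[ℝ] ℝ) ∘ₗ LinearMap.snd ℝ E E ≠ 0 := by
    intro h
    refine N.vel_ne s hs (N.nondeg s hs _ fun v ↦ ?_)
    rw [N.metric_symm]
    simpa using LinearMap.congr_fun h (0, v)
  rw [target, Module.Dual.finrank_ker_add_one_of_ne_zero hne, Module.finrank_prod, two_mul]

include 𝒦 in
theorem finrank_target_eq {s : ℝ} (hs : s ∈ Icc 0 N.ℓ) :
    Module.finrank ℝ (target N s) = Module.finrank ℝ (ι → ℝ) := by
  have := 𝒦.card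
  have := finrank_target hs
  rw [Module.finrank_fintype_fun_eq_card]
  omega

/-- By `initial` the data map is onto a space whose dimension is the number of generators, so rank
and nullity leave no kernel. -/
theorem injective_data_zero : Function.Injective (𝒦.data ⟨0, zero_mem_Icc⟩) := by
  rw [← LinearMap.ker_eq_bot, ← Submodule.finrank_eq_zero]
  have h1 : LinearMap.range (𝒦.data ⟨0, zero_mem_Icc⟩) = target N 0 := by
    refine le_antisymm (𝒦.range_data_le _) fun x hx ↦ ?_
    obtain ⟨J, hJ, h1, h2⟩ := 𝒦.initial x.1 x.2 (mem_target.1 hx)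
    obtain ⟨p, rfl⟩ := 𝒦.exists_linearCombination hJ
    exact ⟨p, Prod.ext h1 h2⟩
  have h2 := LinearMap.finrank_range_add_finrank_ker (𝒦.data ⟨0, zero_mem_Icc⟩)
  have h3 := 𝒦.finrank_target_eq zero_mem_Icc
  rw [h1, h3] at h2
  omega

/-- A member of the span is determined by its Cauchy data at any parameter. -/
theorem injective_data (s : Icc 0 N.ℓ) : Function.Injective (𝒦.data s) := by
  rw [injective_iff_map_eq_zero]
  intro p hp
  have hmem := 𝒦.linearCombination_mem p
  set J := Fintype.linearCombination ℝ 𝒦.K p with hJ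
  have hp1 : J s = 0 := congr_arg Prod.fst hp
  have hp2 : N.cov J s = 0 := congr_arg Prod.snd hp
  -- Zero data at `s` make every Wronskian with the span vanish, also at `0`, where all admissible
  -- data of `L` are available. Data `(u, 0)` give `J'(0) = 0`; data `(0, w)` give `J(0) ∥ γ̇(0)`.
  have hω : ∀ L ∈ Submodule.span ℝ (range 𝒦.K),
      N.metric 0 (N.cov J 0) (L 0) - N.metric 0 (J 0) (N.cov L 0) = 0 := by
    intro L hL
    rw [(𝒦.isJacobi_of_mem hmem).wronskian (𝒦.isJacobi_of_mem hL) zero_mem_Icc s.2]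
    simp [hp1, hp2]
  have h1 : N.cov J 0 = 0 := by
    refine N.nondeg 0 zero_mem_Icc _ fun u ↦ ?_
    obtain ⟨L, hL, hL1, hL2⟩ := 𝒦.initial u 0 (by simp)
    simpa [hL1, hL2] using hω L hL
  obtain ⟨c, hc⟩ : ∃ c : ℝ, J 0 = c • N.vel 0 := by
    refine eq_smul_vel_of_forall zero_mem_Icc fun w hw ↦ ?_
    obtain ⟨L, hL, hL1, hL2⟩ := 𝒦.initial 0 w hw
    simpa [hL1, hL2] using hω L hL
  obtain ⟨q, hq⟩ := 𝒦.exists_linearCombination 𝒦.vel_mem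
  -- Injectivity at `0` identifies `J` with `c γ̇`. Its value at `s` is zero while `γ̇(s) ≠ 0`, so
  -- `c = 0`.
  have h2 : p = c • q := by
    apply 𝒦.injective_data_zero
    rw [map_smul]
    refine Prod.ext ?_ ?_
    · simpa [data, hq, ← hJ] using hc
    · simp [data, hq, ← hJ, h1, N.cov_vel 0 zero_mem_Icc]
  have h3 : c • N.vel s = 0 := by
    rw [← hp1, hJ, h2, map_smul, hq]
    rfl
  rw [h2, (smul_eq_zero.1 h3).resolve_right (N.vel_ne s s.2), zero_smul]

/-- The span realizes all Cauchy data orthogonal to the geodesic, at any parameter. -/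
theorem exists_of_data {s : ℝ} (hs : s ∈ Icc 0 N.ℓ) (u : E) {w : E}
    (hw : N.metric s w (N.vel s) = 0) :
    ∃ J ∈ Submodule.span ℝ (range 𝒦.K), J s = u ∧ N.cov J s = w := by
  have h1 : LinearMap.range (𝒦.data ⟨s, hs⟩) = target N s := by
    refine Submodule.eq_of_le_of_finrank_eq (𝒦.range_data_le _) ?_
    rw [LinearMap.finrank_range_of_inj (𝒦.injective_data _), 𝒦.finrank_target_eq hs]
  have h2 : (u, w) ∈ target N s := mem_target.2 hw
  rw [← h1] at h2
  obtain ⟨p, hp⟩ := h2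
  exact ⟨_, 𝒦.linearCombination_mem p, congr_arg Prod.fst hp, congr_arg Prod.snd hp⟩

include 𝒦 in
/-- Uniqueness for Jacobi fields with orthogonal derivative. -/
theorem eq_zero_of_data {J : ℝ → E} (hJ : N.IsJacobi J) {s : ℝ} (hs : s ∈ Icc 0 N.ℓ) (h₀ : J s = 0)
    (h₁ : N.cov J s = 0) {t : ℝ} (ht : t ∈ Icc 0 N.ℓ) : J t = 0 := by
  -- Here `J` need not be in the span, but its Wronskians with the span vanish at every `r`. Testing
  -- with all data at `r` gives `J'(r) = 0` and `J(r) ⊥ γ̇(r)^⊥`.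
  have hω : ∀ r ∈ Icc 0 N.ℓ, ∀ L ∈ Submodule.span ℝ (range 𝒦.K),
      N.metric r (N.cov J r) (L r) - N.metric r (J r) (N.cov L r) = 0 := by
    intro r hr L hL
    rw [hJ.wronskian (𝒦.isJacobi_of_mem hL) hr hs]
    simp [h₀, h₁]
  have hcov : ∀ r ∈ Icc 0 N.ℓ, N.cov J r = 0 := by
    intro r hr
    refine N.nondeg r hr _ fun u ↦ ?_
    obtain ⟨L, hL, hL1, hL2⟩ := 𝒦.exists_of_data hr u (w := 0) (by simp)
    simpa [hL1, hL2] using hω r hr L hL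
  have hpar : ∀ r ∈ Icc 0 N.ℓ, ∀ w, N.metric r w (N.vel r) = 0 → N.metric r (J r) w = 0 := by
    intro r hr w hw
    obtain ⟨L, hL, hL1, hL2⟩ := 𝒦.exists_of_data hr 0 hw
    simpa [hL1, hL2] using hω r hr L hL
  refine N.nondeg t ht _ fun u ↦ ?_
  obtain ⟨L, hL, hL1, -⟩ := 𝒦.exists_of_data ht u (w := 0) (by simp)
  -- The derivative is `(J', L) + (J, L')`. The first term is zero as `J' = 0`, the second as `L' ⊥
  -- γ̇`. So `(J, L)` keeps its value `0` at `s`, while `L(t)` is arbitrary.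
  have := eq_of_hasDerivAt_zero (f := fun r ↦ N.metric r (J r) (L r)) (fun r hr ↦
    (N.hasDerivAt_metric _ hJ.1 _ (𝒦.isJacobi_of_mem hL).1 r hr).congr_deriv (by
      simp [hcov r hr, hpar r hr _ (𝒦.ortho_of_mem hL hr)])) ht hs
  simpa [hL1, h₀] using this

/-- A Jacobi field that vanishes twice belongs to the span. -/
theorem exists_eq_of_vanish {J : ℝ → E} (hJ : N.IsJacobi J) {s₁ s₂ : ℝ} (h₁ : s₁ ∈ Icc 0 N.ℓ)
    (h₂ : s₂ ∈ Icc 0 N.ℓ) (hne : s₁ ≠ s₂) (hJ₁ : J s₁ = 0) (hJ₂ : J s₂ = 0) :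
    ∃ L ∈ Submodule.span ℝ (range 𝒦.K), ∀ s ∈ Icc 0 N.ℓ, L s = J s := by
  obtain ⟨L, hL, hL1, hL2⟩ := 𝒦.exists_of_data h₁ (J s₁)
    (hJ.metric_cov_vel 𝒦.isJacobi_vel h₁ h₂ hne hJ₁ hJ₂ h₁)
  refine ⟨L, hL, fun s hs ↦ ?_⟩
  have hLJ := 𝒦.isJacobi_of_mem hL
  rw [← sub_eq_zero, ← Pi.sub_apply]
  exact 𝒦.eq_zero_of_data (hLJ.sub hJ) h₁ (by simp [hL1])
    (by rw [cov_sub hLJ.1 hJ.1 h₁, hL2, sub_self]) hs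

/-- `J` and `c (s - s₁) γ̇` have the same data at `s₁`, so they agree on `[0, ℓ]`. The value at `s₂`
forces `c = 0`. -/
theorem eq_zero_of_cov_tangent {J : ℝ → E} (hJ : J ∈ Submodule.span ℝ (range 𝒦.K)) {s₁ s₂ : ℝ}
    (h₁ : s₁ ∈ Icc 0 N.ℓ) (h₂ : s₂ ∈ Icc 0 N.ℓ) (hne : s₁ ≠ s₂) (hJ₁ : J s₁ = 0) (hJ₂ : J s₂ = 0)
    {c : ℝ} (hc : N.cov J s₁ = c • N.vel s₁) : c = 0 ∧ ∀ s ∈ Icc 0 N.ℓ, J s = 0 := by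
  have hT := 𝒦.isJacobi_of_mem (𝒦.sub_smul_vel_mem s₁)
  have hJJ := 𝒦.isJacobi_of_mem hJ
  have h {t : ℝ} := 𝒦.eq_zero_of_data (t := t) (hJJ.sub (hT.smul c)) h₁ (by simp [hJ₁])
    (by rw [cov_sub hJJ.1 (hT.smul c).1 h₁, N.cov_smul _ _ hT.1 s₁ h₁, cov_sub_smul_vel s₁ h₁, hc,
      sub_self])
  have hc0 : c = 0 := by
    have := h h₂
    simp only [Pi.sub_apply, hJ₂, Pi.smul_apply, zero_sub, neg_eq_zero, smul_eq_zero,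
      N.vel_ne s₂ h₂, or_false, sub_eq_zero, hne.symm] at this
    exact this
  exact ⟨hc0, fun s hs ↦ by simpa [hc0] using h hs⟩

theorem cov_eq_of_decomposition {J K : ℝ → E} (hJ : J ∈ Submodule.span ℝ (range 𝒦.K))
    (hK : K ∈ Submodule.span ℝ (range 𝒦.K)) {s₁ s₂ : ℝ} (h₁ : s₁ ∈ Icc 0 N.ℓ) (h₂ : s₂ ∈ Icc 0 N.ℓ)
    (hne : s₁ ≠ s₂) (hJ₁ : J s₁ = 0) (hJ₂ : J s₂ = 0) (hK₁ : K s₁ = 0) (hK₂ : K s₂ = 0) {a b : ℝ}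
    (h : N.cov J s₁ + a • N.vel s₁ = N.cov K s₁ + b • N.vel s₁) :
    a = b ∧ ∀ s ∈ Icc 0 N.ℓ, N.cov J s = N.cov K s := by
  have hJJ := 𝒦.isJacobi_of_mem hJ
  have hKJ := 𝒦.isJacobi_of_mem hK
  have := 𝒦.eq_zero_of_cov_tangent (Submodule.sub_mem _ hJ hK) h₁ h₂ hne (by simp [hJ₁, hK₁])
    (by simp [hJ₂, hK₂]) (c := b - a) (by
      rw [cov_sub hJJ.1 hKJ.1 h₁, sub_smul, sub_eq_sub_iff_add_eq_add, h, add_comm])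
  exact ⟨(sub_eq_zero.1 this.1).symm, fun s hs ↦ cov_congr hJJ.1 hKJ.1
    (fun t ht ↦ sub_eq_zero.1 (this.2 t ht)) hs⟩

/-- A vector of `γ̇^⊥` that is not spacelike is a multiple of `γ̇`, and then so is `J'(s₁)`, which
forces `J = 0`. The criterion at `s₂` follows by exchanging the two parameters. -/
theorem pos_iff {J : ℝ → E} (hJ : J ∈ Submodule.span ℝ (range 𝒦.K)) {s₁ s₂ : ℝ}
    (h₁ : s₁ ∈ Icc 0 N.ℓ) (h₂ : s₂ ∈ Icc 0 N.ℓ) (hne : s₁ ≠ s₂) (hJ₁ : J s₁ = 0) (hJ₂ : J s₂ = 0)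
    (a : ℝ) : 0 < N.metric s₁ (N.cov J s₁ + a • N.vel s₁) (N.cov J s₁ + a • N.vel s₁) ↔
      ∃ s ∈ Icc 0 N.ℓ, N.cov J s ≠ 0 := by
  have ho := 𝒦.ortho_decomposition hJ h₁ a
  constructor
  · intro h
    refine ⟨s₁, h₁, fun h0 ↦ ?_⟩
    simp [h0, N.vel_null s₁ h₁] at h
  · rintro ⟨s, hs, hne0⟩
    refine lt_of_le_of_ne (N.nonneg s₁ h₁ _ ho) fun h0 ↦ hne0 ?_
    obtain ⟨c, hc⟩ := N.eq_smul_vel s₁ h₁ _ ho h0.symm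
    have := 𝒦.eq_zero_of_cov_tangent hJ h₁ h₂ hne hJ₁ hJ₂ (c := c - a)
      (by rw [sub_smul, ← hc, add_sub_cancel_right])
    exact N.cov_zero J (𝒦.isJacobi_of_mem hJ).1 this.2 s hs

theorem eq_of_pairing {s : ℝ} (hs : s ∈ Icc 0 N.ℓ) {v₁ v₂ : E}
    (h : ∀ J ∈ Submodule.span ℝ (range 𝒦.K), N.metric s v₁ (J s) = N.metric s v₂ (J s)) :
    v₁ = v₂ := by
  rw [← sub_eq_zero]
  refine N.nondeg s hs _ fun u ↦ ?_
  obtain ⟨J, hJ, rfl, -⟩ := 𝒦.exists_of_data hs u (w := 0) (by simp)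
  simp [h J hJ]

theorem exists_decomposition {s₁ s₂ : ℝ} (h₁ : s₁ ∈ Icc 0 N.ℓ) (h₂ : s₂ ∈ Icc 0 N.ℓ)
    (hne : s₁ ≠ s₂) {v₁ v₂ : E} (hv₁ : N.metric s₁ v₁ (N.vel s₁) = 0)
    (h : ∀ J ∈ Submodule.span ℝ (range 𝒦.K), N.metric s₁ v₁ (J s₁) = N.metric s₂ v₂ (J s₂)) :
    ∃ J ∈ Submodule.span ℝ (range 𝒦.K), J s₁ = 0 ∧ J s₂ = 0 ∧ ∃ a : ℝ,
      v₁ = N.cov J s₁ + a • N.vel s₁ ∧ v₂ = N.cov J s₂ + a • N.vel s₂ := by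
  obtain ⟨J, hJ, hJ1, hJ2⟩ := 𝒦.exists_of_data h₁ 0 hv₁
  have hJJ := 𝒦.isJacobi_of_mem hJ
  -- At `s₁` the Wronskian of `J` and `L` is `(v₁, L(s₁))`, as `J(s₁) = 0` and `J'(s₁) = v₁`. By
  -- hypothesis this equals `(v₂, L(s₂))`.
  have hω : ∀ L ∈ Submodule.span ℝ (range 𝒦.K), N.metric s₂ v₂ (L s₂) =
      N.metric s₂ (N.cov J s₂) (L s₂) - N.metric s₂ (J s₂) (N.cov L s₂) := by
    intro L hL
    rw [← hJJ.wronskian (𝒦.isJacobi_of_mem hL) h₁ h₂, hJ1, hJ2, ← h L hL]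
    simp
  have hv₂ : v₂ = N.cov J s₂ := by
    rw [← sub_eq_zero]
    refine N.nondeg s₂ h₂ _ fun u ↦ ?_
    obtain ⟨L, hL, hL1, hL2⟩ := 𝒦.exists_of_data h₂ u (w := 0) (by simp)
    have := hω L hL
    rw [hL1, hL2] at this
    simp [this]
  obtain ⟨c, hc⟩ : ∃ c : ℝ, J s₂ = c • N.vel s₂ := by
    refine eq_smul_vel_of_forall h₂ fun w hw ↦ ?_
    obtain ⟨L, hL, hL1, hL2⟩ := 𝒦.exists_of_data h₂ 0 hw
    simpa [hL1, hL2] using hω L hL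
  have hd : s₂ - s₁ ≠ 0 := sub_ne_zero.2 hne.symm
  have hT := 𝒦.isJacobi_of_mem (𝒦.sub_smul_vel_mem s₁)
  have hcov : ∀ s ∈ Icc 0 N.ℓ, N.cov (J - (c / (s₂ - s₁)) • fun s ↦ (s - s₁) • N.vel s) s =
      N.cov J s - (c / (s₂ - s₁)) • N.vel s := by
    intro s hs
    rw [cov_sub hJJ.1 (hT.smul _).1 hs, N.cov_smul _ _ hT.1 s hs, cov_sub_smul_vel s₁ hs]
  -- The factor `c / (s₂ - s₁)` makes `(s - s₁) γ̇` cancel `J(s₂) = c γ̇(s₂)`. It reappears as the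
  -- coefficient of `γ̇` because `((s - s₁) γ̇)' = γ̇`.
  refine ⟨_, Submodule.sub_mem _ hJ (Submodule.smul_mem _ (c / (s₂ - s₁))
    (𝒦.sub_smul_vel_mem s₁)), by simp [hJ1], ?_, c / (s₂ - s₁), ?_, ?_⟩
  · simp [hc, smul_smul, div_mul_cancel₀ _ hd]
  · rw [hcov s₁ h₁, hJ2, sub_add_cancel]
  · rw [hcov s₂ h₂, hv₂, sub_add_cancel]

end JacobiFrame

end NullGeodesicCalculus

/-! ### The metric and tangent vectors in the preferred charts of the manifold. -/

section Charts

open Filter Topology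

set_option maxSynthPendingDepth 3

/-- The model space of an `(1 + n)`-dimensional manifold. -/
abbrev ModelSpace (n : ℕ) := EuclideanSpace ℝ (Fin (n + 1))

variable {n : ℕ} {M : Type*} [TopologicalSpace M]
  [ChartedSpace (EuclideanSpace ℝ (Fin (n + 1))) M]

/-- The differential at `x` of the preferred chart at `x₀`. -/
def chartDiff (n : ℕ) {M : Type*} [TopologicalSpace M]
    [ChartedSpace (EuclideanSpace ℝ (Fin (n + 1))) M] (x₀ x : M) : ModelSpace n →L[ℝ] ModelSpace n :=
  mfderiv (𝓡 (n + 1)) 𝓘(ℝ, ModelSpace n) (extChartAt (𝓡 (n + 1)) x₀) x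

/-- The differential of the inverse of the preferred chart at `x₀`. -/
def chartDiffSymm (n : ℕ) {M : Type*} [TopologicalSpace M]
    [ChartedSpace (EuclideanSpace ℝ (Fin (n + 1))) M] (x₀ : M) (y : ModelSpace n) :
    ModelSpace n →L[ℝ] ModelSpace n :=
  mfderiv 𝓘(ℝ, ModelSpace n) (𝓡 (n + 1)) (extChartAt (𝓡 (n + 1)) x₀).symm y

theorem source_mem_nhds {x₀ x : M} (hx : x ∈ (extChartAt (𝓡 (n + 1)) x₀).source) :
    (extChartAt (𝓡 (n + 1)) x₀).source ∈ 𝓝 x :=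
  (isOpen_extChartAt_source x₀).mem_nhds hx

variable [IsManifold (𝓡 (n + 1)) ∞ M]

theorem chartDiffSymm_chartDiff {x₀ x : M} (hx : x ∈ (extChartAt (𝓡 (n + 1)) x₀).source)
    (v : ModelSpace n) :
    chartDiffSymm n x₀ (extChartAt (𝓡 (n + 1)) x₀ x) (chartDiff n x₀ x v) = v := by
  have h := mfderivWithin_extChartAt_symm_comp_mfderiv_extChartAt' (I := 𝓡 (n + 1)) hx
  rw [ModelWithCorners.range_eq_univ, mfderivWithin_univ] at h
  exact DFunLike.congr_fun h v

theorem chartDiff_chartDiffSymm {x₀ : M} {y : ModelSpace n}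
    (hy : y ∈ (extChartAt (𝓡 (n + 1)) x₀).target) (v : ModelSpace n) :
    chartDiff n x₀ ((extChartAt (𝓡 (n + 1)) x₀).symm y) (chartDiffSymm n x₀ y v) = v := by
  have h := mfderiv_extChartAt_comp_mfderivWithin_extChartAt_symm (I := 𝓡 (n + 1)) hy
  rw [ModelWithCorners.range_eq_univ, mfderivWithin_univ] at h
  exact DFunLike.congr_fun h v

theorem chartDiff_self (x : M) (v : ModelSpace n) : chartDiff n x x v = v := by
  have h := mfderiv_extChartAt_self (I := 𝓡 (n + 1)) (x := x)
  exact DFunLike.congr_fun h v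

theorem chartDiff_surjective {x₀ x : M} (hx : x ∈ (extChartAt (𝓡 (n + 1)) x₀).source) :
    Function.Surjective (chartDiff n x₀ x) := fun v ↦ by
  have h := chartDiff_chartDiffSymm ((extChartAt (𝓡 (n + 1)) x₀).map_source hx) v
  rw [(extChartAt (𝓡 (n + 1)) x₀).left_inv hx] at h
  exact ⟨_, h⟩

/-- Links the bundle trivialization, through which smoothness of fields is defined, with the
differential of the chart, through which they are differentiated. -/
theorem trivializationAt_snd {x₀ x : M} (hx : x ∈ (extChartAt (𝓡 (n + 1)) x₀).source)
    (v : TangentSpace (𝓡 (n + 1)) x) :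
    (trivializationAt (EuclideanSpace ℝ (Fin (n + 1))) (TangentSpace (𝓡 (n + 1))) x₀
      (⟨x, v⟩ : TangentBundle (𝓡 (n + 1)) M)).2 = chartDiff n x₀ x v := by
  have h1 := TangentBundle.continuousLinearMapAt_trivializationAt (I := 𝓡 (n + 1))
    (x₀ := x₀) (x := x) (by simpa using hx)
  have h2 := DFunLike.congr_fun h1 v
  rw [Bundle.Trivialization.continuousLinearMapAt_apply,
    Bundle.Trivialization.coe_linearMapAt_of_mem _ (by simpa using hx)] at h2
  exact h2

/-- The change of coordinates between preferred charts. -/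
def chartChange (n : ℕ) {M : Type*} [TopologicalSpace M]
    [ChartedSpace (EuclideanSpace ℝ (Fin (n + 1))) M] (x₀ x₁ : M) (y : ModelSpace n) :
    ModelSpace n :=
  extChartAt (𝓡 (n + 1)) x₁ ((extChartAt (𝓡 (n + 1)) x₀).symm y)

theorem contDiffAt_chartChange {x₀ x₁ x : M} (h₀ : x ∈ (extChartAt (𝓡 (n + 1)) x₀).source)
    (h₁ : x ∈ (extChartAt (𝓡 (n + 1)) x₁).source) :
    ContDiffAt ℝ ∞ (chartChange n x₀ x₁) (extChartAt (𝓡 (n + 1)) x₀ x) := by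
  rw [← contMDiffAt_iff_contDiffAt]
  have e1 : ContMDiffAt 𝓘(ℝ, ModelSpace n) (𝓡 (n + 1)) ∞ (extChartAt (𝓡 (n + 1)) x₀).symm
      (extChartAt (𝓡 (n + 1)) x₀ x) :=
    (contMDiffOn_extChartAt_symm x₀).contMDiffAt
      ((isOpen_extChartAt_target x₀).mem_nhds ((extChartAt (𝓡 (n + 1)) x₀).map_source h₀))
  refine ContMDiffAt.comp (I' := 𝓡 (n + 1)) _ ?_ e1
  rw [(extChartAt (𝓡 (n + 1)) x₀).left_inv h₀]
  exact contMDiffAt_extChartAt' (by simpa using h₁)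

theorem fderiv_chartChange {x₀ x₁ x : M} (h₀ : x ∈ (extChartAt (𝓡 (n + 1)) x₀).source)
    (h₁ : x ∈ (extChartAt (𝓡 (n + 1)) x₁).source) (v : ModelSpace n) :
    fderiv ℝ (chartChange n x₀ x₁) (extChartAt (𝓡 (n + 1)) x₀ x) (chartDiff n x₀ x v) =
      chartDiff n x₁ x v := by
  have hψ := (contDiffAt_chartChange h₀ h₁).differentiableAt (by simp)
  have h : (chartChange n x₀ x₁ ∘ extChartAt (𝓡 (n + 1)) x₀) =ᶠ[𝓝 x]
      extChartAt (𝓡 (n + 1)) x₁ := by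
    filter_upwards [source_mem_nhds h₀] with y hy
    simp only [chartChange, Function.comp_apply, (extChartAt (𝓡 (n + 1)) x₀).left_inv hy]
  have h2 := mfderiv_comp x hψ.mdifferentiableAt
    (mdifferentiableAt_extChartAt (I := 𝓡 (n + 1)) (by simpa using h₀))
  rw [h.mfderiv_eq, mfderiv_eq_fderiv] at h2
  exact (DFunLike.congr_fun h2 v).symm

namespace LorentzianMetric

variable (g : LorentzianMetric n M)

/-- The scalar product at `x` as a bilinear form on the model space. -/
def form (x : M) : ModelSpace n →L[ℝ] ModelSpace n →L[ℝ] ℝ := g.inner x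

theorem form_symm (x : M) (v w : ModelSpace n) : g.form x v w = g.form x w v := g.symm x v w

theorem inChart_apply (x₀ : M) (y u v : ModelSpace n) : g.inChart x₀ y u v =
    g.form ((extChartAt (𝓡 (n + 1)) x₀).symm y) (chartDiffSymm n x₀ y u)
      (chartDiffSymm n x₀ y v) := rfl

theorem inChart_chartDiff {x₀ x : M} (hx : x ∈ (extChartAt (𝓡 (n + 1)) x₀).source)
    (u v : ModelSpace n) : g.inChart x₀ (extChartAt (𝓡 (n + 1)) x₀ x) (chartDiff n x₀ x u)
      (chartDiff n x₀ x v) = g.form x u v := by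
  rw [inChart_apply, chartDiffSymm_chartDiff hx, chartDiffSymm_chartDiff hx,
    (extChartAt (𝓡 (n + 1)) x₀).left_inv hx]

theorem form_nondeg (x : M) {u : ModelSpace n} (h : ∀ v, g.form x u v = 0) : u = 0 := by
  obtain ⟨b, hb⟩ := g.signature x
  let b' : Module.Basis (Fin (n + 1)) ℝ (ModelSpace n) := b
  have hb' : ∀ i j, g.form x (b' i) (b' j) = if i = j then (if i = 0 then -1 else 1) else 0 := hb
  apply b'.repr.injective
  ext j
  have h1 := h (b' j)
  rw [← b'.sum_repr u] at h1
  simp only [map_sum, map_smul, _root_.sum_apply, _root_.smul_apply, hb', smul_eq_mul, mul_ite, mul_zero,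
    Finset.sum_ite_eq', Finset.mem_univ, if_true] at h1
  split_ifs at h1 <;> simpa using h1

theorem form_invertible (x : M) : (g.form x).IsInvertible := by
  have hinj : Function.Injective (g.form x) := by
    rw [injective_iff_map_eq_zero]
    intro u hu
    exact g.form_nondeg x fun v ↦ by rw [hu]; rfl
  have hd : Module.finrank ℝ (ModelSpace n) = Module.finrank ℝ (ModelSpace n →L[ℝ] ℝ) := by
    rw [(LinearMap.toContinuousLinearMap (𝕜 := ℝ) (E := ModelSpace n) (F' := ℝ)).symm.finrank_eq]
    exact Subspace.dual_finrank_eq.symm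
  exact ⟨((g.form x : ModelSpace n →ₗ[ℝ] _).linearEquivOfInjective hinj
    hd).toContinuousLinearEquiv, by ext; rfl⟩

theorem inChart_invertible {x₀ : M} {y : ModelSpace n}
    (hy : y ∈ (extChartAt (𝓡 (n + 1)) x₀).target) : (g.inChart x₀ y).IsInvertible := by
  have hinj : Function.Injective (g.inChart x₀ y) := by
    rw [injective_iff_map_eq_zero]
    intro u hu
    have hs := (extChartAt (𝓡 (n + 1)) x₀).map_target hy
    rw [← (extChartAt (𝓡 (n + 1)) x₀).right_inv hy] at hu
    obtain ⟨u, rfl⟩ := chartDiff_surjective hs u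
    have h0 : u = 0 := g.form_nondeg _ fun v ↦ by rw [← inChart_chartDiff g hs u v, hu]; rfl
    rw [h0, map_zero]
  have hd : Module.finrank ℝ (ModelSpace n) = Module.finrank ℝ (ModelSpace n →L[ℝ] ℝ) := by
    rw [(LinearMap.toContinuousLinearMap (𝕜 := ℝ) (E := ModelSpace n) (F' := ℝ)).symm.finrank_eq]
    exact Subspace.dual_finrank_eq.symm
  exact ⟨((g.inChart x₀ y : ModelSpace n →ₗ[ℝ] _).linearEquivOfInjective hinj
    hd).toContinuousLinearEquiv, by ext; rfl⟩

/-- Smoothness is tested on the coefficients `g(dφ⁻¹ u, dφ⁻¹ v)`. The fields `dφ⁻¹ u` are smooth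
because their coordinate representation is the constant `u`. -/
theorem contDiffOn_inChart (x₀ : M) :
    ContDiffOn ℝ ∞ (g.inChart x₀) (extChartAt (𝓡 (n + 1)) x₀).target := by
  rw [contDiffOn_clm_apply]
  intro u
  rw [contDiffOn_clm_apply]
  intro v y hy
  refine ContDiffAt.contDiffWithinAt ?_
  rw [← contMDiffAt_iff_contDiffAt]
  set φ := extChartAt (𝓡 (n + 1)) x₀ with hφ
  have hm : ContMDiffAt 𝓘(ℝ, ModelSpace n) (𝓡 (n + 1)) ∞ φ.symm y :=
    (contMDiffOn_extChartAt_symm x₀).contMDiffAt ((isOpen_extChartAt_target x₀).mem_nhds hy)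
  have hs (u : ModelSpace n) : ContMDiffAt 𝓘(ℝ, ModelSpace n) ((𝓡 (n + 1)).prod 𝓘(ℝ, ModelSpace n))
      ∞ (fun y ↦ (⟨φ.symm y, chartDiffSymm n x₀ y u⟩ : TangentBundle (𝓡 (n + 1)) M)) y := by
    have hy' : φ.symm y ∈ (extChartAt (𝓡 (n + 1)) x₀).source := φ.map_target hy
    rw [(Bundle.Trivialization.contMDiffAt_iff (e := trivializationAt (ModelSpace n)
      (TangentSpace (𝓡 (n + 1))) x₀) (by simpa using hy'))]
    refine ⟨hm, contMDiffAt_const (c := u) |>.congr_of_eventuallyEq ?_⟩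
    filter_upwards [(isOpen_extChartAt_target x₀).mem_nhds hy] with z hz
    have hz' : φ.symm z ∈ (extChartAt (𝓡 (n + 1)) x₀).source := φ.map_target hz
    exact (trivializationAt_snd hz' _).trans (chartDiff_chartDiffSymm hz u)
  have h1 := ContMDiffAt.clm_bundle_apply₂ (𝕜 := ℝ) (F₁ := ModelSpace n) (F₂ := ModelSpace n)
    (F₃ := ℝ) (E₁ := TangentSpace (𝓡 (n + 1)) (M := M)) (E₂ := TangentSpace (𝓡 (n + 1)) (M := M))
    (E₃ := Bundle.Trivial M ℝ)
    (IM := 𝓘(ℝ, ModelSpace n)) (IB := 𝓡 (n + 1)) (n := ∞) (x := y) (b := φ.symm)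
    (ψ := fun y ↦ g.inner (φ.symm y)) (v := fun y ↦ chartDiffSymm n x₀ y u)
    (w := fun y ↦ chartDiffSymm n x₀ y v)
    (ContMDiffAt.comp y g.contMDiff.contMDiffAt hm) (hs u) (hs v)
  exact (Bundle.contMDiffAt_totalSpace.1 h1).2

end LorentzianMetric

end Charts

/-! ### Covariant derivative and curvature on the manifold. -/

section CovariantDerivative

open Filter Topology

set_option maxSynthPendingDepth 3

variable {n : ℕ} {M : Type*} [TopologicalSpace M]
  [ChartedSpace (EuclideanSpace ℝ (Fin (n + 1))) M]

/-- The velocity of a curve as a field of vectors of the model space. -/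
def vel (n : ℕ) {M : Type*} [TopologicalSpace M]
    [ChartedSpace (EuclideanSpace ℝ (Fin (n + 1))) M] (γ : ℝ → M) (s : ℝ) : ModelSpace n :=
  velocity γ s

/-- The curve `γ` in the preferred chart at `x₀`. -/
def coordCurve (n : ℕ) {M : Type*} [TopologicalSpace M]
    [ChartedSpace (EuclideanSpace ℝ (Fin (n + 1))) M] (x₀ : M) (γ : ℝ → M) (τ : ℝ) :
    ModelSpace n := extChartAt (𝓡 (n + 1)) x₀ (γ τ)

/-- The vector field `V` along `γ` in the preferred chart at `x₀`. -/
def coordField (x₀ : M) (γ : ℝ → M) (V : ℝ → ModelSpace n) (τ : ℝ) : ModelSpace n :=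
  chartDiff n x₀ (γ τ) (V τ)

variable [IsManifold (𝓡 (n + 1)) ∞ M]

/-- The vector field `V` along `γ` is smooth at the parameter `s`. -/
def SmoothFieldAt (γ : ℝ → M) (V : ℝ → ModelSpace n) (s : ℝ) : Prop :=
  ContMDiffAt 𝓘(ℝ, ℝ) (𝓡 (n + 1)).tangent ∞
    (fun τ ↦ (⟨γ τ, V τ⟩ : TangentBundle (𝓡 (n + 1)) M)) s

theorem smoothFieldAt_iff {γ : ℝ → M} {V : ℝ → ModelSpace n} {s : ℝ} {x₀ : M}
    (hs : γ s ∈ (extChartAt (𝓡 (n + 1)) x₀).source) : SmoothFieldAt γ V s ↔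
      ContMDiffAt 𝓘(ℝ, ℝ) (𝓡 (n + 1)) ∞ γ s ∧ ContDiffAt ℝ ∞ (coordField x₀ γ V) s := by
  unfold SmoothFieldAt
  rw [(Bundle.Trivialization.contMDiffAt_iff (e := trivializationAt (EuclideanSpace ℝ (Fin (n + 1)))
    (TangentSpace (𝓡 (n + 1))) x₀) (by simpa using hs)), ← contMDiffAt_iff_contDiffAt]
  refine and_congr_right fun hγ ↦ ?_
  have : (fun τ ↦ (trivializationAt (EuclideanSpace ℝ (Fin (n + 1)))
      (TangentSpace (𝓡 (n + 1))) x₀ (⟨γ τ, V τ⟩ : TangentBundle (𝓡 (n + 1)) M)).2) =ᶠ[𝓝 s]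
      coordField x₀ γ V := by
    filter_upwards [hγ.continuousAt (source_mem_nhds hs)] with τ hτ
    exact trivializationAt_snd hτ _
  exact this.contMDiffAt_iff

theorem contDiffAt_coordCurve {γ : ℝ → M} {s : ℝ} {x₀ : M}
    (hs : γ s ∈ (extChartAt (𝓡 (n + 1)) x₀).source) {k : ℕ∞}
    (hγ : ContMDiffAt 𝓘(ℝ, ℝ) (𝓡 (n + 1)) k γ s) : ContDiffAt ℝ k (coordCurve n x₀ γ) s := by
  rw [← contMDiffAt_iff_contDiffAt]
  exact ((contMDiffAt_extChartAt' (I := 𝓡 (n + 1)) (n := ∞) (by simpa using hs)).of_le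
    (WithTop.coe_le_coe.2 le_top)).comp s hγ

theorem differentiableAt_coordCurve {γ : ℝ → M} {s : ℝ} {x₀ : M}
    (hs : γ s ∈ (extChartAt (𝓡 (n + 1)) x₀).source)
    (hγ : MDifferentiableAt 𝓘(ℝ, ℝ) (𝓡 (n + 1)) γ s) :
    DifferentiableAt ℝ (coordCurve n x₀ γ) s := by
  rw [← mdifferentiableAt_iff_differentiableAt]
  exact (mdifferentiableAt_extChartAt (I := 𝓡 (n + 1)) (by simpa using hs)).comp s hγ

theorem ContMDiffAt.eventually_mdifferentiableAt_curve {γ : ℝ → M} {s : ℝ}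
    (hγ : ContMDiffAt 𝓘(ℝ, ℝ) (𝓡 (n + 1)) ∞ γ s) :
    ∀ᶠ τ in 𝓝 s, MDifferentiableAt 𝓘(ℝ, ℝ) (𝓡 (n + 1)) γ τ := by
  filter_upwards [(contMDiffAt_iff_contMDiffAt_nhds (n := 1) (by simp)).1
    (hγ.of_le (by simp))] with τ hτ using hτ.mdifferentiableAt (by simp)

theorem chartDiff_vel {γ : ℝ → M} {s : ℝ} {x₀ : M}
    (hs : γ s ∈ (extChartAt (𝓡 (n + 1)) x₀).source)
    (hγ : MDifferentiableAt 𝓘(ℝ, ℝ) (𝓡 (n + 1)) γ s) :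
    chartDiff n x₀ (γ s) (vel n γ s) = deriv (coordCurve n x₀ γ) s := by
  have h := mfderiv_comp s (mdifferentiableAt_extChartAt (I := 𝓡 (n + 1)) (x := x₀)
    (by simpa using hs)) hγ
  rw [mfderiv_eq_fderiv] at h
  exact (DFunLike.congr_fun h (1 : ℝ)).symm

theorem coordField_vel_eventuallyEq {γ : ℝ → M} {s : ℝ} {x₀ : M}
    (hs : γ s ∈ (extChartAt (𝓡 (n + 1)) x₀).source) (hγ : ContMDiffAt 𝓘(ℝ, ℝ) (𝓡 (n + 1)) ∞ γ s) :
    coordField x₀ γ (vel n γ) =ᶠ[𝓝 s] deriv (coordCurve n x₀ γ) := by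
  filter_upwards [hγ.continuousAt (source_mem_nhds hs), hγ.eventually_mdifferentiableAt_curve]
    with τ h1 h2 using chartDiff_vel h1 h2

theorem ContDiffAt.deriv_infty {E : Type*} [NormedAddCommGroup E] [NormedSpace ℝ E] {f : ℝ → E}
    {s : ℝ} (h : ContDiffAt ℝ ∞ f s) : ContDiffAt ℝ ∞ (deriv f) s := by
  have : deriv f = fun s ↦ fderiv ℝ f s 1 := by
    ext s
    simp
  rw [this]
  exact h.fderiv_apply_const 1

namespace LorentzianMetric

variable (g : LorentzianMetric n M)

theorem isMetricNear_inChart {x₀ : M} {y : ModelSpace n}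
    (hy : y ∈ (extChartAt (𝓡 (n + 1)) x₀).target) : IsMetricNear (g.inChart x₀) y := by
  refine ⟨?_, .of_forall fun x u v ↦ g.form_symm _ _ _, g.inChart_invertible hy⟩
  have ho := isOpen_extChartAt_target (I := 𝓡 (n + 1)) x₀
  filter_upwards [ho.mem_nhds hy] with z hz
  exact (g.contDiffOn_inChart x₀).contDiffAt (ho.mem_nhds hz)

theorem isMetricNear_coord {x₀ x : M} (hx : x ∈ (extChartAt (𝓡 (n + 1)) x₀).source) :
    IsMetricNear (g.inChart x₀) (extChartAt (𝓡 (n + 1)) x₀ x) :=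
  g.isMetricNear_inChart ((extChartAt (𝓡 (n + 1)) x₀).map_source hx)

theorem eventually_inChart_eq {x₀ x₁ x : M} (h₀ : x ∈ (extChartAt (𝓡 (n + 1)) x₀).source)
    (h₁ : x ∈ (extChartAt (𝓡 (n + 1)) x₁).source) :
    ∀ᶠ y in 𝓝 (extChartAt (𝓡 (n + 1)) x₀ x), ∀ u v, g.inChart x₀ y u v =
      g.inChart x₁ (chartChange n x₀ x₁ y) (fderiv ℝ (chartChange n x₀ x₁) y u)
        (fderiv ℝ (chartChange n x₀ x₁) y v) := by
  have hc : ContinuousAt (extChartAt (𝓡 (n + 1)) x₀).symm (extChartAt (𝓡 (n + 1)) x₀ x) :=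
    continuousAt_extChartAt_symm' h₀
  have hm : (extChartAt (𝓡 (n + 1)) x₁).source ∈
      𝓝 ((extChartAt (𝓡 (n + 1)) x₀).symm (extChartAt (𝓡 (n + 1)) x₀ x)) := by
    rw [(extChartAt (𝓡 (n + 1)) x₀).left_inv h₀]
    exact source_mem_nhds h₁
  filter_upwards [hc hm, (isOpen_extChartAt_target (I := 𝓡 (n + 1)) x₀).mem_nhds
    ((extChartAt (𝓡 (n + 1)) x₀).map_source h₀)] with y hy hy' u v
  obtain ⟨z, hz, rfl⟩ : ∃ z ∈ (extChartAt (𝓡 (n + 1)) x₀).source, extChartAt (𝓡 (n + 1)) x₀ z = y :=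
    ⟨_, (extChartAt (𝓡 (n + 1)) x₀).map_target hy', (extChartAt (𝓡 (n + 1)) x₀).right_inv hy'⟩
  have hz' : z ∈ (extChartAt (𝓡 (n + 1)) x₁).source := by
    rwa [mem_preimage, (extChartAt (𝓡 (n + 1)) x₀).left_inv hz] at hy
  obtain ⟨u, rfl⟩ := chartDiff_surjective hz u
  obtain ⟨v, rfl⟩ := chartDiff_surjective hz v
  rw [g.inChart_chartDiff hz, fderiv_chartChange hz hz', fderiv_chartChange hz hz', chartChange,
    (extChartAt (𝓡 (n + 1)) x₀).left_inv hz, g.inChart_chartDiff hz']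

/-- The covariant derivative along `γ`, for fields of vectors of the model space. -/
def cov (γ : ℝ → M) (V : ℝ → ModelSpace n) (s : ℝ) : ModelSpace n := g.covDeriv γ V s

theorem cov_eq_chartCov {γ : ℝ → M} {s : ℝ} (hγ : MDifferentiableAt 𝓘(ℝ, ℝ) (𝓡 (n + 1)) γ s)
    (V : ℝ → ModelSpace n) : g.cov γ V s =
      chartCov (g.inChart (γ s)) (coordCurve n (γ s) γ) (coordField (γ s) γ V) s := by
  rw [chartCov, ← chartDiff_vel (mem_extChartAt_source _) hγ, chartDiff_self]
  have : coordField (γ s) γ V s = V s := chartDiff_self _ _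
  rw [this, christoffelMap_apply]
  rfl

/-- The covariant derivative can be computed in any chart. -/
theorem chartDiff_cov {γ : ℝ → M} {V : ℝ → ModelSpace n} {s : ℝ} {x₀ : M}
    (hs : γ s ∈ (extChartAt (𝓡 (n + 1)) x₀).source)
    (hγ : MDifferentiableAt 𝓘(ℝ, ℝ) (𝓡 (n + 1)) γ s)
    (hV : DifferentiableAt ℝ (coordField x₀ γ V) s) :
    chartDiff n x₀ (γ s) (g.cov γ V s) =
      chartCov (g.inChart x₀) (coordCurve n x₀ γ) (coordField x₀ γ V) s := by
  have h₁ := mem_extChartAt_source (I := 𝓡 (n + 1)) (γ s)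
  have hsur : Function.Surjective (fderiv ℝ (chartChange n x₀ (γ s)) (coordCurve n x₀ γ s)) := by
    intro v
    exact ⟨chartDiff n x₀ (γ s) v, (fderiv_chartChange hs h₁ v).trans (chartDiff_self _ _)⟩
  have hev := hγ.continuousAt (source_mem_nhds hs)
  have hev' := hγ.continuousAt (source_mem_nhds h₁)
  have hch : chartChange n x₀ (γ s) (coordCurve n x₀ γ s) = extChartAt (𝓡 (n + 1)) (γ s) (γ s) := by
    rw [chartChange, coordCurve, (extChartAt (𝓡 (n + 1)) x₀).left_inv hs]
  -- The transition map from the chart at `x₀` to the chart at `γ s`, in which `covDeriv` is defined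
  -- and whose differential at `γ s` is the identity.
  have key := chartCov_transform (g.isMetricNear_coord hs)
    (G₁ := g.inChart (γ s)) (ψ := chartChange n x₀ (γ s)) (c := coordCurve n x₀ γ)
    (v := coordField x₀ γ V) (c₁ := coordCurve n (γ s) γ) (v₁ := coordField (γ s) γ V) (s := s)
    (by rw [hch]; exact g.isMetricNear_coord h₁)
    ((contDiffAt_chartChange hs h₁).of_le (WithTop.coe_le_coe.2 (le_top : (2 : ℕ∞) ≤ ⊤))) hsur
    (g.eventually_inChart_eq hs h₁) (differentiableAt_coordCurve hs hγ) hV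
    (by
      filter_upwards [hev] with τ hτ
      rw [chartChange, coordCurve, coordCurve, (extChartAt (𝓡 (n + 1)) x₀).left_inv hτ])
    (by
      filter_upwards [hev, hev'] with τ h1 h2
      exact (fderiv_chartChange h1 h2 _).symm)
  obtain ⟨w, hw⟩ := chartDiff_surjective hs
    (chartCov (g.inChart x₀) (coordCurve n x₀ γ) (coordField x₀ γ V) s)
  rw [← g.cov_eq_chartCov hγ, ← hw] at key
  rw [key, ← hw]
  congr 1
  exact (fderiv_chartChange hs h₁ w).trans (chartDiff_self _ _)

variable {g}

/-- `covDeriv` uses a chart that moves with the parameter. Reading it in one fixed chart near `s` is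
what allows it to be differentiated again. -/
theorem coordField_cov_eventuallyEq {γ : ℝ → M} {V : ℝ → ModelSpace n} {s : ℝ} {x₀ : M}
    (hs : γ s ∈ (extChartAt (𝓡 (n + 1)) x₀).source) (hV : SmoothFieldAt γ V s) :
    coordField x₀ γ (g.cov γ V) =ᶠ[𝓝 s]
      chartCov (g.inChart x₀) (coordCurve n x₀ γ) (coordField x₀ γ V) := by
  obtain ⟨hγ, hv⟩ := (smoothFieldAt_iff hs).1 hV
  filter_upwards [hγ.continuousAt (source_mem_nhds hs), hγ.eventually_mdifferentiableAt_curve,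
    hv.eventually_differentiableAt] with τ h1 h2 h3 using g.chartDiff_cov h1 h2 h3

theorem smoothFieldAt_cov {γ : ℝ → M} {V : ℝ → ModelSpace n} {s : ℝ} (hV : SmoothFieldAt γ V s) :
    SmoothFieldAt γ (g.cov γ V) s := by
  have hs := mem_extChartAt_source (I := 𝓡 (n + 1)) (γ s)
  obtain ⟨hγ, hv⟩ := (smoothFieldAt_iff hs).1 hV
  refine (smoothFieldAt_iff hs).2 ⟨hγ, ContDiffAt.congr_of_eventuallyEq ?_
    (coordField_cov_eventuallyEq hs hV)⟩
  have hc := contDiffAt_coordCurve hs hγ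
  have hΓ : ContDiffAt ℝ ∞ (fun τ ↦ christoffelMap (g.inChart (γ s)) (coordCurve n (γ s) γ τ)) s :=
    ContDiffAt.comp (g := christoffelMap (g.inChart (γ s))) s
      (g.isMetricNear_coord hs).contDiffAt_christoffel hc
  exact hv.deriv_infty.add ((hΓ.clm_apply hc.deriv_infty).clm_apply hv)

theorem smoothFieldAt_vel {γ : ℝ → M} {s : ℝ} (hγ : ContMDiffAt 𝓘(ℝ, ℝ) (𝓡 (n + 1)) ∞ γ s) :
    SmoothFieldAt γ (vel n γ) s := by
  have hs := mem_extChartAt_source (I := 𝓡 (n + 1)) (γ s)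
  exact (smoothFieldAt_iff hs).2 ⟨hγ, (contDiffAt_coordCurve hs hγ).deriv_infty.congr_of_eventuallyEq
    (coordField_vel_eventuallyEq hs hγ)⟩

theorem hasDerivAt_form {γ : ℝ → M} {V W : ℝ → ModelSpace n} {s : ℝ} (hV : SmoothFieldAt γ V s)
    (hW : SmoothFieldAt γ W s) : HasDerivAt (fun τ ↦ g.form (γ τ) (V τ) (W τ))
      (g.form (γ s) (g.cov γ V s) (W s) + g.form (γ s) (V s) (g.cov γ W s)) s := by
  have hs := mem_extChartAt_source (I := 𝓡 (n + 1)) (γ s)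
  obtain ⟨hγ, hv⟩ := (smoothFieldAt_iff hs).1 hV
  obtain ⟨-, hw⟩ := (smoothFieldAt_iff hs).1 hW
  have hγ' := hγ.mdifferentiableAt (by simp)
  have h := (g.isMetricNear_coord hs).hasDerivAt_apply (c := coordCurve n (γ s) γ)
    (differentiableAt_coordCurve hs hγ') (hv.differentiableAt (by simp))
    (hw.differentiableAt (by simp))
  refine (h.congr_of_eventuallyEq ?_).congr_deriv ?_
  · filter_upwards [hγ.continuousAt (source_mem_nhds hs)] with τ hτ
    exact (g.inChart_chartDiff hτ _ _).symm
  · rw [← g.chartDiff_cov hs hγ' (hv.differentiableAt (by simp)),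
      ← g.chartDiff_cov hs hγ' (hw.differentiableAt (by simp))]
    exact congr_arg₂ _ (g.inChart_chartDiff hs _ _) (g.inChart_chartDiff hs _ _)

theorem cov_add {γ : ℝ → M} {V W : ℝ → ModelSpace n} {s : ℝ} (hV : SmoothFieldAt γ V s)
    (hW : SmoothFieldAt γ W s) : g.cov γ (V + W) s = g.cov γ V s + g.cov γ W s := by
  have hs := mem_extChartAt_source (I := 𝓡 (n + 1)) (γ s)
  obtain ⟨hγ, hv⟩ := (smoothFieldAt_iff hs).1 hV
  obtain ⟨-, hw⟩ := (smoothFieldAt_iff hs).1 hW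
  have hγ' := hγ.mdifferentiableAt (by simp)
  have e : coordField (γ s) γ (V + W) = coordField (γ s) γ V + coordField (γ s) γ W := by
    ext1 τ
    exact map_add _ _ _
  simp only [g.cov_eq_chartCov hγ', chartCov, e]
  rw [deriv_add (hv.differentiableAt (by simp)) (hw.differentiableAt (by simp)), Pi.add_apply,
    map_add]
  abel

/-- The Leibniz rule. -/
theorem cov_smul {γ : ℝ → M} {V : ℝ → ModelSpace n} {s : ℝ} {f : ℝ → ℝ} {f' : ℝ}
    (hf : HasDerivAt f f' s) (hV : SmoothFieldAt γ V s) :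
    g.cov γ (fun τ ↦ f τ • V τ) s = f' • V s + f s • g.cov γ V s := by
  have hs := mem_extChartAt_source (I := 𝓡 (n + 1)) (γ s)
  obtain ⟨hγ, hv⟩ := (smoothFieldAt_iff hs).1 hV
  have hγ' := hγ.mdifferentiableAt (by simp)
  have e : coordField (γ s) γ (fun τ ↦ f τ • V τ) = fun τ ↦ f τ • coordField (γ s) γ V τ := by
    ext1 τ
    exact map_smul _ _ _
  have e0 : coordField (γ s) γ V s = V s := chartDiff_self _ _
  simp only [g.cov_eq_chartCov hγ', chartCov, e]
  rw [show deriv (fun τ ↦ f τ • coordField (γ s) γ V τ) s = _ from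
    (hf.smul (hv.differentiableAt (by simp)).hasDerivAt).deriv, e0, map_smul]
  module

theorem smoothFieldAt_smul {γ : ℝ → M} {V : ℝ → ModelSpace n} {s : ℝ} {f : ℝ → ℝ}
    (hf : ContDiffAt ℝ ∞ f s) (hV : SmoothFieldAt γ V s) :
    SmoothFieldAt γ (fun τ ↦ f τ • V τ) s := by
  have hs := mem_extChartAt_source (I := 𝓡 (n + 1)) (γ s)
  obtain ⟨hγ, hv⟩ := (smoothFieldAt_iff hs).1 hV
  have e : coordField (γ s) γ (fun τ ↦ f τ • V τ) = fun τ ↦ f τ • coordField (γ s) γ V τ := by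
    ext1 τ
    exact map_smul _ _ _
  exact (smoothFieldAt_iff hs).2 ⟨hγ, e ▸ hf.smul hv⟩

theorem smoothFieldAt_add {γ : ℝ → M} {V W : ℝ → ModelSpace n} {s : ℝ} (hV : SmoothFieldAt γ V s)
    (hW : SmoothFieldAt γ W s) : SmoothFieldAt γ (V + W) s := by
  have hs := mem_extChartAt_source (I := 𝓡 (n + 1)) (γ s)
  obtain ⟨hγ, hv⟩ := (smoothFieldAt_iff hs).1 hV
  obtain ⟨-, hw⟩ := (smoothFieldAt_iff hs).1 hW
  have e : coordField (γ s) γ (V + W) = coordField (γ s) γ V + coordField (γ s) γ W := by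
    ext1 τ
    exact map_add _ _ _
  exact (smoothFieldAt_iff hs).2 ⟨hγ, e ▸ hv.add hw⟩

theorem cov_eq_zero {γ : ℝ → M} {V : ℝ → ModelSpace n} {ℓ s : ℝ} (hℓ : 0 < ℓ) (hs : s ∈ Icc 0 ℓ)
    (hV : SmoothFieldAt γ V s) (h0 : ∀ t ∈ Icc 0 ℓ, V t = 0) : g.cov γ V s = 0 := by
  have hs' := mem_extChartAt_source (I := 𝓡 (n + 1)) (γ s)
  obtain ⟨hγ, hv⟩ := (smoothFieldAt_iff hs').1 hV
  have e : ∀ t ∈ Icc 0 ℓ, coordField (γ s) γ V t = 0 := fun t ht ↦ by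
    rw [coordField, h0 t ht, map_zero]
  -- At an end point `V` may be nonzero on one side. The derivative exists, so it is determined by
  -- its restriction to `[0, ℓ]`.
  have hd : deriv (coordField (γ s) γ V) s = 0 := by
    have h1 := (hv.differentiableAt (by simp)).hasDerivAt.hasDerivWithinAt (s := Icc 0 ℓ)
    have h2 := (hasDerivWithinAt_const s (Icc 0 ℓ) (0 : ModelSpace n)).congr e (e s hs)
    exact (uniqueDiffOn_Icc hℓ s hs).eq_deriv _ h1 h2
  rw [g.cov_eq_chartCov (hγ.mdifferentiableAt (by simp)), chartCov, hd, e s hs, map_zero, add_zero]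

/-- The curvature at `x` on the model space. -/
def curv (g : LorentzianMetric n M) (x : M) (u v w : ModelSpace n) : ModelSpace n :=
  g.curvature x u v w

/-- `curvature` differentiates the Christoffel symbols with arguments frozen, and `chartCurvature`
differentiates the field of bilinear maps. Differentiability of that field makes them agree. -/
theorem curv_eq (x : M) (u v w : ModelSpace n) :
    g.curv x u v w = chartCurvature (g.inChart x) (extChartAt (𝓡 (n + 1)) x x) u v w := by
  have hΓ := (g.isMetricNear_coord (mem_extChartAt_source (I := 𝓡 (n + 1)) x)).hasFDerivAt_christoffel
  have e (u v : ModelSpace n) : (fun y ↦ g.christoffel x y u v) =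
      fun y ↦ christoffelMap (g.inChart x) y u v := by
    ext1 y
    rw [christoffelMap_apply]
    rfl
  have e' (y u v : ModelSpace n) : g.christoffel x y u v = christoffelMap (g.inChart x) y u v :=
    congr_fun (e u v) y
  have hd (v w : ModelSpace n) : fderiv ℝ (fun y ↦ g.christoffel x y v w)
      (extChartAt (𝓡 (n + 1)) x x) = ((fderiv ℝ (christoffelMap (g.inChart x))
        (extChartAt (𝓡 (n + 1)) x x)).flip v).flip w := by
    rw [e, ((hΓ.clm_apply (hasFDerivAt_const v _)).clm_apply (hasFDerivAt_const w _)).fderiv]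
    ext
    simp
  change fderiv ℝ (fun y ↦ g.christoffel x y v w) _ u - fderiv ℝ (fun y ↦ g.christoffel x y u w) _ v
    + g.christoffel x _ u (g.christoffel x _ v w) - g.christoffel x _ v (g.christoffel x _ u w) = _
  rw [hd, hd]
  simp only [e']
  rfl

theorem form_curv_symm (x : M) (u v w : ModelSpace n) :
    g.form x (g.curv x u w w) v = g.form x (g.curv x v w w) u := by
  have hx := mem_extChartAt_source (I := 𝓡 (n + 1)) x
  have h := (g.isMetricNear_coord hx).curvature_symm u v w
  rw [← curv_eq, ← curv_eq] at h
  have e (u v : ModelSpace n) : g.inChart x (extChartAt (𝓡 (n + 1)) x x) u v = g.form x u v := by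
    rw [← g.inChart_chartDiff hx, chartDiff_self, chartDiff_self]
  rwa [e, e] at h

theorem curv_add (x : M) (u v w : ModelSpace n) :
    g.curv x (u + v) w w = g.curv x u w w + g.curv x v w w := by
  simp only [curv_eq, chartCurvature, map_add, _root_.add_apply]
  abel

theorem curv_smul (x : M) (c : ℝ) (u w : ModelSpace n) :
    g.curv x (c • u) w w = c • g.curv x u w w := by
  simp only [curv_eq, chartCurvature, map_smul, _root_.smul_apply]
  module

end LorentzianMetric

end CovariantDerivative

/-! ### Variations through lightlike geodesics on the manifold. -/

section GeodesicVariation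

open Filter Topology

set_option maxSynthPendingDepth 3

variable {n : ℕ} {M : Type*} [TopologicalSpace M]
  [ChartedSpace (EuclideanSpace ℝ (Fin (n + 1))) M]

/-- The variation field of a one-parameter family of curves. -/
def variationField (n : ℕ) {M : Type*} [TopologicalSpace M]
    [ChartedSpace (EuclideanSpace ℝ (Fin (n + 1))) M] (f : ℝ × ℝ → M) (s : ℝ) : ModelSpace n :=
  vel n (fun ε ↦ f (ε, s)) 0

theorem ContMDiffAt.snd_slice {f : ℝ × ℝ → M} {ε s : ℝ}
    (h : ContMDiffAt 𝓘(ℝ, ℝ × ℝ) (𝓡 (n + 1)) ∞ f (ε, s)) :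
    ContMDiffAt 𝓘(ℝ, ℝ) (𝓡 (n + 1)) ∞ (fun τ ↦ f (ε, τ)) s :=
  ContMDiffAt.comp (I' := 𝓘(ℝ, ℝ × ℝ)) s h
    (contMDiffAt_iff_contDiffAt.2 (contDiffAt_const.prodMk contDiffAt_id))

theorem MDifferentiableAt.fst_slice {f : ℝ × ℝ → M} {ε s : ℝ}
    (h : MDifferentiableAt 𝓘(ℝ, ℝ × ℝ) (𝓡 (n + 1)) f (ε, s)) :
    MDifferentiableAt 𝓘(ℝ, ℝ) (𝓡 (n + 1)) (fun ε ↦ f (ε, s)) ε :=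
  MDifferentiableAt.comp (I' := 𝓘(ℝ, ℝ × ℝ)) ε h
    (mdifferentiableAt_iff_differentiableAt.2
      (differentiableAt_id.prodMk (differentiableAt_const s)))

theorem variationField_eq_zero {f : ℝ × ℝ → M} {s : ℝ} (h : ∀ᶠ ε in 𝓝 (0 : ℝ), f (ε, s) = f (0, s)) :
    variationField n f s = 0 := by
  have h0 := Filter.EventuallyEq.mfderiv_eq (I := 𝓘(ℝ, ℝ)) (I' := 𝓡 (n + 1)) h
  have h1 : mfderiv 𝓘(ℝ, ℝ) (𝓡 (n + 1)) (fun _ : ℝ ↦ f (0, s)) 0 = 0 := mfderiv_const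
  exact DFunLike.congr_fun (h0.trans h1) (1 : ℝ)

variable [IsManifold (𝓡 (n + 1)) ∞ M]

/-- A smooth one-parameter family of lightlike geodesics defined on `[0, ℓ]`. -/
structure IsNullGeodesicVariation (g : LorentzianMetric n M) (f : ℝ × ℝ → M) (ℓ : ℝ) : Prop where
  smooth : ∀ᶠ ε in 𝓝 (0 : ℝ), ∀ s ∈ Icc 0 ℓ,
    ContMDiffAt 𝓘(ℝ, ℝ × ℝ) (𝓡 (n + 1)) ∞ f (ε, s)
  geodesic : ∀ᶠ ε in 𝓝 (0 : ℝ), ∀ s ∈ Icc 0 ℓ,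
    g.cov (fun τ ↦ f (ε, τ)) (vel n fun τ ↦ f (ε, τ)) s = 0
  null : ∀ᶠ ε in 𝓝 (0 : ℝ), ∀ s ∈ Icc 0 ℓ,
    g.form (f (ε, s)) (vel n (fun τ ↦ f (ε, τ)) s) (vel n (fun τ ↦ f (ε, τ)) s) = 0

theorem chartCov_congr {E : Type*} [NormedAddCommGroup E] [NormedSpace ℝ E]
    {G : E → E →L[ℝ] E →L[ℝ] ℝ} {c v w : ℝ → E} {s : ℝ} (h : v =ᶠ[𝓝 s] w) :
    chartCov G c v s = chartCov G c w s := by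
  rw [chartCov, chartCov, h.deriv_eq, h.self_of_nhds]

theorem chartCov_eventuallyEq {E : Type*} [NormedAddCommGroup E] [NormedSpace ℝ E]
    {G : E → E →L[ℝ] E →L[ℝ] ℝ} {c v w : ℝ → E} {s : ℝ} (h : v =ᶠ[𝓝 s] w) :
    chartCov G c v =ᶠ[𝓝 s] chartCov G c w :=
  h.eventuallyEq_nhds.mono fun _ ht ↦ chartCov_congr ht

/-- A variation in the preferred chart at `x₀`. -/
def coordVariation (n : ℕ) {M : Type*} [TopologicalSpace M]
    [ChartedSpace (EuclideanSpace ℝ (Fin (n + 1))) M] (x₀ : M) (f : ℝ × ℝ → M) (p : ℝ × ℝ) :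
    ModelSpace n := extChartAt (𝓡 (n + 1)) x₀ (f p)

theorem contDiffAt_coordVariation {f : ℝ × ℝ → M} {s : ℝ} {x₀ : M}
    (hs : f (0, s) ∈ (extChartAt (𝓡 (n + 1)) x₀).source)
    (h : ContMDiffAt 𝓘(ℝ, ℝ × ℝ) (𝓡 (n + 1)) ∞ f (0, s)) :
    ContDiffAt ℝ ∞ (coordVariation n x₀ f) (0, s) := by
  rw [← contMDiffAt_iff_contDiffAt]
  exact (contMDiffAt_extChartAt' (I := 𝓡 (n + 1)) (n := ∞) (by simpa using hs)).comp (0, s) h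

theorem coordField_variationField_eventuallyEq {f : ℝ × ℝ → M} {s : ℝ} {x₀ : M}
    (hs : f (0, s) ∈ (extChartAt (𝓡 (n + 1)) x₀).source)
    (h : ContMDiffAt 𝓘(ℝ, ℝ × ℝ) (𝓡 (n + 1)) ∞ f (0, s)) :
    coordField x₀ (fun τ ↦ f (0, τ)) (variationField n f) =ᶠ[𝓝 s]
      fun τ ↦ deriv (fun ε ↦ coordVariation n x₀ f (ε, τ)) 0 := by
  have h1 : ∀ᶠ p in 𝓝 ((0 : ℝ), s), MDifferentiableAt 𝓘(ℝ, ℝ × ℝ) (𝓡 (n + 1)) f p := by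
    filter_upwards [(contMDiffAt_iff_contMDiffAt_nhds (n := 1) (by simp)).1
      (h.of_le (by simp))] with p hp using hp.mdifferentiableAt (by simp)
  filter_upwards [h1.snd_slice, Filter.Eventually.snd_slice
    (h.continuousAt (source_mem_nhds hs))] with τ h1 h2
  exact chartDiff_vel (γ := fun ε ↦ f (ε, τ)) (s := 0) h2 h1.fst_slice

theorem smoothFieldAt_variationField {f : ℝ × ℝ → M} {s : ℝ}
    (h : ContMDiffAt 𝓘(ℝ, ℝ × ℝ) (𝓡 (n + 1)) ∞ f (0, s)) :
    SmoothFieldAt (fun τ ↦ f (0, τ)) (variationField n f) s := by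
  have hs := mem_extChartAt_source (I := 𝓡 (n + 1)) (f (0, s))
  have hC := contDiffAt_coordVariation hs h
  refine (smoothFieldAt_iff hs).2 ⟨h.snd_slice, ?_⟩
  have h1 : ContDiffAt ℝ ∞ (fun τ ↦ fderiv ℝ (coordVariation n (f (0, s)) f) (0, τ) (1, 0)) s :=
    ContDiffAt.comp (g := fun p ↦ fderiv ℝ (coordVariation n (f (0, s)) f) p (1, 0)) s
      (hC.fderiv_apply_const (1, 0)) (contDiffAt_const.prodMk contDiffAt_id)
  refine h1.congr_of_eventuallyEq ((coordField_variationField_eventuallyEq hs h).trans ?_)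
  exact (eventually_deriv_fst hC).snd_slice

theorem chartDiff_vel_variation {f : ℝ × ℝ → M} {s : ℝ} {x₀ : M}
    (hs : f (0, s) ∈ (extChartAt (𝓡 (n + 1)) x₀).source)
    (h0 : ContMDiffAt 𝓘(ℝ, ℝ × ℝ) (𝓡 (n + 1)) ∞ f (0, s))
    (h : ∀ᶠ ε in 𝓝 (0 : ℝ), ContMDiffAt 𝓘(ℝ, ℝ × ℝ) (𝓡 (n + 1)) ∞ f (ε, s)) :
    ∀ᶠ ε in 𝓝 (0 : ℝ), chartDiff n x₀ (f (ε, s)) (vel n (fun τ ↦ f (ε, τ)) s) =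
      deriv (fun τ ↦ coordVariation n x₀ f (ε, τ)) s := by
  filter_upwards [h, Filter.Eventually.fst_slice (h0.continuousAt (source_mem_nhds hs))]
    with ε h1 h2
  exact chartDiff_vel (γ := fun τ ↦ f (ε, τ)) h2 (h1.snd_slice.mdifferentiableAt (by simp))

namespace IsNullGeodesicVariation

variable {g : LorentzianMetric n M} {f : ℝ × ℝ → M} {ℓ s : ℝ}

theorem smooth_zero (h : IsNullGeodesicVariation g f ℓ) (hs : s ∈ Icc 0 ℓ) :
    ContMDiffAt 𝓘(ℝ, ℝ × ℝ) (𝓡 (n + 1)) ∞ f (0, s) := h.smooth.self_of_nhds s hs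

theorem cov_variationField (h : IsNullGeodesicVariation g f ℓ) (hs : s ∈ Icc 0 ℓ) :
    g.cov (fun τ ↦ f (0, τ)) (variationField n f) s =
      chartCov (g.inChart (f (0, s))) (fun τ ↦ coordVariation n (f (0, s)) f (0, τ))
        (fun τ ↦ deriv (fun ε ↦ coordVariation n (f (0, s)) f (ε, τ)) 0) s := by
  have hsm := h.smooth_zero hs
  have hsrc := mem_extChartAt_source (I := 𝓡 (n + 1)) (f (0, s))
  rw [g.cov_eq_chartCov (hsm.snd_slice.mdifferentiableAt (by simp)),
    chartCov_congr (coordField_variationField_eventuallyEq hsrc hsm)]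
  rfl

/-- The variation field of a family of geodesics is a Jacobi field. -/
theorem jacobi (h : IsNullGeodesicVariation g f ℓ) (hs : s ∈ Icc 0 ℓ) :
    g.cov (fun τ ↦ f (0, τ)) (g.cov (fun τ ↦ f (0, τ)) (variationField n f)) s +
      g.curv (f (0, s)) (variationField n f s) (vel n (fun τ ↦ f (0, τ)) s)
        (vel n (fun τ ↦ f (0, τ)) s) = 0 := by
  have hsm := h.smooth_zero hs
  have hsrc := mem_extChartAt_source (I := 𝓡 (n + 1)) (f (0, s))
  have hC := contDiffAt_coordVariation hsrc hsm
  have hmd := hsm.snd_slice.mdifferentiableAt (by simp)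
  have hV := smoothFieldAt_variationField hsm
  have hgeo : ∀ᶠ ε in 𝓝 (0 : ℝ), chartCov (g.inChart (f (0, s)))
      (fun τ ↦ coordVariation n (f (0, s)) f (ε, τ))
      (deriv fun τ ↦ coordVariation n (f (0, s)) f (ε, τ)) s = 0 := by
    filter_upwards [h.smooth, h.geodesic,
      Filter.Eventually.fst_slice (hsm.continuousAt (source_mem_nhds hsrc))] with ε h1 h2 h3
    have h1' := (h1 s hs).snd_slice
    have e := coordField_vel_eventuallyEq (γ := fun τ ↦ f (ε, τ)) h3 h1'
    have h4 := g.chartDiff_cov (γ := fun τ ↦ f (ε, τ)) (V := vel n fun τ ↦ f (ε, τ)) (s := s) h3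
      (h1'.mdifferentiableAt (by simp))
      (((contDiffAt_coordCurve (γ := fun τ ↦ f (ε, τ)) h3 h1').deriv_infty.congr_of_eventuallyEq
        e).differentiableAt (by simp))
    rw [h2 s hs, map_zero, chartCov_congr e] at h4
    exact h4.symm
  have key := chartCov_chartCov_variation (g.isMetricNear_coord hsrc) hC hgeo
  have eV : deriv (fun ε ↦ coordVariation n (f (0, s)) f (ε, s)) 0 = variationField n f s := by
    exact (coordField_variationField_eventuallyEq hsrc hsm).self_of_nhds.symm.trans
      (chartDiff_self _ _)
  have eT : deriv (fun τ ↦ coordVariation n (f (0, s)) f (0, τ)) s =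
      vel n (fun τ ↦ f (0, τ)) s := by
    rw [← chartDiff_self (f (0, s)) (vel n (fun τ ↦ f (0, τ)) s)]
    exact (chartDiff_vel hsrc hmd).symm
  rw [eV, eT] at key
  rw [g.cov_eq_chartCov hmd, chartCov_congr (LorentzianMetric.coordField_cov_eventuallyEq hsrc hV),
    chartCov_congr (chartCov_eventuallyEq (coordField_variationField_eventuallyEq hsrc hsm)),
    LorentzianMetric.curv_eq]
  exact key

/-- The square norm of the velocities vanishes for all small `ε`, and by the first variation formula
its `ε`-derivative is `2 (V', γ̇)`. -/
theorem ortho (h : IsNullGeodesicVariation g f ℓ) (hs : s ∈ Icc 0 ℓ) :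
    g.form (f (0, s)) (g.cov (fun τ ↦ f (0, τ)) (variationField n f) s)
      (vel n (fun τ ↦ f (0, τ)) s) = 0 := by
  have hsm := h.smooth_zero hs
  have hsrc := mem_extChartAt_source (I := 𝓡 (n + 1)) (f (0, s))
  have hC := contDiffAt_coordVariation hsrc hsm
  have hvel := chartDiff_vel_variation hsrc hsm (h.smooth.mono fun ε hε ↦ hε s hs)
  have h1 := deriv_normSq_variation (g.isMetricNear_coord hsrc) hC
  have h2 : (fun ε ↦ g.inChart (f (0, s)) (coordVariation n (f (0, s)) f (ε, s))
      (deriv (fun τ ↦ coordVariation n (f (0, s)) f (ε, τ)) s)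
      (deriv (fun τ ↦ coordVariation n (f (0, s)) f (ε, τ)) s)) =ᶠ[𝓝 0] fun _ ↦ (0 : ℝ) := by
    filter_upwards [hvel, h.null,
      Filter.Eventually.fst_slice (hsm.continuousAt (source_mem_nhds hsrc))] with ε h1 h2 h3
    rw [← h1, coordVariation, g.inChart_chartDiff h3, h2 s hs]
  have h3 := h1.unique ((hasDerivAt_const (0 : ℝ) (0 : ℝ)).congr_of_eventuallyEq h2)
  rw [← h.cov_variationField hs, ← hvel.self_of_nhds] at h3
  have h4 := g.inChart_chartDiff hsrc (g.cov (fun τ ↦ f (0, τ)) (variationField n f) s)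
    (vel n (fun τ ↦ f (0, τ)) s)
  rw [chartDiff_self] at h4
  rw [← h4]
  exact (mul_eq_zero.1 h3).resolve_left two_ne_zero

/-- The derivative of the variation field where the variation fixes a point. -/
theorem cov_variationField_of_const (h : IsNullGeodesicVariation g f ℓ) (hs : s ∈ Icc 0 ℓ)
    (hc : ∀ᶠ ε in 𝓝 (0 : ℝ), f (ε, s) = f (0, s)) {w : ModelSpace n}
    (hw : HasDerivAt (fun ε ↦ vel n (fun τ ↦ f (ε, τ)) s) w 0) :
    g.cov (fun τ ↦ f (0, τ)) (variationField n f) s = w := by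
  have hsm := h.smooth_zero hs
  have hsrc := mem_extChartAt_source (I := 𝓡 (n + 1)) (f (0, s))
  have hC := contDiffAt_coordVariation hsrc hsm
  have hvel := chartDiff_vel_variation hsrc hsm (h.smooth.mono fun ε hε ↦ hε s hs)
  -- The variation field vanishes at `s`, so the Christoffel term drops out and only the mixed
  -- derivative of the variation remains.
  have h0 : fderiv ℝ (coordVariation n (f (0, s)) f) (0, s) (1, 0) = 0 := by
    refine (eventually_deriv_fst hC).self_of_nhds.symm.trans
      ((coordField_variationField_eventuallyEq hsrc hsm).self_of_nhds.symm.trans ?_)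
    rw [coordField, variationField_eq_zero hc, map_zero]
  rw [h.cov_variationField hs, (eventually_chartCov_variation hC).self_of_nhds, h0, map_zero,
    add_zero]
  have h1 := ((hC.fderiv_apply_const (0, 1)).differentiableAt (by simp)).hasDerivAt_fst
  refine h1.unique (hw.congr_of_eventuallyEq ?_)
  filter_upwards [hvel, hc, (eventually_deriv_snd hC).fst_slice] with ε e1 e2 e3
  -- The base point does not move, and the chart centred there has identity differential, so
  -- coordinate velocities are the velocities themselves.
  rw [← e3, ← e1, e2, chartDiff_self]

end IsNullGeodesicVariation

end GeodesicVariation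

/-! ### The geodesics of the family and their variation fields. -/

section Geodesic

open Filter Topology

set_option maxSynthPendingDepth 3

variable {n : ℕ} {M : Type*} [TopologicalSpace M]
  [ChartedSpace (EuclideanSpace ℝ (Fin (n + 1))) M]

theorem mfderiv_comp_fderiv_apply {P Q : Type*} [NormedAddCommGroup P] [NormedSpace ℝ P]
    [NormedAddCommGroup Q] [NormedSpace ℝ Q] {f : Q → M} {u : P → Q} {u' : P →L[ℝ] Q} {x : P}
    {y : Q} (hu : HasFDerivAt u u' x) (hy : u x = y)
    (hf : MDifferentiableAt 𝓘(ℝ, Q) (𝓡 (n + 1)) f y) (w : P) :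
    (mfderiv 𝓘(ℝ, P) (𝓡 (n + 1)) (fun p ↦ f (u p)) x w : ModelSpace n) =
      (mfderiv 𝓘(ℝ, Q) (𝓡 (n + 1)) f y (u' w) : ModelSpace n) := by
  subst hy
  have h := mfderiv_comp x hf hu.differentiableAt.mdifferentiableAt
  rw [mfderiv_eq_fderiv, hu.fderiv] at h
  exact DFunLike.congr_fun h w

variable [IsManifold (𝓡 (n + 1)) ∞ M]

namespace LorentzianMetric

variable (g : LorentzianMetric n M)

theorem exists_basis (x : M) : ∃ b : Module.Basis (Fin (n + 1)) ℝ (ModelSpace n),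
    ∀ w, g.form x w w = ∑ i, (if i = 0 then -1 else 1) * b.repr w i ^ 2 := by
  obtain ⟨b, hb⟩ := g.signature x
  let b' : Module.Basis (Fin (n + 1)) ℝ (ModelSpace n) := b
  have hb' : ∀ i j, g.form x (b' i) (b' j) = if i = j then (if i = 0 then -1 else 1) else 0 := hb
  refine ⟨b', fun w ↦ ?_⟩
  conv_lhs => rw [← b'.sum_repr w]
  simp only [map_sum, map_smul, _root_.sum_apply, _root_.smul_apply, hb', smul_eq_mul, mul_ite,
    mul_zero, Finset.sum_ite_eq', Finset.mem_univ, if_true]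
  refine Finset.sum_congr rfl fun i _ ↦ ?_
  split_ifs <;> ring

/-- A vector orthogonal to a nonzero lightlike vector is spacelike or proportional to it. -/
theorem nonneg_of_ortho_null {x : M} {u v : ModelSpace n} (hv : v ≠ 0) (hvv : g.form x v v = 0)
    (huv : g.form x u v = 0) : 0 ≤ g.form x u u ∧ (g.form x u u = 0 → ∃ c : ℝ, u = c • v) := by
  obtain ⟨b, hb⟩ := g.exists_basis x
  -- The metric is positive definite on vectors without time component. Subtracting a multiple of
  -- `v` removes the time component of `u` without changing `(u, u)`, since `v` is null and
  -- orthogonal to `u`.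
  have key : ∀ w, b.repr w 0 = 0 → 0 ≤ g.form x w w ∧ (g.form x w w = 0 → w = 0) := by
    intro w hw
    have hnn : ∀ i ∈ Finset.univ, 0 ≤ (if i = 0 then (-1 : ℝ) else 1) * b.repr w i ^ 2 := by
      intro i _
      split_ifs with hi
      · simp [hi, hw]
      · positivity
    rw [hb]
    refine ⟨Finset.sum_nonneg hnn, fun h ↦ b.repr.injective (Finsupp.ext fun i ↦ ?_)⟩
    have h1 := (Finset.sum_eq_zero_iff_of_nonneg hnn).1 h i (Finset.mem_univ i)
    by_cases hi : i = 0
    · simp [hi, hw]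
    · simpa [hi] using h1
  have hv0 : b.repr v 0 ≠ 0 := fun h ↦ hv ((key v h).2 hvv)
  have hw := key (u - (b.repr u 0 / b.repr v 0) • v) (by simp [div_mul_cancel₀ _ hv0])
  have he : g.form x (u - (b.repr u 0 / b.repr v 0) • v) (u - (b.repr u 0 / b.repr v 0) • v) =
      g.form x u u := by
    simp [hvv, huv, g.form_symm x v u]
  rw [he] at hw
  exact ⟨hw.1, fun h ↦ ⟨_, sub_eq_zero.1 (hw.2 h)⟩⟩

variable {g}

theorem smoothFieldAt_congr {γ : ℝ → M} {V W : ℝ → ModelSpace n} {s : ℝ} (h : V =ᶠ[𝓝 s] W)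
    (hV : SmoothFieldAt γ V s) : SmoothFieldAt γ W s := by
  refine ContMDiffAt.congr_of_eventuallyEq hV (h.mono fun τ hτ ↦ ?_)
  simp only [hτ]

theorem cov_congr {γ : ℝ → M} {V W : ℝ → ModelSpace n} {s : ℝ} (h : V =ᶠ[𝓝 s] W)
    (hγ : MDifferentiableAt 𝓘(ℝ, ℝ) (𝓡 (n + 1)) γ s) : g.cov γ V s = g.cov γ W s := by
  rw [g.cov_eq_chartCov hγ, g.cov_eq_chartCov hγ]
  refine chartCov_congr (h.mono fun τ hτ ↦ ?_)
  simp only [coordField, hτ]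

theorem cov_eventuallyEq {γ : ℝ → M} {V W : ℝ → ModelSpace n} {s : ℝ} (h : V =ᶠ[𝓝 s] W)
    (hγ : ContMDiffAt 𝓘(ℝ, ℝ) (𝓡 (n + 1)) ∞ γ s) : g.cov γ V =ᶠ[𝓝 s] g.cov γ W := by
  filter_upwards [h.eventuallyEq_nhds, hγ.eventually_mdifferentiableAt_curve] with τ h1 h2
    using cov_congr h1 h2

variable (g) in
/-- The calculus of vector fields along a nonconstant lightlike geodesic. -/
def calculus (γ : ℝ → M) (ℓ : ℝ) (hℓ : 0 < ℓ)
    (hγ : ∀ s ∈ Icc 0 ℓ, ContMDiffAt 𝓘(ℝ, ℝ) (𝓡 (n + 1)) ∞ γ s)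
    (hgeo : ∀ s ∈ Icc 0 ℓ, g.cov γ (vel n γ) s = 0)
    (hnull : ∀ s ∈ Icc 0 ℓ, g.form (γ s) (vel n γ s) (vel n γ s) = 0)
    (hne : ∀ s ∈ Icc 0 ℓ, vel n γ s ≠ 0) : NullGeodesicCalculus (ModelSpace n) where
  ℓ := ℓ
  ℓ_pos := hℓ
  metric s := g.form (γ s)
  fields :=
    { carrier := {V | ∀ s ∈ Icc 0 ℓ, SmoothFieldAt γ V s}
      add_mem' := fun hV hW s hs ↦ smoothFieldAt_add (hV s hs) (hW s hs)
      zero_mem' := fun s hs ↦ by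
        -- A smooth field includes smoothness of its base curve, so the zero field is obtained as `0
        -- • γ̇`.
        convert smoothFieldAt_smul (f := fun _ ↦ (0 : ℝ)) contDiffAt_const
          (smoothFieldAt_vel (hγ s hs)) using 1
        ext1 τ
        simp
      smul_mem' := fun c V hV s hs ↦ smoothFieldAt_smul (f := fun _ ↦ c) contDiffAt_const (hV s hs) }
  cov := g.cov γ
  curv s u := g.curv (γ s) u (vel n γ s) (vel n γ s)
  vel := vel n γ
  metric_symm s := g.form_symm (γ s)
  nondeg s _ _ h := g.form_nondeg (γ s) h
  nonneg s hs _ h := (g.nonneg_of_ortho_null (hne s hs) (hnull s hs) h).1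
  eq_smul_vel s hs _ h := (g.nonneg_of_ortho_null (hne s hs) (hnull s hs) h).2
  cov_mem _ hV s hs := smoothFieldAt_cov (hV s hs)
  cov_add _ hV _ hW s hs := cov_add (hV s hs) (hW s hs)
  cov_smul c V hV s hs := by
    have h := LorentzianMetric.cov_smul (g := g) (hasDerivAt_const s c) (hV s hs)
    rw [zero_smul, zero_add] at h
    exact h
  cov_zero _ hV h0 s hs := cov_eq_zero hℓ hs (hV s hs) h0
  hasDerivAt_metric _ hV _ hW s hs := hasDerivAt_form (hV s hs) (hW s hs)
  curv_add s _ u v := curv_add (γ s) u v _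
  curv_smul s _ c u := curv_smul (γ s) c u _
  curv_symm s _ u v := form_curv_symm (γ s) u v _
  vel_mem s hs := smoothFieldAt_vel (hγ s hs)
  cov_vel := hgeo
  vel_ne := hne
  vel_null := hnull
  smul_vel_mem s hs := smoothFieldAt_smul (f := fun s ↦ s) contDiffAt_id
    (smoothFieldAt_vel (hγ s hs))
  cov_smul_vel s hs := by
    rw [cov_smul (f := fun s ↦ s) (hasDerivAt_id s) (smoothFieldAt_vel (hγ s hs)), hgeo s hs]
    simp

end LorentzianMetric

/-- Properties of a field along a geodesic that agrees with a variation field on `[0, ℓ]`. -/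
theorem IsNullGeodesicVariation.of_eventuallyEq {g : LorentzianMetric n M} {f : ℝ × ℝ → M} {ℓ : ℝ}
    {γ : ℝ → M} {V : ℝ → ModelSpace n} (h : IsNullGeodesicVariation g f ℓ)
    (hf : (fun τ ↦ f (0, τ)) = γ) {s : ℝ} (hs : s ∈ Icc 0 ℓ)
    (hV : variationField n f =ᶠ[𝓝 s] V) :
    SmoothFieldAt γ V s ∧ g.cov γ (g.cov γ V) s + g.curv (γ s) (V s) (vel n γ s) (vel n γ s) = 0 ∧
      g.form (γ s) (g.cov γ V s) (vel n γ s) = 0 ∧ g.cov γ (variationField n f) s = g.cov γ V s := by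
  subst hf
  have hsm := (h.smooth_zero hs).snd_slice
  have hmd := hsm.mdifferentiableAt (by simp)
  refine ⟨LorentzianMetric.smoothFieldAt_congr hV (smoothFieldAt_variationField (h.smooth_zero hs)),
    ?_, ?_, LorentzianMetric.cov_congr hV hmd⟩
  · rw [← LorentzianMetric.cov_congr (LorentzianMetric.cov_eventuallyEq hV hsm) hmd,
      ← hV.self_of_nhds]
    exact h.jacobi hs
  · rw [← LorentzianMetric.cov_congr hV hmd]
    exact h.ortho hs

namespace NullGeodesicFamily

variable {g : LorentzianMetric n M} (F : NullGeodesicFamily g)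

/-- The map `(z, a, s) ↦ γ_{z,a}(s)`. -/
def paramMap (q : EuclideanSpace ℝ (Fin n) × EuclideanSpace ℝ (Fin (n - 1)) × ℝ) : M :=
  F.γ q.1 q.2.1 q.2.2

/-- The differential of the semigeodesic coordinates at `(0, z)`. -/
def dΦ (z : EuclideanSpace ℝ (Fin n)) : ℝ × EuclideanSpace ℝ (Fin n) →L[ℝ] ModelSpace n :=
  mfderiv 𝓘(ℝ, ℝ × EuclideanSpace ℝ (Fin n)) (𝓡 (n + 1)) F.Φ ((0 : ℝ), z)

/-- The geodesics whose parameters vary along a line. -/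
def lineVariation (z : EuclideanSpace ℝ (Fin n)) (a : EuclideanSpace ℝ (Fin (n - 1)))
    (d : EuclideanSpace ℝ (Fin n) × EuclideanSpace ℝ (Fin (n - 1))) (p : ℝ × ℝ) : M :=
  F.γ (z + p.1 • d.1) (a + p.1 • d.2) p.2

variable {F} {z : EuclideanSpace ℝ (Fin n)} {a : EuclideanSpace ℝ (Fin (n - 1))}

theorem γ_zero (hz : z ∈ F.Z) (ha : a ∈ F.A) : F.γ z a 0 = F.Φ (0, z) :=
  congr_arg (fun q : TangentBundle (𝓡 (n + 1)) M ↦ q.1) (F.initial_γ z hz a ha)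

theorem vel_zero (hz : z ∈ F.Z) (ha : a ∈ F.A) :
    vel n (F.γ z a) 0 = F.dΦ z (1, F.θ (z, a)) :=
  congr_arg (fun q : TangentBundle (𝓡 (n + 1)) M ↦ (q.2 : ModelSpace n)) (F.initial_γ z hz a ha)

theorem zero_mem_domain (hz : z ∈ F.Z) : ((0 : ℝ), z) ∈ Ioo (-F.T) F.T ×ˢ F.Z :=
  ⟨⟨by simpa using F.T_pos, F.T_pos⟩, hz⟩

theorem form_dΦ_one (hz : z ∈ F.Z) :
    g.form (F.Φ (0, z)) (F.dΦ z (1, 0)) (F.dΦ z (1, 0)) = -1 :=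
  (F.semigeodesic _ (zero_mem_domain hz)).1

theorem form_dΦ_mixed (hz : z ∈ F.Z) (v : EuclideanSpace ℝ (Fin n)) :
    g.form (F.Φ (0, z)) (F.dΦ z (1, 0)) (F.dΦ z (0, v)) = 0 :=
  (F.semigeodesic _ (zero_mem_domain hz)).2.1 v

theorem form_dΦ_pos (hz : z ∈ F.Z) {v : EuclideanSpace ℝ (Fin n)} (hv : v ≠ 0) :
    0 < g.form (F.Φ (0, z)) (F.dΦ z (0, v)) (F.dΦ z (0, v)) :=
  (F.semigeodesic _ (zero_mem_domain hz)).2.2 v hv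

theorem form_dΦ_θ (hz : z ∈ F.Z) (ha : a ∈ F.A) :
    g.form (F.Φ (0, z)) (F.dΦ z (0, F.θ (z, a))) (F.dΦ z (0, F.θ (z, a))) = 1 :=
  F.unit_θ z hz a ha

theorem form_dΦ (hz : z ∈ F.Z) (t r : ℝ) (v w : EuclideanSpace ℝ (Fin n)) :
    g.form (F.Φ (0, z)) (F.dΦ z (t, v)) (F.dΦ z (r, w)) =
      -(t * r) + g.form (F.Φ (0, z)) (F.dΦ z (0, v)) (F.dΦ z (0, w)) := by
  have e (t : ℝ) (v : EuclideanSpace ℝ (Fin n)) :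
      F.dΦ z (t, v) = t • F.dΦ z (1, 0) + F.dΦ z (0, v) := by
    rw [← map_smul, ← map_add]
    simp
  rw [e t v, e r w]
  simp only [map_add, map_smul, _root_.add_apply, _root_.smul_apply, smul_eq_mul, form_dΦ_one hz,
    form_dΦ_mixed hz, g.form_symm _ (F.dΦ z (0, v)) (F.dΦ z (1, 0))]
  ring

theorem contMDiffAt_γ (hz : z ∈ F.Z) (ha : a ∈ F.A) {s : ℝ} (hs : s ∈ Icc 0 F.ℓ) :
    ContMDiffAt 𝓘(ℝ, ℝ) (𝓡 (n + 1)) ∞ (F.γ z a) s :=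
  ContMDiffAt.comp (I' := 𝓘(ℝ, EuclideanSpace ℝ (Fin n) × EuclideanSpace ℝ (Fin (n - 1)) × ℝ))
    (f := fun s : ℝ ↦ (z, a, s)) s (F.smooth_γ z hz a ha s hs)
    (contMDiffAt_iff_contDiffAt.2 (contDiffAt_const.prodMk (contDiffAt_const.prodMk contDiffAt_id)))

theorem cov_vel_γ (hz : z ∈ F.Z) (ha : a ∈ F.A) {s : ℝ} (hs : s ∈ Icc 0 F.ℓ) :
    g.cov (F.γ z a) (vel n (F.γ z a)) s = 0 := F.geodesic_γ z hz a ha s hs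

theorem zero_mem_Icc : (0 : ℝ) ∈ Icc 0 F.ℓ := ⟨le_rfl, F.ℓ_pos.le⟩

/-- The geodesics of the family are lightlike. -/
theorem vel_null (hz : z ∈ F.Z) (ha : a ∈ F.A) {s : ℝ} (hs : s ∈ Icc 0 F.ℓ) :
    g.form (F.γ z a s) (vel n (F.γ z a) s) (vel n (F.γ z a) s) = 0 := by
  have h := eq_of_hasDerivAt_zero (f := fun s ↦ g.form (F.γ z a s) (vel n (F.γ z a) s)
    (vel n (F.γ z a) s)) (fun s hs ↦ ?_) hs zero_mem_Icc
  · rw [h, γ_zero hz ha, vel_zero hz ha, form_dΦ hz, form_dΦ_θ hz ha]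
    norm_num
  · have h1 := LorentzianMetric.smoothFieldAt_vel (contMDiffAt_γ hz ha hs)
    refine (LorentzianMetric.hasDerivAt_form h1 h1).congr_deriv ?_
    rw [cov_vel_γ hz ha hs]
    simp

theorem lineVariation_zero (d : EuclideanSpace ℝ (Fin n) × EuclideanSpace ℝ (Fin (n - 1))) :
    (fun τ ↦ F.lineVariation z a d (0, τ)) = F.γ z a := by
  ext1 τ
  simp [lineVariation]

theorem eventually_mem (hz : z ∈ F.Z) (ha : a ∈ F.A)
    (d : EuclideanSpace ℝ (Fin n) × EuclideanSpace ℝ (Fin (n - 1))) :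
    ∀ᶠ ε in 𝓝 (0 : ℝ), z + ε • d.1 ∈ F.Z ∧ a + ε • d.2 ∈ F.A := by
  have h1 : ContinuousAt (fun ε : ℝ ↦ z + ε • d.1) 0 := by fun_prop
  have h2 : ContinuousAt (fun ε : ℝ ↦ a + ε • d.2) 0 := by fun_prop
  have h3 : ∀ᶠ ε in 𝓝 (0 : ℝ), z + ε • d.1 ∈ F.Z := h1 (F.isOpen_Z.mem_nhds (by simpa using hz))
  have h4 : ∀ᶠ ε in 𝓝 (0 : ℝ), a + ε • d.2 ∈ F.A := h2 (F.isOpen_A.mem_nhds (by simpa using ha))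
  exact h3.and h4

theorem isNullGeodesicVariation_line (hz : z ∈ F.Z) (ha : a ∈ F.A)
    (d : EuclideanSpace ℝ (Fin n) × EuclideanSpace ℝ (Fin (n - 1))) :
    IsNullGeodesicVariation g (F.lineVariation z a d) F.ℓ where
  smooth := by
    filter_upwards [eventually_mem hz ha d] with ε hε s hs
    refine ContMDiffAt.comp
      (I' := 𝓘(ℝ, EuclideanSpace ℝ (Fin n) × EuclideanSpace ℝ (Fin (n - 1)) × ℝ))
      (f := fun p : ℝ × ℝ ↦ (z + p.1 • d.1, a + p.1 • d.2, p.2)) (ε, s)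
      (F.smooth_γ _ hε.1 _ hε.2 s hs) (contMDiffAt_iff_contDiffAt.2 ?_)
    fun_prop
  geodesic := by
    filter_upwards [eventually_mem hz ha d] with ε hε s hs using cov_vel_γ hε.1 hε.2 hs
  null := by
    filter_upwards [eventually_mem hz ha d] with ε hε s hs using vel_null hε.1 hε.2 hs

theorem eventually_mdifferentiableAt_paramMap (hz : z ∈ F.Z) (ha : a ∈ F.A) {s : ℝ}
    (hs : s ∈ Icc 0 F.ℓ) : ∀ᶠ τ in 𝓝 s, MDifferentiableAt
      𝓘(ℝ, EuclideanSpace ℝ (Fin n) × EuclideanSpace ℝ (Fin (n - 1)) × ℝ) (𝓡 (n + 1))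
      F.paramMap (z, a, τ) := by
  have h : ∀ᶠ q in 𝓝 (z, a, s), MDifferentiableAt
      𝓘(ℝ, EuclideanSpace ℝ (Fin n) × EuclideanSpace ℝ (Fin (n - 1)) × ℝ) (𝓡 (n + 1))
      F.paramMap q := by
    filter_upwards [(contMDiffAt_iff_contMDiffAt_nhds (n := 1) (by simp)).1
      ((F.smooth_γ z hz a ha s hs).of_le (by simp))] with q hq using hq.mdifferentiableAt (by simp)
  have hc : ContinuousAt (fun τ : ℝ ↦ (z, a, τ)) s := by fun_prop
  exact hc.eventually h

section Fields

variable {τ : ℝ} (h : MDifferentiableAt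
  𝓘(ℝ, EuclideanSpace ℝ (Fin n) × EuclideanSpace ℝ (Fin (n - 1)) × ℝ) (𝓡 (n + 1))
  F.paramMap (z, a, τ))

include h

/-- Brings line variations, `M_j` and `J_k` back to the differential of the single map `(z, a, s) ↦
γ_{z,a}(s)`. That map is differentiable only near `[0, ℓ]`, so the fields are compared as germs
there. -/
theorem variationField_line (d : EuclideanSpace ℝ (Fin n) × EuclideanSpace ℝ (Fin (n - 1))) :
    variationField n (F.lineVariation z a d) τ =
      (mfderiv 𝓘(ℝ, EuclideanSpace ℝ (Fin n) × EuclideanSpace ℝ (Fin (n - 1)) × ℝ) (𝓡 (n + 1))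
        F.paramMap (z, a, τ) (d.1, d.2, 0) : ModelSpace n) := by
  have hu : HasFDerivAt (fun ε : ℝ ↦ (z + ε • d.1, a + ε • d.2, τ))
      (ContinuousLinearMap.toSpanSingleton ℝ (d.1, d.2, (0 : ℝ))) 0 := by
    have h1 : HasDerivAt (fun ε : ℝ ↦ z + ε • d.1) d.1 0 := by
      simpa using ((hasDerivAt_id (0 : ℝ)).smul_const d.1).const_add z
    have h2 : HasDerivAt (fun ε : ℝ ↦ a + ε • d.2) d.2 0 := by
      simpa using ((hasDerivAt_id (0 : ℝ)).smul_const d.2).const_add a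
    exact (h1.prodMk (h2.prodMk (hasDerivAt_const (0 : ℝ) τ))).hasFDerivAt
  have := mfderiv_comp_fderiv_apply hu (by simp) h (1 : ℝ)
  rw [ContinuousLinearMap.toSpanSingleton_apply, one_smul] at this
  exact this

theorem fieldM_eq (j : Fin n) : (F.fieldM z a j τ : ModelSpace n) =
    variationField n (F.lineVariation z a (EuclideanSpace.single j 1, 0)) τ := by
  have hu : HasFDerivAt (fun z' : EuclideanSpace ℝ (Fin n) ↦ (z', a, τ))
      ((ContinuousLinearMap.id ℝ _).prod (ContinuousLinearMap.prod 0 0)) z :=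
    (hasFDerivAt_id z).prodMk ((hasFDerivAt_const a z).prodMk (hasFDerivAt_const τ z))
  rw [variationField_line h]
  exact mfderiv_comp_fderiv_apply hu rfl h (EuclideanSpace.single j (1 : ℝ))

theorem fieldJ_eq (k : Fin (n - 1)) : (F.fieldJ z a k τ : ModelSpace n) =
    variationField n (F.lineVariation z a (0, EuclideanSpace.single k 1)) τ := by
  have hu : HasFDerivAt (fun a' : EuclideanSpace ℝ (Fin (n - 1)) ↦ (z, a', τ))
      (ContinuousLinearMap.prod 0 ((ContinuousLinearMap.id ℝ _).prod 0)) a :=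
    (hasFDerivAt_const z a).prodMk ((hasFDerivAt_id a).prodMk (hasFDerivAt_const τ a))
  rw [variationField_line h]
  exact mfderiv_comp_fderiv_apply hu rfl h (EuclideanSpace.single k (1 : ℝ))

end Fields

theorem variationField_line_zero (hz : z ∈ F.Z) (ha : a ∈ F.A)
    (d : EuclideanSpace ℝ (Fin n) × EuclideanSpace ℝ (Fin (n - 1))) :
    variationField n (F.lineVariation z a d) 0 = F.dΦ z (0, d.1) := by
  have hu : HasFDerivAt (fun ε : ℝ ↦ ((0 : ℝ), z + ε • d.1))
      (ContinuousLinearMap.toSpanSingleton ℝ ((0 : ℝ), d.1)) 0 := by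
    have h1 : HasDerivAt (fun ε : ℝ ↦ z + ε • d.1) d.1 0 := by
      simpa using ((hasDerivAt_id (0 : ℝ)).smul_const d.1).const_add z
    exact ((hasDerivAt_const (0 : ℝ) (0 : ℝ)).prodMk h1).hasFDerivAt
  have hΦ : MDifferentiableAt 𝓘(ℝ, ℝ × EuclideanSpace ℝ (Fin n)) (𝓡 (n + 1)) F.Φ ((0 : ℝ), z) :=
    (F.smooth_Φ.contMDiffAt ((isOpen_Ioo.prod F.isOpen_Z).mem_nhds
      (zero_mem_domain hz))).mdifferentiableAt (by simp)
  have h1 := mfderiv_comp_fderiv_apply hu (by simp) hΦ (1 : ℝ)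
  rw [ContinuousLinearMap.toSpanSingleton_apply, one_smul] at h1
  have he : (fun ε ↦ F.lineVariation z a d (ε, 0)) =ᶠ[𝓝 0] fun ε ↦ F.Φ (0, z + ε • d.1) := by
    filter_upwards [eventually_mem hz ha d] with ε hε using γ_zero hε.1 hε.2
  have h2 := DFunLike.congr_fun (he.mfderiv_eq (I := 𝓘(ℝ, ℝ)) (I' := 𝓡 (n + 1))) (1 : ℝ)
  exact Eq.trans h2 h1

theorem hasFDerivAt_θ (hz : z ∈ F.Z) (ha : a ∈ F.A) :
    HasFDerivAt (fun a' ↦ F.θ (z, a')) (fderiv ℝ (fun a' ↦ F.θ (z, a')) a) a := by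
  have h1 : ContDiffAt ℝ ∞ F.θ (z, a) :=
    F.smooth_θ.contDiffAt ((F.isOpen_Z.prod F.isOpen_A).mem_nhds ⟨hz, ha⟩)
  exact (DifferentiableAt.comp (f := fun a' ↦ (z, a')) (g := F.θ) a
    (h1.differentiableAt (by simp)) (by fun_prop)).hasFDerivAt

/-- Varying `a` fixes the initial point `Φ(0, z)`, so the covariant derivative at `0` is the plain
derivative of the initial velocity `dΦ(1, θ(z, a))`. -/
theorem cov_variationField_line_zero (hz : z ∈ F.Z) (ha : a ∈ F.A)
    (d : EuclideanSpace ℝ (Fin (n - 1))) :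
    g.cov (F.γ z a) (variationField n (F.lineVariation z a (0, d))) 0 =
      F.dΦ z (0, fderiv ℝ (fun a' ↦ F.θ (z, a')) a d) := by
  have h := isNullGeodesicVariation_line hz ha (0, d)
  have hmem := eventually_mem hz ha (0, d)
  rw [← lineVariation_zero (0, d)]
  refine h.cov_variationField_of_const zero_mem_Icc ?_ ?_
  · filter_upwards [hmem] with ε hε
    simp only [lineVariation, smul_zero, add_zero, zero_smul]
    rw [γ_zero hz hε.2, γ_zero hz ha]
  · have hl : HasDerivAt (fun ε : ℝ ↦ a + ε • d) d 0 := by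
      simpa using ((hasDerivAt_id (0 : ℝ)).smul_const d).const_add a
    have hd := ((F.dΦ z).hasFDerivAt).comp_hasDerivAt (0 : ℝ)
      ((hasDerivAt_const (0 : ℝ) (1 : ℝ)).prodMk
        ((hasFDerivAt_θ hz ha).comp_hasDerivAt_of_eq (0 : ℝ) hl (by simp)))
    refine hd.congr_of_eventuallyEq ?_
    filter_upwards [hmem] with ε hε
    have := vel_zero (F := F) (z := z) hz hε.2
    simpa [lineVariation] using this

/-- The geodesics of the family have nonzero velocity. -/
theorem vel_ne_zero (hz : z ∈ F.Z) (ha : a ∈ F.A) {s : ℝ} (hs : s ∈ Icc 0 F.ℓ) :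
    vel n (F.γ z a) s ≠ 0 := by
  -- For the variation of `z` in the direction `θ`, the product `(V, γ̇)` is constant since `V' ⊥
  -- γ̇` and `γ̇' = 0`. Its value at `0` is `(θ, θ)_h = 1`, so `γ̇` never vanishes.
  set V := variationField n (F.lineVariation z a (F.θ (z, a), 0)) with hV
  have hvar := isNullGeodesicVariation_line hz ha (F.θ (z, a), 0)
  have h := eq_of_hasDerivAt_zero (f := fun s ↦ g.form (F.γ z a s) (V s) (vel n (F.γ z a) s))
    (fun s hs ↦ ?_) hs zero_mem_Icc
  · intro h0
    rw [h0, γ_zero hz ha, vel_zero hz ha, hV, variationField_line_zero hz ha, form_dΦ hz,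
      form_dΦ_θ hz ha] at h
    simp at h
  · obtain ⟨h1, -, h2, -⟩ := hvar.of_eventuallyEq (lineVariation_zero _) hs
      (Filter.EventuallyEq.refl _ V)
    refine (LorentzianMetric.hasDerivAt_form h1
      (LorentzianMetric.smoothFieldAt_vel (contMDiffAt_γ hz ha hs))).congr_deriv ?_
    rw [h2, cov_vel_γ hz ha hs, map_zero, add_zero]

end NullGeodesicFamily

end Geodesic

/-! ### The generators of `𝒥` form a frame of Jacobi fields. -/

section Frame

open Filter Topology

set_option maxSynthPendingDepth 3

theorem EuclideanSpace.mem_of_single_mem {m : ℕ} (P : Submodule ℝ (EuclideanSpace ℝ (Fin m)))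
    (h : ∀ i, EuclideanSpace.single i (1 : ℝ) ∈ P) (y : EuclideanSpace ℝ (Fin m)) : y ∈ P := by
  have h1 := (EuclideanSpace.basisFun (Fin m) ℝ).toBasis.span_eq
  have h2 : Submodule.span ℝ (range (EuclideanSpace.basisFun (Fin m) ℝ).toBasis) ≤ P := by
    rw [Submodule.span_le]
    rintro _ ⟨i, rfl⟩
    simpa using h i
  exact h2 (h1 ▸ Submodule.mem_top)

variable {n : ℕ} {M : Type*} [TopologicalSpace M]
  [ChartedSpace (EuclideanSpace ℝ (Fin (n + 1))) M] [IsManifold (𝓡 (n + 1)) ∞ M]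

namespace NullGeodesicFamily

variable {g : LorentzianMetric n M} {F : NullGeodesicFamily g}
  {z : EuclideanSpace ℝ (Fin n)} {a : EuclideanSpace ℝ (Fin (n - 1))}

/-- The form `-dt² + h` is nondegenerate, so `dΦ` has no kernel, and the dimensions agree. -/
theorem dΦ_surjective (hz : z ∈ F.Z) : Function.Surjective (F.dΦ z) := by
  have hinj : Function.Injective (F.dΦ z) := by
    rw [injective_iff_map_eq_zero]
    rintro ⟨t, v⟩ h
    have h1 := form_dΦ hz t t v v
    have h2 := form_dΦ hz t 1 v 0
    have e : ((0 : ℝ), (0 : EuclideanSpace ℝ (Fin n))) = 0 := rfl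
    rw [h] at h1 h2
    simp only [map_zero, _root_.zero_apply, e] at h1 h2
    have ht : t = 0 := by linarith
    by_contra hne
    have hv : v ≠ 0 := fun hv ↦ hne (by rw [ht, hv]; rfl)
    have := form_dΦ_pos hz hv
    rw [ht] at h1
    linarith
  have hd : Module.finrank ℝ (ℝ × EuclideanSpace ℝ (Fin n)) =
      Module.finrank ℝ (ModelSpace n) := by
    simp [add_comm]
  exact (LinearMap.injective_iff_surjective_of_finrank_eq_finrank
    (f := (F.dΦ z : _ →ₗ[ℝ] ModelSpace n)) hd).1 hinj

/-- The tangent space of the unit sphere at `θ(z, a)` is the orthogonal complement of `θ(z, a)`. -/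
theorem exists_fderiv_θ_eq (hn : 1 ≤ n) (hz : z ∈ F.Z) (ha : a ∈ F.A) {y : EuclideanSpace ℝ (Fin n)}
    (hy : g.form (F.Φ (0, z)) (F.dΦ z (0, y)) (F.dΦ z (0, F.θ (z, a))) = 0) :
    ∃ q, fderiv ℝ (fun a' ↦ F.θ (z, a')) a q = y := by
  let ι : EuclideanSpace ℝ (Fin n) →L[ℝ] ModelSpace n :=
    F.dΦ z ∘L ContinuousLinearMap.inr ℝ ℝ (EuclideanSpace ℝ (Fin n))
  have hι (y) : ι y = F.dΦ z (0, y) := rfl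
  let h : EuclideanSpace ℝ (Fin n) →ₗ[ℝ] ℝ :=
    ((g.form (F.Φ (0, z))).flip (ι (F.θ (z, a))) ∘L ι : _ →L[ℝ] ℝ)
  have hh (y) : h y = g.form (F.Φ (0, z)) (F.dΦ z (0, y)) (F.dΦ z (0, F.θ (z, a))) := rfl
  have hne : h ≠ 0 := fun h0 ↦ by
    have h1 : h (F.θ (z, a)) = 1 := form_dΦ_θ hz ha
    simp [h0] at h1
  have hker := Module.Dual.finrank_ker_add_one_of_ne_zero hne
  have hle : LinearMap.range (fderiv ℝ (fun a' ↦ F.θ (z, a')) a :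
    EuclideanSpace ℝ (Fin (n - 1)) →ₗ[ℝ] EuclideanSpace ℝ (Fin n)) ≤ LinearMap.ker h := by
    rintro _ ⟨q, rfl⟩
    have hd := ι.hasFDerivAt.comp a (hasFDerivAt_θ hz ha)
    have hd2 := ((g.form (F.Φ (0, z))).hasFDerivAt.comp a hd).clm_apply hd
    -- Differentiating `(θ, θ)_h = 1` in `a` puts the range of `∂_a θ` into `θ^⊥`. Both have
    -- dimension `n - 1`, as `∂_a θ` is injective.
    have hc : (fun a' ↦ g.form (F.Φ (0, z)) (ι (F.θ (z, a'))) (ι (F.θ (z, a')))) =ᶠ[𝓝 a]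
        fun _ ↦ (1 : ℝ) := by
      filter_upwards [F.isOpen_A.mem_nhds ha] with a' ha' using form_dΦ_θ hz ha'
    have h0 := DFunLike.congr_fun
      (hd2.unique ((hasFDerivAt_const (1 : ℝ) a).congr_of_eventuallyEq hc)) q
    simp only [Function.comp_def, _root_.add_apply, ContinuousLinearMap.comp_apply,
      ContinuousLinearMap.flip_apply, _root_.zero_apply] at h0
    rw [g.form_symm _ (ι (F.θ (z, a))), ← two_mul] at h0
    exact LinearMap.mem_ker.2 ((mul_eq_zero.1 h0).resolve_left two_ne_zero)
  have hrange : LinearMap.range (fderiv ℝ (fun a' ↦ F.θ (z, a')) a :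
    EuclideanSpace ℝ (Fin (n - 1)) →ₗ[ℝ] EuclideanSpace ℝ (Fin n)) =
      LinearMap.ker h := by
    refine Submodule.eq_of_le_of_finrank_eq hle ?_
    rw [LinearMap.finrank_range_of_inj (F.immersion_θ z hz a ha)]
    simp only [finrank_euclideanSpace, Fintype.card_fin] at hker ⊢
    omega
  have hy' : y ∈ LinearMap.ker h := hy
  rw [← hrange] at hy'
  exact hy'

variable (F) in
/-- The calculus along the geodesic `γ_{z,a}`. -/
def calculus (hz : z ∈ F.Z) (ha : a ∈ F.A) : NullGeodesicCalculus (ModelSpace n) :=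
  g.calculus (F.γ z a) F.ℓ F.ℓ_pos (fun _ hs ↦ contMDiffAt_γ hz ha hs)
    (fun _ hs ↦ cov_vel_γ hz ha hs) (fun _ hs ↦ vel_null hz ha hs) (fun _ hs ↦ vel_ne_zero hz ha hs)

variable (F z a) in
/-- The spanning family `M_1, …, M_n, J_1, …, J_{n-1}, γ̇, Γ`. -/
def frameField : (Fin n ⊕ Fin (n - 1)) ⊕ Fin 2 → ℝ → ModelSpace n :=
  Sum.elim (Sum.elim (fun j ↦ F.fieldM z a j) (fun k ↦ F.fieldJ z a k))
    ![vel n (F.γ z a), fun s ↦ s • vel n (F.γ z a) s]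

theorem range_frameField : range (F.frameField z a) =
    range (F.fieldM z a) ∪ range (F.fieldJ z a) ∪
      {velocity (F.γ z a), fun s ↦ s • velocity (F.γ z a) s} := by
  have key (f : Fin n → ℝ → ModelSpace n) (h : Fin (n - 1) → ℝ → ModelSpace n)
      (v w : ℝ → ModelSpace n) :
      range (Sum.elim (Sum.elim f h) ![v, w]) = range f ∪ range h ∪ {v, w} := by
    rw [Set.Sum.elim_range, Set.Sum.elim_range, Matrix.range_cons, Matrix.range_cons,
      Matrix.range_empty, union_empty]
    rfl
  exact key _ _ _ _

theorem mem_spaceJ_iff {J : ℝ → ModelSpace n} :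
    J ∈ F.spaceJ z a ↔ J ∈ Submodule.span ℝ (range (F.frameField z a)) := by
  rw [range_frameField]
  rfl

theorem variationField_eventuallyEq_fieldM (hz : z ∈ F.Z) (ha : a ∈ F.A) {s : ℝ}
    (hs : s ∈ Icc 0 F.ℓ) (j : Fin n) :
    variationField n (F.lineVariation z a (EuclideanSpace.single j 1, 0)) =ᶠ[𝓝 s]
      F.frameField z a (Sum.inl (Sum.inl j)) := by
  filter_upwards [eventually_mdifferentiableAt_paramMap hz ha hs] with τ hτ
    using (fieldM_eq hτ j).symm

theorem variationField_eventuallyEq_fieldJ (hz : z ∈ F.Z) (ha : a ∈ F.A) {s : ℝ}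
    (hs : s ∈ Icc 0 F.ℓ) (k : Fin (n - 1)) :
    variationField n (F.lineVariation z a (0, EuclideanSpace.single k 1)) =ᶠ[𝓝 s]
      F.frameField z a (Sum.inl (Sum.inr k)) := by
  filter_upwards [eventually_mdifferentiableAt_paramMap hz ha hs] with τ hτ
    using (fieldJ_eq hτ k).symm

theorem isJacobi_frameField (hz : z ∈ F.Z) (ha : a ∈ F.A) (i : (Fin n ⊕ Fin (n - 1)) ⊕ Fin 2) :
    (F.calculus hz ha).IsJacobi (F.frameField z a i) := by
  have hcurv : ∀ s, g.curv (F.γ z a s) (vel n (F.γ z a) s) (vel n (F.γ z a) s)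
      (vel n (F.γ z a) s) = 0 := fun s ↦ by
    rw [LorentzianMetric.curv_eq, chartCurvature]
    abel
  have hz0 : ∀ s ∈ Icc 0 F.ℓ, g.cov (F.γ z a) (g.cov (F.γ z a) (vel n (F.γ z a))) s = 0 :=
    (F.calculus hz ha).cov_zero _
      ((F.calculus hz ha).cov_mem _ (F.calculus hz ha).vel_mem) (F.calculus hz ha).cov_vel
  rcases i with (j | k) | i
  · have h (s) (hs : s ∈ Icc 0 F.ℓ) := (isNullGeodesicVariation_line hz ha
      (EuclideanSpace.single j 1, 0)).of_eventuallyEq (lineVariation_zero _) hs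
      (variationField_eventuallyEq_fieldM hz ha hs j)
    exact ⟨fun s hs ↦ (h s hs).1, fun s hs ↦ (h s hs).2.1⟩
  · have h (s) (hs : s ∈ Icc 0 F.ℓ) := (isNullGeodesicVariation_line hz ha
      (0, EuclideanSpace.single k 1)).of_eventuallyEq (lineVariation_zero _) hs
      (variationField_eventuallyEq_fieldJ hz ha hs k)
    exact ⟨fun s hs ↦ (h s hs).1, fun s hs ↦ (h s hs).2.1⟩
  · fin_cases i
    · refine ⟨(F.calculus hz ha).vel_mem, fun s hs ↦ ?_⟩
      exact (congr_arg₂ _ (hz0 s hs) (hcurv s)).trans (add_zero _)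
    · refine ⟨(F.calculus hz ha).smul_vel_mem, fun s hs ↦ ?_⟩
      have h1 := NullGeodesicCalculus.cov_congr (N := F.calculus hz ha)
        ((F.calculus hz ha).cov_mem _ (F.calculus hz ha).smul_vel_mem) (F.calculus hz ha).vel_mem
        (F.calculus hz ha).cov_smul_vel hs
      have h2 : (F.calculus hz ha).curv s (s • vel n (F.γ z a) s) = 0 := by
        rw [(F.calculus hz ha).curv_smul s hs]
        exact (congr_arg (s • ·) (hcurv s)).trans (smul_zero s)
      exact (congr_arg₂ _ (h1.trans ((F.calculus hz ha).cov_vel s hs)) h2).trans (add_zero _)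

theorem ortho_frameField (hz : z ∈ F.Z) (ha : a ∈ F.A) (i : (Fin n ⊕ Fin (n - 1)) ⊕ Fin 2) {s : ℝ}
    (hs : s ∈ Icc 0 F.ℓ) :
    g.form (F.γ z a s) (g.cov (F.γ z a) (F.frameField z a i) s) (vel n (F.γ z a) s) = 0 := by
  rcases i with (j | k) | i
  · exact ((isNullGeodesicVariation_line hz ha
      (EuclideanSpace.single j 1, 0)).of_eventuallyEq (lineVariation_zero _) hs
      (variationField_eventuallyEq_fieldM hz ha hs j)).2.2.1
  · exact ((isNullGeodesicVariation_line hz ha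
      (0, EuclideanSpace.single k 1)).of_eventuallyEq (lineVariation_zero _) hs
      (variationField_eventuallyEq_fieldJ hz ha hs k)).2.2.1
  · fin_cases i
    · have h : g.cov (F.γ z a) (vel n (F.γ z a)) s = 0 := cov_vel_γ hz ha hs
      change g.form _ (g.cov (F.γ z a) (vel n (F.γ z a)) s) _ = 0
      rw [h, map_zero, _root_.zero_apply]
    · have h : g.cov (F.γ z a) (fun s ↦ s • vel n (F.γ z a) s) s = vel n (F.γ z a) s :=
        (F.calculus hz ha).cov_smul_vel s hs
      change g.form _ (g.cov (F.γ z a) (fun s ↦ s • vel n (F.γ z a) s) s) _ = 0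
      rw [h, vel_null hz ha hs]

/-- The fields `γ̇` and `M_j` produce every value `u` with some derivative `w₁`. The fields `Γ` and
`J_k`, which vanish at `0`, then correct `w₁` by any vector of `γ̇(0)^⊥`. The derivatives `M_j'(0)`
are never computed; only their orthogonality to `γ̇` is used. -/
theorem initial_frameField (hn : 1 ≤ n) (hz : z ∈ F.Z) (ha : a ∈ F.A) (u w : ModelSpace n)
    (hw : g.form (F.γ z a 0) w (vel n (F.γ z a) 0) = 0) :
    ∃ J ∈ Submodule.span ℝ (range (F.frameField z a)), J 0 = u ∧ g.cov (F.γ z a) J 0 = w := by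
  have h0 : (0 : ℝ) ∈ Icc 0 (F.calculus hz ha).ℓ := zero_mem_Icc
  let S := NullGeodesicCalculus.spanData (isJacobi_frameField hz ha) h0
  have hS := NullGeodesicCalculus.mk_mem_spanData (isJacobi_frameField hz ha) h0
  have hT := vel_zero hz ha
  have hvel : (F.dΦ z (1, F.θ (z, a)), 0) ∈ S := by
    have := hS (Sum.inr 0)
    rwa [show (F.calculus hz ha).cov (F.frameField z a (Sum.inr 0)) 0 = 0 from
      cov_vel_γ hz ha zero_mem_Icc, show F.frameField z a (Sum.inr 0) 0 = _ from hT] at this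
  have hΓ : (0, F.dΦ z (1, F.θ (z, a))) ∈ S := by
    have := hS (Sum.inr 1)
    rwa [show (F.calculus hz ha).cov (F.frameField z a (Sum.inr 1)) 0 = _ from
      ((F.calculus hz ha).cov_smul_vel 0 h0).trans hT,
      show F.frameField z a (Sum.inr 1) 0 = 0 from zero_smul ℝ _] at this
  have hM (y : EuclideanSpace ℝ (Fin n)) : ∃ w', (F.dΦ z (0, y), w') ∈ S := by
    have := EuclideanSpace.mem_of_single_mem ((S.map (LinearMap.fst ℝ _ _)).comap
      ((F.dΦ z : _ →ₗ[ℝ] ModelSpace n) ∘ₗ LinearMap.inr ℝ ℝ (EuclideanSpace ℝ (Fin n)))) (fun j ↦ by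
        refine ⟨_, hS (Sum.inl (Sum.inl j)), ?_⟩
        exact (variationField_eventuallyEq_fieldM hz ha zero_mem_Icc j).self_of_nhds.symm.trans
          (variationField_line_zero hz ha _)) y
    obtain ⟨x, hx, hx'⟩ := this
    exact ⟨x.2, by rwa [← show x.1 = F.dΦ z (0, y) from hx']⟩
  have hJ (q : EuclideanSpace ℝ (Fin (n - 1))) :
      (0, F.dΦ z (0, fderiv ℝ (fun a' ↦ F.θ (z, a')) a q)) ∈ S := by
    refine EuclideanSpace.mem_of_single_mem (S.comap (LinearMap.inr ℝ _ _ ∘ₗ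
      (F.dΦ z : _ →ₗ[ℝ] ModelSpace n) ∘ₗ LinearMap.inr ℝ ℝ (EuclideanSpace ℝ (Fin n)) ∘ₗ
      (fderiv ℝ (fun a' ↦ F.θ (z, a')) a :
    EuclideanSpace ℝ (Fin (n - 1)) →ₗ[ℝ] EuclideanSpace ℝ (Fin n)))) (fun k ↦ ?_) q
    have he := variationField_eventuallyEq_fieldJ hz ha zero_mem_Icc k
    have h1 : F.frameField z a (Sum.inl (Sum.inr k)) 0 = 0 := by
      rw [← he.self_of_nhds, variationField_line_zero hz ha]
      exact map_zero _
    have h2 : (F.calculus hz ha).cov (F.frameField z a (Sum.inl (Sum.inr k))) 0 =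
        F.dΦ z (0, fderiv ℝ (fun a' ↦ F.θ (z, a')) a (EuclideanSpace.single k 1)) := by
      rw [← cov_variationField_line_zero hz ha]
      exact (LorentzianMetric.cov_congr he
        ((contMDiffAt_γ hz ha zero_mem_Icc).mdifferentiableAt (by simp))).symm
    have h3 := hS (Sum.inl (Sum.inr k))
    rw [h1, h2] at h3
    exact h3
  -- Splits off a multiple of `γ̇(0)` and leaves a vector tangent to `{t = 0}`. For a vector
  -- orthogonal to the null vector `γ̇(0)` this remainder is orthogonal to `θ`, hence in the range
  -- of `∂_a θ`.
  have hsplit (t : ℝ) (y : EuclideanSpace ℝ (Fin n)) : F.dΦ z (t, y) =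
      t • F.dΦ z (1, F.θ (z, a)) + F.dΦ z (0, y - t • F.θ (z, a)) := by
    rw [← map_smul, ← map_add]
    simp
  obtain ⟨w₁, hw₁⟩ : ∃ w₁, (u, w₁) ∈ S := by
    obtain ⟨⟨t, y⟩, rfl⟩ := dΦ_surjective hz u
    obtain ⟨w', hw'⟩ := hM (y - t • F.θ (z, a))
    refine ⟨w', ?_⟩
    have := S.add_mem (S.smul_mem t hvel) hw'
    rwa [Prod.smul_mk, Prod.mk_add_mk, ← hsplit, smul_zero, zero_add] at this
  have hw₂ : (0, w - w₁) ∈ S := by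
    have ho : g.form (F.γ z a 0) (w - w₁) (vel n (F.γ z a) 0) = 0 := by
      obtain ⟨J, hJ, -, h2⟩ := hw₁
      have h3 : g.form (F.γ z a 0) w₁ (vel n (F.γ z a) 0) = 0 := by
        have := NullGeodesicCalculus.ortho_of_mem_span (isJacobi_frameField hz ha)
          (fun i ↦ ortho_frameField hz ha i zero_mem_Icc) h0 hJ
        rwa [h2] at this
      rw [map_sub, _root_.sub_apply, hw, h3, sub_zero]
    obtain ⟨⟨t, y⟩, hty⟩ := dΦ_surjective hz (w - w₁)
    rw [← hty, hT, γ_zero hz ha, hsplit, map_add, _root_.add_apply, map_smul, _root_.smul_apply,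
      form_dΦ hz, form_dΦ_θ hz ha, form_dΦ hz 0 1] at ho
    obtain ⟨q, hq⟩ := exists_fderiv_θ_eq hn hz ha (y := y - t • F.θ (z, a)) (by simpa using ho)
    have := S.add_mem (S.smul_mem t hΓ) (hJ q)
    rwa [hq, Prod.smul_mk, Prod.mk_add_mk, ← hsplit, smul_zero, zero_add, hty] at this
  have := S.add_mem hw₁ hw₂
  rw [Prod.mk_add_mk, add_zero, add_sub_cancel] at this
  exact this

variable (F) in
/-- The fields `M_1, …, M_n, J_1, …, J_{n-1}, γ̇, Γ` form a frame of Jacobi fields. -/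
def frame (hn : 1 ≤ n) (hz : z ∈ F.Z) (ha : a ∈ F.A) :
    (F.calculus hz ha).JacobiFrame ((Fin n ⊕ Fin (n - 1)) ⊕ Fin 2) where
  K := F.frameField z a
  isJacobi := isJacobi_frameField hz ha
  ortho i _ hs := ortho_frameField hz ha i hs
  vel_mem := Submodule.subset_span ⟨Sum.inr 0, rfl⟩
  smul_vel_mem := Submodule.subset_span ⟨Sum.inr 1, rfl⟩
  card := by
    simp only [Fintype.card_sum, Fintype.card_fin, finrank_euclideanSpace]
    omega
  initial := initial_frameField hn hz ha

end NullGeodesicFamily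

end Frame

/-! ### Covectors solving the system, and conjugate points. -/

section Covectors

set_option maxSynthPendingDepth 3

variable {n : ℕ} {M : Type*} [TopologicalSpace M]
  [ChartedSpace (EuclideanSpace ℝ (Fin (n + 1))) M] [IsManifold (𝓡 (n + 1)) ∞ M]

theorem apply_eq_of_mem_span {ι E : Type*} [NormedAddCommGroup E] [NormedSpace ℝ E]
    {η₁ η₂ : E →L[ℝ] ℝ} {s₁ s₂ : ℝ} {K : ι → ℝ → E} (h : ∀ i, η₁ (K i s₁) = η₂ (K i s₂))
    {J : ℝ → E} (hJ : J ∈ Submodule.span ℝ (range K)) : η₁ (J s₁) = η₂ (J s₂) := by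
  induction hJ using Submodule.span_induction with
  | mem x hx =>
    obtain ⟨i, rfl⟩ := hx
    exact h i
  | zero => simp
  | add x y _ _ h1 h2 => rw [Pi.add_apply, Pi.add_apply, map_add, map_add, h1, h2]
  | smul c x _ h => rw [Pi.smul_apply, Pi.smul_apply, map_smul, map_smul, h]

namespace LorentzianMetric

variable (g : LorentzianMetric n M)

/-- The vector of the model space obtained by raising the index of a covector at `x`. -/
def raise (x : M) (ξ : TangentSpace (𝓡 (n + 1)) x →L[ℝ] ℝ) : ModelSpace n := g.sharp x ξ

theorem form_raise (x : M) (ξ : TangentSpace (𝓡 (n + 1)) x →L[ℝ] ℝ) (v : ModelSpace n) :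
    g.form x (g.raise x ξ) v = (ξ : ModelSpace n →L[ℝ] ℝ) v :=
  DFunLike.congr_fun ((g.form_invertible x).apply_inverse_apply (ξ : ModelSpace n →L[ℝ] ℝ)) v

theorem raise_form (x : M) (v : ModelSpace n) : g.raise x (g.form x v) = v := by
  rw [← sub_eq_zero]
  refine g.form_nondeg x fun w ↦ ?_
  rw [map_sub, _root_.sub_apply, sub_eq_zero]
  exact g.form_raise x (g.form x v) w

theorem raise_injective (x : M) : Function.Injective (g.raise x) := by
  intro ξ η h
  have (v : ModelSpace n) : (ξ : ModelSpace n →L[ℝ] ℝ) v = (η : ModelSpace n →L[ℝ] ℝ) v := by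
    rw [← form_raise, ← form_raise, h]
  exact ContinuousLinearMap.ext this

theorem isSpacelike_iff (x : M) (ξ : TangentSpace (𝓡 (n + 1)) x →L[ℝ] ℝ) :
    g.IsSpacelike x ξ ↔ 0 < g.form x (g.raise x ξ) (g.raise x ξ) := by
  rw [form_raise]
  rfl

theorem isLightlike_iff (x : M) (ξ : TangentSpace (𝓡 (n + 1)) x →L[ℝ] ℝ) :
    g.IsLightlike x ξ ↔ g.form x (g.raise x ξ) (g.raise x ξ) = 0 := by
  rw [form_raise]
  rfl

theorem isSpacelike_form_iff (x : M) (v : ModelSpace n) :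
    g.IsSpacelike x (g.form x v) ↔ 0 < g.form x v v := by
  refine (g.isSpacelike_iff x (g.form x v)).trans (iff_of_eq ?_)
  exact congrArg (fun w ↦ 0 < g.form x w w) (g.raise_form x v)

end LorentzianMetric

namespace NullGeodesicFamily

variable {g : LorentzianMetric n M} {F : NullGeodesicFamily g}
  {z : EuclideanSpace ℝ (Fin n)} {a : EuclideanSpace ℝ (Fin (n - 1))}

theorem mem_spaceJ'_iff {s₁ s₂ : Icc 0 F.ℓ} {W : Icc 0 F.ℓ → ModelSpace n} :
    W ∈ F.spaceJ' z a s₁ s₂ ↔ ∃ J ∈ Submodule.span ℝ (range (F.frameField z a)),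
      J s₁ = 0 ∧ J s₂ = 0 ∧ ∀ s : Icc 0 F.ℓ, W s = g.cov (F.γ z a) J s := by
  constructor
  · rintro ⟨J, hJ, h⟩
    exact ⟨J, mem_spaceJ_iff.1 hJ, h⟩
  · rintro ⟨J, hJ, h⟩
    exact ⟨J, mem_spaceJ_iff.2 hJ, h⟩

theorem Solves.ortho {ζ : Fin n → ℝ} {α : Fin (n - 1) → ℝ} {s : Icc 0 F.ℓ}
    {ξ : TangentSpace (𝓡 (n + 1)) (F.γ z a s) →L[ℝ] ℝ} (h : F.Solves z a ζ α s ξ) :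
    g.form (F.γ z a s) (g.raise _ ξ) (vel n (F.γ z a) s) = 0 := by
  rw [g.form_raise]
  exact h.2.2

/-- Two solutions of the same system pair in the same way with the span. -/
theorem Solves.pairing {ζ : Fin n → ℝ} {α : Fin (n - 1) → ℝ} {s₁ s₂ : Icc 0 F.ℓ}
    {ξ₁ : TangentSpace (𝓡 (n + 1)) (F.γ z a s₁) →L[ℝ] ℝ}
    {ξ₂ : TangentSpace (𝓡 (n + 1)) (F.γ z a s₂) →L[ℝ] ℝ} (h₁ : F.Solves z a ζ α s₁ ξ₁)
    (h₂ : F.Solves z a ζ α s₂ ξ₂) {J : ℝ → ModelSpace n}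
    (hJ : J ∈ Submodule.span ℝ (range (F.frameField z a))) :
    g.form (F.γ z a s₁) (g.raise _ ξ₁) (J s₁) = g.form (F.γ z a s₂) (g.raise _ ξ₂) (J s₂) := by
  refine apply_eq_of_mem_span (fun i ↦ ?_) hJ
  obtain (j | k) | i := i
  · exact (g.form_raise _ ξ₁ _).trans
      ((h₁.1 j).symm.trans ((h₂.1 j).trans (g.form_raise _ ξ₂ _).symm))
  · exact (g.form_raise _ ξ₁ _).trans
      ((h₁.2.1 k).symm.trans ((h₂.2.1 k).trans (g.form_raise _ ξ₂ _).symm))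
  -- The fields `γ̇` and `Γ` do not enter `ζ` and `α`; they pair to zero at both parameters because
  -- of the equation `⟨ξ, γ̇⟩ = 0`.
  · fin_cases i
    · exact h₁.ortho.trans h₂.ortho.symm
    · change g.form (F.γ z a s₁) (g.raise _ ξ₁) ((s₁ : ℝ) • vel n (F.γ z a) s₁) =
        g.form (F.γ z a s₂) (g.raise _ ξ₂) ((s₂ : ℝ) • vel n (F.γ z a) s₂)
      rw [map_smul, map_smul, h₁.ortho, h₂.ortho, smul_zero, smul_zero]

theorem Solves.isLightlike {ζ : Fin n → ℝ} {α : Fin (n - 1) → ℝ} {s : Icc 0 F.ℓ}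
    {ξ : TangentSpace (𝓡 (n + 1)) (F.γ z a s) →L[ℝ] ℝ} (hz : z ∈ F.Z) (ha : a ∈ F.A)
    (h : F.Solves z a ζ α s ξ) (hs : ¬ g.IsSpacelike _ ξ) : g.IsLightlike _ ξ := by
  rw [g.isLightlike_iff]
  rw [g.isSpacelike_iff, not_lt] at hs
  exact le_antisymm hs ((F.calculus hz ha).nonneg s s.2 _ h.ortho)

theorem isSpacelike_iff_of_decomposition (hn : 1 ≤ n) (hz : z ∈ F.Z) (ha : a ∈ F.A)
    {s₁ s₂ : Icc 0 F.ℓ} (hne : s₁ ≠ s₂) {W : Icc 0 F.ℓ → ModelSpace n}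
    (hW : W ∈ F.spaceJ' z a s₁ s₂) {lam : ℝ} {ξ₁ : TangentSpace (𝓡 (n + 1)) (F.γ z a s₁) →L[ℝ] ℝ}
    {ξ₂ : TangentSpace (𝓡 (n + 1)) (F.γ z a s₂) →L[ℝ] ℝ}
    (h₁ : g.raise _ ξ₁ = W s₁ + lam • vel n (F.γ z a) s₁)
    (h₂ : g.raise _ ξ₂ = W s₂ + lam • vel n (F.γ z a) s₂) :
    (g.IsSpacelike _ ξ₁ ↔ W ≠ 0) ∧ (g.IsSpacelike _ ξ₂ ↔ W ≠ 0) := by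
  have hne' : (s₁ : ℝ) ≠ s₂ := fun h ↦ hne (Subtype.ext h)
  obtain ⟨J, hJ, hJ₁, hJ₂, hW'⟩ := mem_spaceJ'_iff.1 hW
  have hW0 : W ≠ 0 ↔ ∃ s ∈ Icc 0 F.ℓ, g.cov (F.γ z a) J s ≠ 0 := by
    rw [Function.ne_iff]
    constructor
    · rintro ⟨s, hs⟩
      exact ⟨s, s.2, by rw [← hW' s]; exact hs⟩
    · rintro ⟨s, hs, h⟩
      exact ⟨⟨s, hs⟩, by rw [hW']; exact h⟩
  rw [hW0, g.isSpacelike_iff, g.isSpacelike_iff, h₁, h₂, hW', hW']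
  exact ⟨(F.frame hn hz ha).pos_iff hJ s₁.2 s₂.2 hne' hJ₁ hJ₂ lam,
    (F.frame hn hz ha).pos_iff hJ s₂.2 s₁.2 hne'.symm hJ₂ hJ₁ lam⟩

theorem existsUnique_decomposition (hn : 1 ≤ n) (hz : z ∈ F.Z) (ha : a ∈ F.A)
    {ζ : Fin n → ℝ} {α : Fin (n - 1) → ℝ} {s₁ s₂ : Icc 0 F.ℓ} (hne : s₁ ≠ s₂)
    {ξ₁ : TangentSpace (𝓡 (n + 1)) (F.γ z a s₁) →L[ℝ] ℝ}
    {ξ₂ : TangentSpace (𝓡 (n + 1)) (F.γ z a s₂) →L[ℝ] ℝ} (h₁ : F.Solves z a ζ α s₁ ξ₁)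
    (h₂ : F.Solves z a ζ α s₂ ξ₂) :
    ∃! p : (Icc 0 F.ℓ → ModelSpace n) × ℝ, p.1 ∈ F.spaceJ' z a s₁ s₂ ∧
      g.raise _ ξ₁ = p.1 s₁ + p.2 • vel n (F.γ z a) s₁ ∧
      g.raise _ ξ₂ = p.1 s₂ + p.2 • vel n (F.γ z a) s₂ := by
  have hne' : (s₁ : ℝ) ≠ s₂ := fun h ↦ hne (Subtype.ext h)
  obtain ⟨J, hJ, hJ₁, hJ₂, lam, e₁, e₂⟩ := (F.frame hn hz ha).exists_decomposition s₁.2 s₂.2 hne'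
    (v₁ := g.raise _ ξ₁) (v₂ := g.raise _ ξ₂) h₁.ortho (fun J hJ ↦ h₁.pairing h₂ hJ)
  refine ⟨(fun s ↦ g.cov (F.γ z a) J s, lam), ⟨mem_spaceJ'_iff.2 ⟨J, hJ, hJ₁, hJ₂, fun s ↦ rfl⟩,
    e₁, e₂⟩, ?_⟩
  rintro ⟨W, μ⟩ ⟨hW, f₁, -⟩
  obtain ⟨K, hK, hK₁, hK₂, hWK⟩ := mem_spaceJ'_iff.1 hW
  rw [hWK] at f₁
  obtain ⟨h1, h2⟩ := (F.frame hn hz ha).cov_eq_of_decomposition hK hJ s₁.2 s₂.2 hne' hK₁ hK₂ hJ₁ hJ₂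
    (f₁.symm.trans e₁)
  exact Prod.ext (funext fun s ↦ (hWK s).trans (h2 s s.2)) h1

theorem isSpacelike_both_or_isLightlike_both (hn : 1 ≤ n) (hz : z ∈ F.Z) (ha : a ∈ F.A)
    {ζ : Fin n → ℝ} {α : Fin (n - 1) → ℝ} {s₁ s₂ : Icc 0 F.ℓ}
    {ξ₁ : TangentSpace (𝓡 (n + 1)) (F.γ z a s₁) →L[ℝ] ℝ}
    {ξ₂ : TangentSpace (𝓡 (n + 1)) (F.γ z a s₂) →L[ℝ] ℝ} (h₁ : F.Solves z a ζ α s₁ ξ₁)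
    (h₂ : F.Solves z a ζ α s₂ ξ₂) :
    (g.IsSpacelike _ ξ₁ ∧ g.IsSpacelike _ ξ₂) ∨ (g.IsLightlike _ ξ₁ ∧ g.IsLightlike _ ξ₂) := by
  have hiff : g.IsSpacelike _ ξ₁ ↔ g.IsSpacelike _ ξ₂ := by
    by_cases hs : s₁ = s₂
    · subst hs
      rw [g.raise_injective _ ((F.frame hn hz ha).eq_of_pairing s₁.2 fun J hJ ↦ h₁.pairing h₂ hJ)]
    · obtain ⟨p, ⟨hp, e₁, e₂⟩, -⟩ := existsUnique_decomposition hn hz ha hs h₁ h₂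
      have h := isSpacelike_iff_of_decomposition hn hz ha hs hp e₁ e₂
      exact h.1.trans h.2.symm
  by_cases h : g.IsSpacelike _ ξ₁
  · exact Or.inl ⟨h, hiff.1 h⟩
  · exact Or.inr ⟨h₁.isLightlike hz ha h, h₂.isLightlike hz ha (hiff.not.1 h)⟩

theorem heq_of_solves (hn : 1 ≤ n) (hz : z ∈ F.Z) (ha : a ∈ F.A)
    {ζ : Fin n → ℝ} {α : Fin (n - 1) → ℝ} {s₁ s₂ : Icc 0 F.ℓ}
    {ξ₁ : TangentSpace (𝓡 (n + 1)) (F.γ z a s₁) →L[ℝ] ℝ}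
    {ξ₂ : TangentSpace (𝓡 (n + 1)) (F.γ z a s₂) →L[ℝ] ℝ} (h₁ : F.Solves z a ζ α s₁ ξ₁)
    (h₂ : F.Solves z a ζ α s₂ ξ₂) (hs : s₁ = s₂) : ξ₁ ≍ ξ₂ := by
  subst hs
  exact heq_of_eq (g.raise_injective _
    ((F.frame hn hz ha).eq_of_pairing s₁.2 fun J hJ ↦ h₁.pairing h₂ hJ))

/-- A Jacobi field that vanishes twice agrees with a member of `𝒥` on `[0, ℓ]` only. This suffices
because elements of `spaceJ'` are compared on `[0, ℓ]`. -/
theorem mem_spaceJ'_iff_exists_isJacobi (hn : 1 ≤ n) (hz : z ∈ F.Z) (ha : a ∈ F.A)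
    {s₁ s₂ : Icc 0 F.ℓ} (hne : s₁ ≠ s₂) {W : Icc 0 F.ℓ → ModelSpace n} :
    W ∈ F.spaceJ' z a s₁ s₂ ↔ ∃ J : ℝ → ModelSpace n, (F.calculus hz ha).IsJacobi J ∧
      J s₁ = 0 ∧ J s₂ = 0 ∧ ∀ s : Icc 0 F.ℓ, W s = g.cov (F.γ z a) J s := by
  have hne' : (s₁ : ℝ) ≠ s₂ := fun h ↦ hne (Subtype.ext h)
  rw [mem_spaceJ'_iff]
  constructor
  · rintro ⟨J, hJ, h⟩
    exact ⟨J, (F.frame hn hz ha).isJacobi_of_mem hJ, h⟩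
  · rintro ⟨J, hJ, hJ₁, hJ₂, hW⟩
    obtain ⟨L, hL, hLJ⟩ := (F.frame hn hz ha).exists_eq_of_vanish hJ s₁.2 s₂.2 hne' hJ₁ hJ₂
    refine ⟨L, hL, (hLJ s₁ s₁.2).trans hJ₁, (hLJ s₂ s₂.2).trans hJ₂, fun s ↦ (hW s).trans ?_⟩
    exact NullGeodesicCalculus.cov_congr (N := F.calculus hz ha) hJ.1
      ((F.frame hn hz ha).isJacobi_of_mem hL).1 (fun t ht ↦ (hLJ t ht).symm) s.2

theorem exists_isSpacelike_iff (hn : 1 ≤ n) (hz : z ∈ F.Z) (ha : a ∈ F.A)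
    {s₁ s₂ : Icc 0 F.ℓ} (hne : s₁ ≠ s₂) :
    (∃ (ζ : Fin n → ℝ) (α : Fin (n - 1) → ℝ)
        (ξ₁ : TangentSpace (𝓡 (n + 1)) (F.γ z a s₁) →L[ℝ] ℝ)
        (ξ₂ : TangentSpace (𝓡 (n + 1)) (F.γ z a s₂) →L[ℝ] ℝ),
        F.Solves z a ζ α s₁ ξ₁ ∧ F.Solves z a ζ α s₂ ξ₂ ∧
        g.IsSpacelike _ ξ₁ ∧ g.IsSpacelike _ ξ₂) ↔ g.AreConjugate (F.γ z a) F.ℓ s₁ s₂ := by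
  have hne' : (s₁ : ℝ) ≠ s₂ := fun h ↦ hne (Subtype.ext h)
  let 𝒦 := F.frame hn hz ha
  constructor
  · rintro ⟨ζ, α, ξ₁, ξ₂, h₁, h₂, hs₁, -⟩
    obtain ⟨⟨W, lam⟩, ⟨hW, e₁, e₂⟩, -⟩ := existsUnique_decomposition hn hz ha hne h₁ h₂
    have hW0 := (isSpacelike_iff_of_decomposition hn hz ha hne hW e₁ e₂).1.1 hs₁
    obtain ⟨J, hJ, hJ₁, hJ₂, hWJ⟩ := mem_spaceJ'_iff.1 hW
    refine ⟨hne', J, 𝒦.isJacobi_of_mem hJ, hJ₁, hJ₂, ?_⟩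
    by_contra! hJ0
    refine hW0 (funext fun s ↦ ?_)
    exact (hWJ s).trans
      ((F.calculus hz ha).cov_zero J (𝒦.isJacobi_of_mem hJ).1 (fun t ht ↦ hJ0 t ht) s s.2)
  · rintro ⟨-, J, hJ, hJ₁, hJ₂, s, hs, hJs⟩
    replace hJ : (F.calculus hz ha).IsJacobi J := hJ
    obtain ⟨L, hL, hLJ⟩ := 𝒦.exists_eq_of_vanish hJ s₁.2 s₂.2 hne' hJ₁ hJ₂
    have hLjac := 𝒦.isJacobi_of_mem hL
    have hL₁ : L s₁ = 0 := (hLJ s₁ s₁.2).trans hJ₁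
    have hL₂ : L s₂ = 0 := (hLJ s₂ s₂.2).trans hJ₂
    -- `L(s₁) = 0`, so `L'(s₁) = 0` would make `L` vanish identically on `[0, ℓ]`.
    have hcov : ∃ t ∈ Icc 0 F.ℓ, g.cov (F.γ z a) L t ≠ 0 := by
      refine ⟨s₁, s₁.2, fun h0 ↦ hJs ?_⟩
      exact (hLJ s hs).symm.trans (𝒦.eq_zero_of_data hLjac s₁.2 hL₁ h0 hs)
    have hpair (i) := 𝒦.pairing_of_vanish hLjac s₁.2 s₂.2 hL₁ hL₂
      (Submodule.subset_span (mem_range_self i))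
    -- Take `ξ^j = (L'(s_j), ·)`, that is `λ = 0`, and read `ζ`, `α` off at `s₁`. The Wronskian
    -- shows that they take the same values at `s₂`.
    refine ⟨fun j ↦ g.form (F.γ z a s₁) (g.cov (F.γ z a) L s₁) (F.fieldM z a j s₁),
      fun k ↦ g.form (F.γ z a s₁) (g.cov (F.γ z a) L s₁) (F.fieldJ z a k s₁),
      g.form (F.γ z a s₁) (g.cov (F.γ z a) L s₁), g.form (F.γ z a s₂) (g.cov (F.γ z a) L s₂),
      ⟨fun j ↦ rfl, fun k ↦ rfl, 𝒦.ortho_of_mem hL s₁.2⟩,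
      ⟨fun j ↦ hpair (Sum.inl (Sum.inl j)), fun k ↦ hpair (Sum.inl (Sum.inr k)),
        𝒦.ortho_of_mem hL s₂.2⟩, ?_, ?_⟩
    · refine (g.isSpacelike_form_iff _ _).2 ?_
      have h := (𝒦.pos_iff hL s₁.2 s₂.2 hne' hL₁ hL₂ 0).2 hcov
      rwa [zero_smul, add_zero] at h
    · refine (g.isSpacelike_form_iff _ _).2 ?_
      have h := (𝒦.pos_iff hL s₂.2 s₁.2 hne'.symm hL₂ hL₁ 0).2 hcov
      rwa [zero_smul, add_zero] at h

end NullGeodesicFamily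

end Covectors

end

/-! ### The lemma. -/

theorem lemma3p5 {n : ℕ} (hn : 2 ≤ n) {M : Type*} [TopologicalSpace M] [T2Space M]
    [ChartedSpace (EuclideanSpace ℝ (Fin (n + 1))) M] [IsManifold (𝓡 (n + 1)) ∞ M]
    (g : LorentzianMetric n M) (F : NullGeodesicFamily g)
    (z : EuclideanSpace ℝ (Fin n)) (hz : z ∈ F.Z)
    (a : EuclideanSpace ℝ (Fin (n - 1))) (ha : a ∈ F.A) :
    (∀ (ζ : Fin n → ℝ) (α : Fin (n - 1) → ℝ) (s₁ s₂ : Icc 0 F.ℓ)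
      (ξ₁ : TangentSpace (𝓡 (n + 1)) (F.γ z a s₁) →L[ℝ] ℝ)
      (ξ₂ : TangentSpace (𝓡 (n + 1)) (F.γ z a s₂) →L[ℝ] ℝ),
      F.Solves z a ζ α s₁ ξ₁ → F.Solves z a ζ α s₂ ξ₂ →
      -- (i)
      ((g.IsSpacelike _ ξ₁ ∧ g.IsSpacelike _ ξ₂) ∨ (g.IsLightlike _ ξ₁ ∧ g.IsLightlike _ ξ₂)) ∧
      -- (ii)
      (s₁ = s₂ → ξ₁ ≍ ξ₂) ∧
      -- (iii)
      (s₁ ≠ s₂ →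
        (∃! p : (∀ s : Icc 0 F.ℓ, TangentSpace (𝓡 (n + 1)) (F.γ z a s)) × ℝ,
          p.1 ∈ F.spaceJ' z a s₁ s₂ ∧
          g.sharp _ ξ₁ = p.1 s₁ + p.2 • velocity (F.γ z a) s₁ ∧
          g.sharp _ ξ₂ = p.1 s₂ + p.2 • velocity (F.γ z a) s₂) ∧
        ∀ W ∈ F.spaceJ' z a s₁ s₂, ∀ lam : ℝ,
          g.sharp _ ξ₁ = W s₁ + lam • velocity (F.γ z a) s₁ →
          g.sharp _ ξ₂ = W s₂ + lam • velocity (F.γ z a) s₂ →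
          ((g.IsSpacelike _ ξ₁ ∧ g.IsSpacelike _ ξ₂) ↔ W ≠ 0))) ∧
    -- `𝒥'_{s₁,s₂}` consists of the derivatives of all Jacobi fields vanishing at `s₁` and `s₂`
    (∀ s₁ s₂ : Icc 0 F.ℓ, s₁ ≠ s₂ →
      F.spaceJ' z a s₁ s₂ =
        {W | ∃ J, g.IsJacobiField (F.γ z a) (Icc 0 F.ℓ) J ∧ J s₁ = 0 ∧ J s₂ = 0 ∧
          ∀ s : Icc 0 F.ℓ, W s = g.covDeriv (F.γ z a) J s}) ∧
    -- distinct spacelike solutions exist precisely over conjugate points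
    (∀ s₁ s₂ : Icc 0 F.ℓ, s₁ ≠ s₂ →
      ((∃ (ζ : Fin n → ℝ) (α : Fin (n - 1) → ℝ)
        (ξ₁ : TangentSpace (𝓡 (n + 1)) (F.γ z a s₁) →L[ℝ] ℝ)
        (ξ₂ : TangentSpace (𝓡 (n + 1)) (F.γ z a s₂) →L[ℝ] ℝ),
        F.Solves z a ζ α s₁ ξ₁ ∧ F.Solves z a ζ α s₂ ξ₂ ∧
        g.IsSpacelike _ ξ₁ ∧ g.IsSpacelike _ ξ₂) ↔
      g.AreConjugate (F.γ z a) F.ℓ s₁ s₂)) := by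
  have hn' : 1 ≤ n := by omega
  refine ⟨fun ζ α s₁ s₂ ξ₁ ξ₂ h₁ h₂ ↦ ⟨?_, ?_, fun hne ↦ ⟨?_, fun W hW lam e₁ e₂ ↦ ?_⟩⟩,
    fun s₁ s₂ hne ↦ ?_, fun s₁ s₂ hne ↦ ?_⟩
  · exact NullGeodesicFamily.isSpacelike_both_or_isLightlike_both hn' hz ha h₁ h₂
  · exact NullGeodesicFamily.heq_of_solves hn' hz ha h₁ h₂
  · exact NullGeodesicFamily.existsUnique_decomposition hn' hz ha hne h₁ h₂
  · have h := NullGeodesicFamily.isSpacelike_iff_of_decomposition hn' hz ha hne hW e₁ e₂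
    exact ⟨fun h' ↦ h.1.1 h'.1, fun h' ↦ ⟨h.1.2 h', h.2.2 h'⟩⟩
  · ext W
    exact NullGeodesicFamily.mem_spaceJ'_iff_exists_isJacobi hn' hz ha hne
  · exact NullGeodesicFamily.exists_isSpacelike_iff hn' hz ha hne
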